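/- **Setting.** Let $L$ be the finite language with symbols $0,1,+,\cdot,\le$, a binary symbol $\langle x,y\rangle$ and unary symbols $\pi_1,\pi_2$ for a pairing function and its projections (bit-interleaving, in the standard model), and a unary symbol $|x|$ for the bit-length of $x$. Let ${\cal M}$ be an $\aleph_1$-saturated model of true arithmetic in $L$ (i.e. elementarily equivalent to the standard model $\mathbf N$); such non-standard models exist. For an ${\cal M}$-finite set $\Omega$, let $\mathcal A$ be the Boolean algebra of subsets of $\Omega$ definable in ${\cal M}$ with parameters, ${\cal I}$ the ideal of those $U$ with $k|U|\le|\Omega|$ for all standard $k$ (cardinalities in the sense of ${\cal M}$), and $\mathcal B=\mathcal A/{\cal I}$. Let $F$ be a family of functions $\Omega\to{\cal M}$ that are elements of ${\cal M}$. * $F$ is $L$-closed if $f(\alpha_1,\dots,\alpha_m)$, computed pointwise, is in $F$ for all function symbols $f$ of $L$ and $\alpha_i\in F$. * $F$ is closed under definition by cases by open formulas if for all $\alpha,\beta\in F$ and every open $L(F)$-formula $B(x)$ there is $\gamma\in F$ with $\gamma(\omega)=\alpha(\omega)$ if $B(\alpha(\omega))$ holds (the parameters from $F$ also being evaluated at $\omega$),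 and $\gamma(\omega)=\beta(\omega)$ otherwise. * $F$ is compact if there is an $L$-formula $H(x,y)$, with parameters from ${\cal M}$, such that the sets $F_k=\{b\in{\cal M}\mid{\cal M}\models H(k,b)\}$ satisfy $F_k\supseteq F_{k+1}$ for all $k\in\mathbf N$ and $\bigcap_{k\in\mathbf N}F_k=F$. * In $K(F)$, an atomic $L(F)$-sentence has as truth value the class in $\mathcal B$ of the set of samples $\omega$ at which it holds in ${\cal M}$; truth values commute with connectives, and $[\![\exists xA(x)]\!]=\bigvee_{\alpha\in F}[\![A(\alpha)]\!]$, $[\![\forall xA(x)]\!]=\bigwedge_{\alpha\in F}[\![A(\alpha)]\!]$. * $K(F)$ has pairing if the universal closures of $\langle\pi_1(z),\pi_2(z)\rangle=z$, $\pi_1(\langle x,y\rangle)=x$, $\pi_2(\langle x,y\rangle)=y$ have truth value $1$. * $u\in F$ realizes (Satur) for a set ${\mathbf p}$ of $L(F)$-formulas in one variable if $\bigwedge_{\Phi\subseteq{\mathbf p}\text{ finite}}[\![\exists x\bigwedge_{A\in\Phi}A(x)]\!]\le\bigwedge_{A\in{\mathbf p}}[\![A(u)]\!]$. **Theorem.**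 Let $n\in{\cal M}$ be non-standard and $\Omega=\{0,1\}^n$ (the numbers below $2^n$). Let $F$ be the family of all functions on $\Omega$ that are computed, in ${\cal M}$, by Boolean circuits with $n$ inputs, arbitrarily many outputs, and size (gates plus outputs) at most $2^{\lfloor n^{1/k}\rfloor}$, for every standard $k\ge1$. Then $\mathcal B$ is a complete Boolean algebra, $F$ is $L$-closed, closed under definition by cases by open $L$-formulas and compact, and $K(F)$ has pairing. Moreover the identity function $\mathrm{id}$ on $\Omega$ is in $F$, and for the countable set of universal $L(F)$-formulas $$A_k(x)\ :=\ \forall y\,\bigl(|x|^k\le|\mathrm{id}|\ \wedge\ |y|\ne x\bigr),\qquad k\ge1$$ (the prenex form of $|x|^k\le|\mathrm{id}|\wedge\forall y(|y|\ne x)$), no element of $K(F)$ realizes (Satur). In particular, there are a finite language $L$ and a family $F$ with all these closure properties for which (Satur) fails for a countable set of universal formulas in one variable. -/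

import Mathlib

open FirstOrder FirstOrder.Language Set

noncomputable section

/-! ### The finite language of arithmetic, and its standard interpretation -/

/-- Function symbols: `0`, `1`, `+`, `·`, a pairing function with its two projections, and the
bit-length `|x|`. -/
inductive ArithFunc : ℕ → Type
  | zero : ArithFunc 0
  | one : ArithFunc 0
  | add : ArithFunc 2
  | mul : ArithFunc 2
  | pair : ArithFunc 2
  | proj1 : ArithFunc 1
  | proj2 : ArithFunc 1
  | len : ArithFunc 1

/-- The only relation symbol besides equality is `≤`. -/
inductive ArithRel : ℕ → Type
  | le : ArithRel 2

/-- The language of Peano arithmetic with `≤`, pairing, projections and bit-length. -/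
def LA : Language := ⟨ArithFunc, ArithRel⟩

/-- The pairing on `ℕ` that interleaves bits: bit `i` of `a` becomes bit `2i`, and bit `i` of `b`
becomes bit `2i+1`. -/
def natPair (a b : ℕ) : ℕ :=
  Nat.ofDigits 4 (Nat.digits 2 a) + 2 * Nat.ofDigits 4 (Nat.digits 2 b)

/-- The number formed by the bits of `z` in even positions. -/
def natProj1 (z : ℕ) : ℕ := Nat.ofDigits 2 ((Nat.digits 4 z).map (fun d => d % 2))

/-- The number formed by the bits of `z` in odd positions. -/
def natProj2 (z : ℕ) : ℕ := Nat.ofDigits 2 ((Nat.digits 4 z).map (fun d => d / 2))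

/-- The standard model; the bit-length of `x` is `Nat.size x`. -/
instance natStructure : LA.Structure ℕ where
  funMap {_} f v :=
    match f, v with
    | ArithFunc.zero, _ => 0
    | ArithFunc.one, _ => 1
    | ArithFunc.add, v => v 0 + v 1
    | ArithFunc.mul, v => v 0 * v 1
    | ArithFunc.pair, v => natPair (v 0) (v 1)
    | ArithFunc.proj1, v => natProj1 (v 0)
    | ArithFunc.proj2, v => natProj2 (v 0)
    | ArithFunc.len, v => Nat.size (v 0)
  RelMap {_} r v :=
    match r, v with
    | ArithRel.le, v => v 0 ≤ v 1

def zeroS : LA.Functions 0 := ArithFunc.zero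
def oneS : LA.Functions 0 := ArithFunc.one
def addS : LA.Functions 2 := ArithFunc.add
def mulS : LA.Functions 2 := ArithFunc.mul
def pairS : LA.Functions 2 := ArithFunc.pair
def proj1S : LA.Functions 1 := ArithFunc.proj1
def proj2S : LA.Functions 1 := ArithFunc.proj2
def lenS : LA.Functions 1 := ArithFunc.len
def leS : LA.Relations 2 := ArithRel.le

/-! ### Models of true arithmetic -/

/-- `ℵ₁`-saturation: every set of formulas in one variable, with parameters from a countable set
`A`, that is finitely satisfiable in `M` is satisfied by an element of `M`. -/
def Aleph1Saturated (M : Type*) [LA.Structure M] : Prop :=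
  ∀ A : Set M, A.Countable → ∀ p : Set (LA.Formula (A ⊕ Unit)),
    (∀ Φ : Finset (LA.Formula (A ⊕ Unit)), (Φ : Set (LA.Formula (A ⊕ Unit))) ⊆ p →
      ∃ x : M, ∀ φ ∈ Φ, φ.Realize (Sum.elim (fun a : A => (a : M)) (fun _ => x))) →
    ∃ x : M, ∀ φ ∈ p, φ.Realize (Sum.elim (fun a : A => (a : M)) (fun _ => x))

section Model

variable {M : Type*} [LA.Structure M]

/-- The standard number `k` in `M`. -/
def num (M : Type*) [LA.Structure M] : ℕ → M
  | 0 => Structure.funMap zeroS ![]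
  | k + 1 => Structure.funMap addS ![num M k, Structure.funMap oneS ![] ]

def Nonstandard (a : M) : Prop := ∀ k : ℕ, a ≠ num M k

open Classical in
/-- A formula that defines the relation `R` in the standard model (all relations to which this is
applied below are arithmetical, so that the default `⊥` is not used for them). -/
def definingFormula {m : ℕ} (R : (Fin m → ℕ) → Prop) : LA.Formula (Fin m) :=
  if h : ∃ φ : LA.Formula (Fin m), ∀ v, φ.Realize v ↔ R v then h.choose else ⊥

/-- The meaning in `M` of an arithmetical relation `R` on `ℕ`. If `M` is elementarily equivalent
to `ℕ`, it does not depend on the choice of the defining formula. -/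
def interp {m : ℕ} (R : (Fin m → ℕ) → Prop) (v : Fin m → M) : Prop :=
  (definingFormula R).Realize v

/-- Finite sets of natural numbers are identified with natural numbers, `s` with
`∑_{i ∈ s} 2^i`. -/
def setCode (s : Finset ℕ) : ℕ := ∑ i ∈ s, 2 ^ i

/-- In `M`: `x` is an element of the `M`-finite set `u`. -/
def MMem (x u : M) : Prop := interp (fun v => (v 1).testBit (v 0) = true) ![x, u]

/-- The `M`-finite set `u` is the set `U`. -/
def CodesSet (u : M) (U : Set M) : Prop := ∀ x, MMem x u ↔ x ∈ U

/-- The `M`-finite set `b` is the graph of the function `α` on `Ω`, a set of pairs. -/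
def CodesFun {Ω : Set M} (b : M) (α : Ω → M) : Prop :=
  (∀ (ω : Ω) (v : M), MMem (Structure.funMap pairS ![(ω : M), v]) b ↔ v = α ω) ∧
    ∀ x, MMem x b → ∃ (ω : Ω) (v : M), x = Structure.funMap pairS ![(ω : M), v]

/-- The functions `Ω → M` that are elements of `M`. A family of random variables is a set of
these. -/
def RV (Ω : Set M) : Type _ := {α : Ω → M // ∃ b : M, CodesFun b α}

instance (Ω : Set M) : CoeFun (RV Ω) (fun _ => Ω → M) := ⟨Subtype.val⟩

/-! ### The Boolean algebra of truth values -/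

/-- The Boolean algebra of `M`-definable (with parameters) subsets of `Ω`. -/
def events (Ω : Set M) : BooleanSubalgebra (Set Ω) where
  carrier := {U | ∃ D : Set M, (univ : Set M).Definable₁ LA D ∧ U = Subtype.val ⁻¹' D}
  supClosed' := by
    rintro _ ⟨D, hD, rfl⟩ _ ⟨E, hE, rfl⟩
    exact ⟨D ∪ E, hD.union hE, rfl⟩
  infClosed' := by
    rintro _ ⟨D, hD, rfl⟩ _ ⟨E, hE, rfl⟩
    exact ⟨D ∩ E, hD.inter hE, rfl⟩
  compl_mem' := by
    rintro _ ⟨D, hD, rfl⟩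
    exact ⟨Dᶜ, hD.compl, rfl⟩
  bot_mem' := ⟨∅, definable_empty, rfl⟩

/-- `U` has infinitesimal counting measure in `Ω`: for every standard `k`, it holds in `M` that
`k |U| ≤ |Ω|`. -/
def Infinitesimal {Ω : Set M} (U : Set Ω) : Prop :=
  ∀ k : ℕ, ∃ u w : M, CodesSet u (Subtype.val '' U) ∧ CodesSet w Ω ∧
    interp (fun v => ∃ s t : Finset ℕ, v 0 = setCode s ∧ v 1 = setCode t ∧ k * s.card ≤ t.card)
      ![u, w]

/-- The ideal of the events of infinitesimal counting measure, in the Boolean ring of events. -/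
def nullIdeal (Ω : Set M) : Ideal (AsBoolRing (events Ω)) :=
  Ideal.span {a | Infinitesimal ((ofBoolRing a : events Ω) : Set Ω)}

instance (Ω : Set M) : BooleanRing (AsBoolRing (events Ω) ⧸ nullIdeal Ω) where
  isIdempotentElem := by
    intro a
    obtain ⟨a, rfl⟩ := Ideal.Quotient.mk_surjective a
    have h : a * a = a := BooleanRing.isIdempotentElem a
    change Ideal.Quotient.mk _ a * Ideal.Quotient.mk _ a = Ideal.Quotient.mk _ a
    rw [← map_mul, h]

/-- The Boolean algebra of truth values: events modulo events of infinitesimal measure. -/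
abbrev TruthAlg (Ω : Set M) : Type _ := AsBoolAlg (AsBoolRing (events Ω) ⧸ nullIdeal Ω)

/-- The class of an event. -/
def cls {Ω : Set M} (U : events Ω) : TruthAlg Ω :=
  toBoolAlg (Ideal.Quotient.mk (nullIdeal Ω) (toBoolRing U))

open Classical in
/-- Greatest lower bound; it always exists in a complete Boolean algebra. -/
def meet {B : Type*} [BooleanAlgebra B] (S : Set B) : B :=
  if h : ∃ b, IsGLB S b then h.choose else ⊥

open Classical in
/-- Least upper bound; it always exists in a complete Boolean algebra. -/
def join {B : Type*} [BooleanAlgebra B] (S : Set B) : B :=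
  if h : ∃ b, IsLUB S b then h.choose else ⊥

/-! Pointwise truth sets of atomic formulas are events. -/

/-- `g : Ω → M` is the restriction of a definable relation. -/
def DefGraph {Ω : Set M} (g : Ω → M) : Prop :=
  ∃ D : Set (Fin 2 → M), (univ : Set M).Definable LA D ∧
    ∀ (ω : Ω) (v : M), ![(ω : M), v] ∈ D ↔ v = g ω

/-- Substituting functions with definable graphs into a definable relation. -/
theorem definable_subst {Ω : Set M} {n m : ℕ} (g : Fin n → Ω → M) (hg : ∀ i, DefGraph (g i))
    (E : Set ((Fin m ⊕ Fin n) → M)) (hE : (univ : Set M).Definable LA E) (j : Fin m) :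
    ∃ D : Set (Fin m → M), (univ : Set M).Definable LA D ∧
      ∀ (q : Fin m → M) (ω : Ω), q j = ω →
        (q ∈ D ↔ Sum.elim q (fun i => g i ω) ∈ E) := by
  choose G hG hGg using hg
  let E' : Set ((Fin m ⊕ Fin n) → M) :=
    E ∩ ⋂ i : Fin n, (fun w : (Fin m ⊕ Fin n) → M => w ∘ ![Sum.inl j, Sum.inr i]) ⁻¹' G i
  have hE' : (univ : Set M).Definable LA E' :=
    hE.inter (definable_iInter_of_finite fun i => (hG i).preimage_comp _)
  refine ⟨_, hE'.image_comp_sumInl_fin n, ?_⟩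
  intro q ω hq
  have key : ∀ (w : (Fin m ⊕ Fin n) → M) (i : Fin n), w ∘ Sum.inl = q →
      (w ∘ ![Sum.inl j, Sum.inr i] ∈ G i ↔ w (Sum.inr i) = g i ω) := by
    intro w i hw
    have h1 : w (Sum.inl j) = ω := by rw [← hq, ← hw]; rfl
    have : w ∘ ![Sum.inl j, Sum.inr i] = ![(ω : M), w (Sum.inr i)] := by
      funext x
      fin_cases x
      · exact h1
      · rfl
    rw [this, hGg]
  constructor
  · rintro ⟨w, ⟨hwE, hwG⟩, hwq⟩
    have : w = Sum.elim q (fun i => g i ω) := by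
      funext x
      rcases x with x | i
      · rw [← hwq]; rfl
      · exact (key w i hwq).1 (mem_iInter.1 hwG i)
    rwa [← this]
  · intro h
    refine ⟨_, ⟨h, mem_iInter.2 fun i => ?_⟩, ?_⟩
    · exact (key _ i (by funext x; rfl)).2 rfl
    · funext x; rfl

theorem RV.defGraph {Ω : Set M} (α : RV Ω) : DefGraph α := by
  obtain ⟨α, b, hb⟩ := α
  refine ⟨{q | MMem (Structure.funMap pairS ![q 0, q 1]) b}, ?_, fun ω v => hb.1 ω v⟩
  rw [definable_iff_exists_formula_sum]
  let tt : Fin 2 → LA.Term ((univ : Set M) ⊕ Fin 2) :=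
    ![Functions.apply₂ pairS (Term.var (Sum.inr 0)) (Term.var (Sum.inr 1)),
      Term.var (Sum.inl ⟨b, mem_univ b⟩)]
  refine ⟨(definingFormula fun v => (v 1).testBit (v 0) = true).subst tt, ?_⟩
  ext q
  have : (fun a => (tt a).realize (Sum.elim (fun a : (univ : Set M) => (a : M)) q)) =
      ![Structure.funMap pairS ![q 0, q 1], b] := by
    funext x
    fin_cases x
    · simp [tt]
    · simp [tt]
  change MMem _ _ ↔ BoundedFormula.Realize (BoundedFormula.subst _ _) _ _
  rw [BoundedFormula.realize_subst, this]
  rfl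

/-- The pointwise value of a term at random variables has a definable graph. -/
theorem defGraph_term {Ω : Set M} {β : Type*} (x : β → RV Ω) (t : LA.Term β) :
    DefGraph (fun ω => t.realize (fun i => x i ω)) := by
  induction t with
  | var i => exact (x i).defGraph
  | func f ts ih =>
    obtain ⟨D, hD, h⟩ := definable_subst (m := 2) _ ih
      {w | w (Sum.inl 1) = Structure.funMap f (fun i => w (Sum.inr i))} (by
        rw [definable_iff_exists_formula_sum]
        refine ⟨Term.equal (Term.var (Sum.inr (Sum.inl 1)))
          (Term.func f fun i => Term.var (Sum.inr (Sum.inr i))), ?_⟩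
        ext w
        simp [Formula.realize_equal]) 0
    refine ⟨D, hD, fun ω v => ?_⟩
    rw [h _ ω rfl]
    rfl

theorem definable_image_fin_one {D : Set (Fin 1 → M)} (hD : (univ : Set M).Definable LA D) :
    (univ : Set M).Definable₁ LA {x | ![x] ∈ D} := by
  have : {q : Fin 1 → M | q 0 ∈ {x | ![x] ∈ D}} = D := by
    ext q
    have : ![q 0] = q := by funext i; fin_cases i; rfl
    simp [this]
  unfold Definable₁
  rw [this]
  exact hD

theorem equal_mem_events {Ω : Set M} {β : Type*} (x : β → RV Ω) (s t : LA.Term β) :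
    {ω : Ω | s.realize (fun i => x i ω) = t.realize (fun i => x i ω)} ∈ events Ω := by
  obtain ⟨D, hD, h⟩ := definable_subst (m := 1)
    (fun i : Fin 2 => fun ω : Ω => ((![s, t] : Fin 2 → LA.Term β) i).realize (fun k => x k ω))
    (fun i => defGraph_term x _)
    {w | w (Sum.inr 0) = w (Sum.inr 1)} (by
      rw [definable_iff_exists_formula_sum]
      refine ⟨Term.equal (Term.var (Sum.inr (Sum.inr 0))) (Term.var (Sum.inr (Sum.inr 1))), ?_⟩
      ext w
      simp [Formula.realize_equal]) 0
  refine ⟨_, definable_image_fin_one hD, ?_⟩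
  ext ω
  exact (h _ ω rfl).symm

theorem rel_mem_events {Ω : Set M} {β : Type*} (x : β → RV Ω) {n : ℕ} (R : LA.Relations n)
    (ts : Fin n → LA.Term β) :
    {ω : Ω | Structure.RelMap R (fun j => (ts j).realize (fun i => x i ω))} ∈ events Ω := by
  obtain ⟨D, hD, h⟩ := definable_subst (m := 1)
    (fun j => fun ω : Ω => (ts j).realize (fun k => x k ω))
    (fun i => defGraph_term x _)
    {w | Structure.RelMap R (fun j => w (Sum.inr j))} (by
      rw [definable_iff_exists_formula_sum]
      refine ⟨Relations.formula R (fun j => Term.var (Sum.inr (Sum.inr j))), ?_⟩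
      ext w
      simp [Formula.realize_rel]) 0
  refine ⟨_, definable_image_fin_one hD, ?_⟩
  ext ω
  exact (h _ ω rfl).symm

/-! ### The Boolean-valued structure `K(F)` -/

/-- The truth value in `K(F)` of an `LA`-formula under an assignment of elements of `F` to its
free variables. The primitive connectives of formulas are `⊥`, `→`, `∀`; the other ones are
defined from them. -/
def truth {Ω : Set M} (F : Set (RV Ω)) {β : Type*} :
    ∀ {n : ℕ}, LA.BoundedFormula β n → (β → F) → (Fin n → F) → TruthAlg Ω
  | _, .falsum, _, _ => ⊥
  | _, .equal s t, v, xs =>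
      cls ⟨_, equal_mem_events (fun i => ((Sum.elim v xs i : F) : RV Ω)) s t⟩
  | _, .rel R ts, v, xs =>
      cls ⟨_, rel_mem_events (fun i => ((Sum.elim v xs i : F) : RV Ω)) R ts⟩
  | _, .imp φ ψ, v, xs => (truth F φ v xs)ᶜ ⊔ truth F ψ v xs
  | _, .all φ, v, xs => meet {b | ∃ y : F, b = truth F φ v (Fin.snoc xs y)}

/-- `L(F)`-formulas in one free variable: formulas whose free variables are either (names of)
elements of `F`, or the variable `x`, the only element of `Unit`. -/
abbrev FormulaF {Ω : Set M} (F : Set (RV Ω)) : Type _ := LA.Formula (F ⊕ Unit)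

/-- The truth value of `A(u)`. -/
def truthAt {Ω : Set M} (F : Set (RV Ω)) (A : FormulaF F) (u : F) : TruthAlg Ω :=
  truth F A (Sum.elim id (fun _ => u)) Fin.elim0

/-- The truth value of the sentence `A` is `1`. -/
def Valid {Ω : Set M} (F : Set (RV Ω)) (A : LA.Sentence) : Prop :=
  truth F A Empty.elim Fin.elim0 = ⊤

/-- `u` realizes (Satur) for `p`: the meet over the finite `Φ ⊆ p` of the truth values of
`∃ x ⋀_{A ∈ Φ} A(x)` is below the meet of the truth values of `A(u)`, `A ∈ p`. -/
def RealizesSatur {Ω : Set M} (F : Set (RV Ω)) (p : Set (FormulaF F)) (u : F) : Prop :=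
  meet {b | ∃ Φ : Finset (FormulaF F), (Φ : Set (FormulaF F)) ⊆ p ∧
      b = join {c | ∃ w : F, c = Φ.inf (fun A => truthAt F A w)}} ≤
    meet {b | ∃ A ∈ p, b = truthAt F A u}

/-- `F` is `L`-closed. -/
def LClosed {Ω : Set M} (F : Set (RV Ω)) : Prop :=
  ∀ (m : ℕ) (f : LA.Functions m) (α : Fin m → F), ∃ β ∈ F, ∀ ω : Ω,
    β ω = Structure.funMap f (fun i => (α i : RV Ω) ω)

/-- `F` is closed under definitions by cases by open formulas. -/
def CasesClosed {Ω : Set M} (F : Set (RV Ω)) : Prop :=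
  ∀ α ∈ F, ∀ β ∈ F, ∀ B : FormulaF F, B.IsQF → ∃ γ ∈ F, ∀ ω : Ω,
    (B.Realize (Sum.elim (fun a : F => (a : RV Ω) ω) (fun _ => α ω)) → γ ω = α ω) ∧
    (¬ B.Realize (Sum.elim (fun a : F => (a : RV Ω) ω) (fun _ => α ω)) → γ ω = β ω)

/-- `F` is compact: for some formula `H`, with parameters from `M`, the sets
`F_k = {b | M ⊨ H(k, b)}` form a decreasing chain for standard `k`, with intersection `F`. -/
def CompactFamily {Ω : Set M} (F : Set (RV Ω)) : Prop :=
  ∃ H : LA.Formula (M ⊕ Fin 2),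
    (⋂ k : ℕ, {b : M | H.Realize (Sum.elim id ![num M k, b])}) = {b | ∃ α ∈ F, CodesFun b α} ∧
    ∀ k : ℕ, {b : M | H.Realize (Sum.elim id ![num M (k + 1), b])} ⊆
      {b : M | H.Realize (Sum.elim id ![num M k, b])}

end Model

/-! Pairing -/

/-- `∀ z, ⟨π₁ z, π₂ z⟩ = z`. -/
def pairingAxiom0 : LA.Sentence :=
  ((pairS.apply₂ (proj1S.apply₁ &0) (proj2S.apply₁ &0)).bdEqual &0 : LA.BoundedFormula Empty 1).all

/-- `∀ x y, π₁ ⟨x, y⟩ = x`. -/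
def pairingAxiom1 : LA.Sentence :=
  ((proj1S.apply₁ (pairS.apply₂ &0 &1)).bdEqual &0 : LA.BoundedFormula Empty 2).all.all

/-- `∀ x y, π₂ ⟨x, y⟩ = y`. -/
def pairingAxiom2 : LA.Sentence :=
  ((proj2S.apply₁ (pairS.apply₂ &0 &1)).bdEqual &1 : LA.BoundedFormula Empty 2).all.all

/-- `K(F)` has pairing. -/
def HasPairing {M : Type*} [LA.Structure M] {Ω : Set M} (F : Set (RV Ω)) : Prop :=
  Valid F pairingAxiom0 ∧ Valid F pairingAxiom1 ∧ Valid F pairingAxiom2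

/-! ### Boolean circuits -/

/-- Gates of a circuit. The wires that a gate reads are given by the indices of earlier gates. -/
inductive Gate
  | const (c : Bool)
  | input (i : ℕ)
  | not (a : ℕ)
  | and (a b : ℕ)
  | or (a b : ℕ)

/-- A circuit: a list of gates, and the list of the gates whose values are the output bits. -/
structure Circuit where
  gates : List Gate
  outputs : List ℕ

/-- The value of a gate on the input string `x`, when `vals` are the values of the earlier gates.
Bits of `x` beyond its length, and wires that do not exist, carry the value `false`. -/
def Gate.eval (x : ℕ) (vals : List Bool) : Gate → Bool
  | const c => c
  | input i => x.testBit i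
  | not a => !(vals.getD a false)
  | and a b => vals.getD a false && vals.getD b false
  | or a b => vals.getD a false || vals.getD b false

/-- The values of all gates of `C` on the input string `x`. -/
def Circuit.wires (C : Circuit) (x : ℕ) : List Bool :=
  C.gates.foldl (fun vals g => vals ++ [g.eval x vals]) []

/-- The number whose bits, from the least significant one, are the output bits of `C`. -/
def Circuit.eval (C : Circuit) (x : ℕ) : ℕ :=
  Nat.ofDigits 2 (C.outputs.map fun o => ((C.wires x).getD o false).toNat)

/-- The number of gates plus the number of outputs. -/
def Circuit.size (C : Circuit) : ℕ := C.gates.length + C.outputs.length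

/-- `b` is (the code of) the graph of a function on `{0,1}^n`, i.e. on the numbers below `2^n`,
that is computed by a circuit of size at most `2^⌊n^{1/k}⌋`. -/
def SubexpComputable (k n b : ℕ) : Prop :=
  ∃ (C : Circuit) (r : ℕ), r ^ k ≤ n ∧ C.size ≤ 2 ^ r ∧
    b = setCode ((Finset.range (2 ^ n)).image fun ω => natPair ω (C.eval ω))

/-! ### The example -/

section Example

variable {M : Type*} [LA.Structure M]

/-- The sample space `{0,1}^n`: the numbers below `2^n`, i.e. of bit-length at most `n`; shorter
numbers stand for strings with leading zeros. -/
def cube (n : M) : Set M :=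
  {ω | Structure.RelMap leS ![Structure.funMap lenS ![ω], n]}

/-- The functions on `{0,1}^n` in `M` that are computed, in `M`, by circuits of size at most
`2^{n^{1/k}}`, for all standard `k ≥ 1`. -/
def circuitFamily (n : M) : Set (RV (cube n)) :=
  {α | ∃ b : M, CodesFun b α ∧
    ∀ k : ℕ, 1 ≤ k → interp (fun v => SubexpComputable (v 0) (v 1) (v 2)) ![num M k, n, b]}

/-- The term `t · … · t` with `k + 1` factors. -/
def powTerm {β : Type*} (t : LA.Term β) : ℕ → LA.Term β
  | 0 => t
  | k + 1 => mulS.apply₂ (powTerm t k) t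

/-- The universal formula `∀ y (|x|^(k+1) ≤ |ι| ∧ |y| ≠ x)`, with a parameter `ι`; this is the
prenex form of `|x|^(k+1) ≤ |ι| ∧ ∀ y (|y| ≠ x)`. -/
def formulaA {Ω : Set M} {F : Set (RV Ω)} (ι : F) (k : ℕ) : FormulaF F :=
  ((leS.boundedFormula₂ (powTerm (lenS.apply₁ (Term.var (Sum.inl (Sum.inr ())))) k)
      (lenS.apply₁ (Term.var (Sum.inl (Sum.inl ι)))) ⊓
    ∼((lenS.apply₁ &0).bdEqual (Term.var (Sum.inl (Sum.inr ()))))) :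
    LA.BoundedFormula (F ⊕ Unit) 1).all

end Example

end

/-! Failure of (Satur). The two halves of the formulas pull against each other: the first pushes |x|
below n^(1/k) for every standard k, while a number that short is the bit-length of a value of some
function in F, which the second half forbids. Finitely many of the formulas are satisfied with value
1 by a constant. With R = ⌊n^(1/(2K))⌋ and w = 2^(R+1), the values of functions in F have at most
2^R < w bits, so w is never a length; and |w| = R+2, so |w|^K ≤ n/2, which is at most |ω| for all
but infinitesimally many ω (`exists_large_const`, `infinitesimal_short`). Hence the left side of
(Satur) is 1. If u satisfied all formulas with value 1, then |u(ω)|^k ≤ n would hold up to an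
infinitesimal event for each standard k. By saturation a single m satisfies m^k ≤ n for all standard
k, and |u(ω)| ≤ m outside an event of measure at most 1/4. The function ω ↦ 2^min(u(ω), 2^m) - 1
then has a circuit of size polynomial in 2^m and in the size of a circuit for u, so it lies in F;
its length is u(ω) wherever |u(ω)| ≤ m. So u is a length with probability at least 3/4, a
contradiction (`exists_truthAt_formulaA_ne_top`).

Closure of F. All operations needed have circuits of size polynomial in those of their arguments
(`PolyOp`), and a polynomial in 2^(n^(1/(2k))) is below 2^(n^(1/k)) for large n (`exists_growth`).
Since membership in F is required for every k, losing a factor 2 in k is harmless. Definition by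
cases reduces to arithmetic with the indicator of ≤.

Completeness of the algebra. In the ideal of events below finite joins of the given classes, some
event C_k is exceeded by any other member by measure at most 1/k, as otherwise increments of 1/k
would add up to more than 1. Saturation gives an event that contains all C_k and exceeds each by at
most 1/k; its class is the least upper bound (`exists_isLUB`).

Passage from ℕ to M. Every combinatorial fact is proved in ℕ, often only for n ≥ N, and transferred
by elementary equivalence; a non-standard n is above every standard N. The relation `Corr R S`,
stable under logical operations and substitution, records that the statement in ℕ and the statement
in M come from one formula. It needs circuit evaluation and cardinalities to be arithmetical, which
follows from their being primitive recursive. The saturated model itself is an ultrapower of ℕ. -/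

noncomputable section

/-! ### Corresponding relations on `ℕ` and on a model -/

section Correspondence

variable {M : Type*} [LA.Structure M] {n m : ℕ}

/-- The relations `R` on `ℕ` and `S` on `M` are defined by the same formula. -/
def Corr (R : (Fin n → ℕ) → Prop) (S : (Fin n → M) → Prop) : Prop :=
  ∃ φ : LA.Formula (Fin n), (∀ v, φ.Realize v ↔ R v) ∧ ∀ v, φ.Realize v ↔ S v

/-- The graphs of `f` and `g` are defined by the same formula. -/
structure CorrF (f : (Fin n → ℕ) → ℕ) (g : (Fin n → M) → M) : Prop where
  graph : Corr (fun w : Fin (n + 1) → ℕ => w 0 = f (fun i => w i.succ))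
    (fun w : Fin (n + 1) → M => w 0 = g (fun i => w i.succ))

abbrev addM (a b : M) : M := Structure.funMap addS ![a, b]
abbrev mulM (a b : M) : M := Structure.funMap mulS ![a, b]
abbrev pairM (a b : M) : M := Structure.funMap pairS ![a, b]
abbrev lenM (a : M) : M := Structure.funMap lenS ![a]
abbrev proj1M (a : M) : M := Structure.funMap proj1S ![a]
abbrev proj2M (a : M) : M := Structure.funMap proj2S ![a]
abbrev leM (a b : M) : Prop := Structure.RelMap leS ![a, b]

/-- A first-order statement that is true in `ℕ` is true in every model of true arithmetic. -/
theorem Corr.transfer {R : (Fin n → ℕ) → Prop} {S : (Fin n → M) → Prop} (h : Corr R S)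
    (hM : M ≅[LA] ℕ) (hR : ∀ v, R v) (v : Fin n → M) : S v := by
  obtain ⟨φ, h1, h2⟩ := h
  rw [← h2]
  have key := elementarilyEquivalent_iff.1 hM
    (φ.relabel (Sum.inr : Fin n → Empty ⊕ Fin n)).iAlls
  simp only [Sentence.Realize, Formula.realize_iAlls, Formula.realize_relabel] at key
  exact key.2 (fun w => (h1 _).2 (hR _)) v

theorem Corr.congr {R R' : (Fin n → ℕ) → Prop} {S S' : (Fin n → M) → Prop} (h : Corr R S)
    (hR : ∀ v, R v ↔ R' v) (hS : ∀ v, S v ↔ S' v) : Corr R' S' := by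
  obtain ⟨φ, h1, h2⟩ := h
  exact ⟨φ, fun v => (h1 v).trans (hR v), fun v => (h2 v).trans (hS v)⟩

theorem Corr.formula (φ : LA.Formula (Fin m)) (e : Fin m → Fin n) :
    Corr (fun v => φ.Realize (fun i => v (e i)))
      (fun v : Fin n → M => φ.Realize (fun i => v (e i))) :=
  ⟨φ.relabel e, fun _ => Formula.realize_relabel, fun _ => Formula.realize_relabel⟩

theorem Corr.not {R : (Fin n → ℕ) → Prop} {S : (Fin n → M) → Prop} (h : Corr R S) :
    Corr (fun v => ¬ R v) (fun v => ¬ S v) := by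
  obtain ⟨φ, h1, h2⟩ := h
  exact ⟨∼φ, fun v => by rw [Formula.realize_not, h1], fun v => by rw [Formula.realize_not, h2]⟩

theorem Corr.and {R R' : (Fin n → ℕ) → Prop} {S S' : (Fin n → M) → Prop} (h : Corr R S)
    (h' : Corr R' S') : Corr (fun v => R v ∧ R' v) (fun v => S v ∧ S' v) := by
  obtain ⟨φ, h1, h2⟩ := h
  obtain ⟨ψ, h3, h4⟩ := h'
  exact ⟨φ ⊓ ψ, fun v => by rw [Formula.realize_inf, h1, h3],
    fun v => by rw [Formula.realize_inf, h2, h4]⟩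

theorem Corr.or {R R' : (Fin n → ℕ) → Prop} {S S' : (Fin n → M) → Prop} (h : Corr R S)
    (h' : Corr R' S') : Corr (fun v => R v ∨ R' v) (fun v => S v ∨ S' v) :=
  (h.not.and h'.not).not.congr (fun v => by tauto) (fun v => by tauto)

theorem Corr.imp {R R' : (Fin n → ℕ) → Prop} {S S' : (Fin n → M) → Prop} (h : Corr R S)
    (h' : Corr R' S') : Corr (fun v => R v → R' v) (fun v => S v → S' v) :=
  (h.and h'.not).not.congr (fun v => by tauto) (fun v => by tauto)

theorem Corr.iff {R R' : (Fin n → ℕ) → Prop} {S S' : (Fin n → M) → Prop} (h : Corr R S)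
    (h' : Corr R' S') : Corr (fun v => R v ↔ R' v) (fun v => S v ↔ S' v) :=
  ((h.imp h').and (h'.imp h)).congr (fun v => by tauto) (fun v => by tauto)

/-- Convention for all that follows: the bound variable has index 0 and the remaining ones are moved
up by `Fin.succ`. -/
theorem realize_cons_iExs {N : Type*} [LA.Structure N] (φ : LA.Formula (Fin (n + 1)))
    (v : Fin n → N) :
    ((φ.relabel (Fin.cases (Sum.inr ()) Sum.inl : Fin (n + 1) → Fin n ⊕ Unit)).iExs).Realize v ↔
      ∃ x : N, φ.Realize (Fin.cons x v : Fin (n + 1) → N) := by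
  have key (i : Unit → N) : Sum.elim v i ∘
      (Fin.cases (Sum.inr ()) Sum.inl : Fin (n + 1) → Fin n ⊕ Unit) = Fin.cons (i ()) v := by
    funext j
    refine Fin.cases ?_ (fun j => ?_) j <;> simp
  simp only [Formula.realize_iExs, Formula.realize_relabel, key]
  exact ⟨fun ⟨i, h⟩ => ⟨_, h⟩, fun ⟨x, h⟩ => ⟨fun _ => x, h⟩⟩

theorem Corr.ex {R : ℕ → (Fin n → ℕ) → Prop} {S : M → (Fin n → M) → Prop}
    (h : Corr (fun w : Fin (n + 1) → ℕ => R (w 0) (fun i => w i.succ))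
      (fun w : Fin (n + 1) → M => S (w 0) (fun i => w i.succ))) :
    Corr (fun v => ∃ x, R x v) (fun v => ∃ x, S x v) := by
  obtain ⟨φ, h1, h2⟩ := h
  exact ⟨_, fun v => (realize_cons_iExs φ v).trans (exists_congr fun x => by simp [h1]),
    fun v => (realize_cons_iExs φ v).trans (exists_congr fun x => by simp [h2])⟩

theorem Corr.all {R : ℕ → (Fin n → ℕ) → Prop} {S : M → (Fin n → M) → Prop}
    (h : Corr (fun w : Fin (n + 1) → ℕ => R (w 0) (fun i => w i.succ))
      (fun w : Fin (n + 1) → M => S (w 0) (fun i => w i.succ))) :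
    Corr (fun v => ∀ x, R x v) (fun v => ∀ x, S x v) :=
  (Corr.ex (R := fun x v => ¬ R x v) (S := fun x v => ¬ S x v) h.not).not.congr
    (fun v => by push Not; rfl) (fun v => by push Not; rfl)

/-- The functions need not be given by terms: R(f(v)) is expressed as "some x satisfies R and each
x_i lies on the graph of f_i", with the graph formulas shared by ℕ and M. -/
theorem Corr.comp {R : (Fin m → ℕ) → Prop} {S : (Fin m → M) → Prop} (h : Corr R S)
    {f : Fin m → (Fin n → ℕ) → ℕ} {g : Fin m → (Fin n → M) → M} (hf : ∀ i, CorrF (f i) (g i)) :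
    Corr (fun v => R (fun i => f i v)) (fun v => S (fun i => g i v)) := by
  obtain ⟨φ, h1, h2⟩ := h
  choose ψ hψ1 hψ2 using fun i => (hf i).graph
  let Φ := ((φ.relabel (Sum.inr : Fin m → Fin n ⊕ Fin m)) ⊓ Formula.iInf fun i =>
        (ψ i).relabel (Fin.cases (Sum.inr i) Sum.inl : Fin (n + 1) → Fin n ⊕ Fin m)).iExs
          (β := Fin m)
  refine ⟨Φ, fun v => .trans ?_ (h1 _), fun v => .trans ?_ (h2 _)⟩
  all_goals
    simp only [Φ, Formula.realize_iExs, Formula.realize_inf, Formula.realize_relabel,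
      Formula.realize_iInf, hψ1, hψ2]
    constructor
    · rintro ⟨x, hx, hx'⟩
      convert hx using 1
      exact (funext hx').symm
    · intro hx
      exact ⟨_, hx, fun i => rfl⟩

theorem CorrF.var (i : Fin n) : CorrF (fun v => v i) (fun v : Fin n → M => v i) :=
  ⟨⟨Term.equal (Term.var 0) (Term.var i.succ), fun v => by simp [Formula.realize_equal],
    fun v => by simp [Formula.realize_equal]⟩⟩

theorem CorrF.shift {f : (Fin n → ℕ) → ℕ} {g : (Fin n → M) → M} (h : CorrF f g) :
    CorrF (fun w : Fin (n + 1) → ℕ => f (fun i => w i.succ))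
      (fun w : Fin (n + 1) → M => g (fun i => w i.succ)) :=
  let e : Fin (n + 1) → Fin (n + 2) := Fin.cases 0 (fun j => j.succ.succ)
  ⟨h.graph.comp (n := n + 2) (f := fun i v => v (e i)) (g := fun i v => v (e i))
    fun _ => CorrF.var _⟩

theorem Corr.rel₂ {P : ℕ → ℕ → Prop} {Q : M → M → Prop}
    (h : Corr (fun v : Fin 2 → ℕ => P (v 0) (v 1)) (fun v : Fin 2 → M => Q (v 0) (v 1)))
    {f₀ f₁ : (Fin n → ℕ) → ℕ} {g₀ g₁ : (Fin n → M) → M} (h₀ : CorrF f₀ g₀) (h₁ : CorrF f₁ g₁) :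
    Corr (fun v => P (f₀ v) (f₁ v)) (fun v => Q (g₀ v) (g₁ v)) :=
  h.comp (f := ![f₀, f₁]) (g := ![g₀, g₁]) fun i => by fin_cases i; exacts [h₀, h₁]

theorem Corr.rel₃ {P : ℕ → ℕ → ℕ → Prop} {Q : M → M → M → Prop}
    (h : Corr (fun v : Fin 3 → ℕ => P (v 0) (v 1) (v 2))
      (fun v : Fin 3 → M => Q (v 0) (v 1) (v 2)))
    {f₀ f₁ f₂ : (Fin n → ℕ) → ℕ} {g₀ g₁ g₂ : (Fin n → M) → M} (h₀ : CorrF f₀ g₀)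
    (h₁ : CorrF f₁ g₁) (h₂ : CorrF f₂ g₂) :
    Corr (fun v => P (f₀ v) (f₁ v) (f₂ v)) (fun v => Q (g₀ v) (g₁ v) (g₂ v)) :=
  h.comp (f := ![f₀, f₁, f₂]) (g := ![g₀, g₁, g₂]) fun i => by fin_cases i; exacts [h₀, h₁, h₂]

theorem Corr.rel₄ {P : ℕ → ℕ → ℕ → ℕ → Prop} {Q : M → M → M → M → Prop}
    (h : Corr (fun v : Fin 4 → ℕ => P (v 0) (v 1) (v 2) (v 3))
      (fun v : Fin 4 → M => Q (v 0) (v 1) (v 2) (v 3)))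
    {f₀ f₁ f₂ f₃ : (Fin n → ℕ) → ℕ} {g₀ g₁ g₂ g₃ : (Fin n → M) → M} (h₀ : CorrF f₀ g₀)
    (h₁ : CorrF f₁ g₁) (h₂ : CorrF f₂ g₂) (h₃ : CorrF f₃ g₃) :
    Corr (fun v => P (f₀ v) (f₁ v) (f₂ v) (f₃ v)) (fun v => Q (g₀ v) (g₁ v) (g₂ v) (g₃ v)) :=
  h.comp (f := ![f₀, f₁, f₂, f₃]) (g := ![g₀, g₁, g₂, g₃])
    fun i => by fin_cases i; exacts [h₀, h₁, h₂, h₃]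

theorem CorrF.comp₁ {p : ℕ → ℕ} {q : M → M}
    (h : CorrF (fun v : Fin 1 → ℕ => p (v 0)) (fun v : Fin 1 → M => q (v 0)))
    {f₀ : (Fin n → ℕ) → ℕ} {g₀ : (Fin n → M) → M} (h₀ : CorrF f₀ g₀) :
    CorrF (fun v => p (f₀ v)) (fun v => q (g₀ v)) :=
  ⟨h.graph.rel₂ (P := fun y a => y = p a) (Q := fun y a => y = q a) (CorrF.var 0) h₀.shift⟩

theorem CorrF.comp₂ {p : ℕ → ℕ → ℕ} {q : M → M → M}
    (h : CorrF (fun v : Fin 2 → ℕ => p (v 0) (v 1)) (fun v : Fin 2 → M => q (v 0) (v 1)))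
    {f₀ f₁ : (Fin n → ℕ) → ℕ} {g₀ g₁ : (Fin n → M) → M} (h₀ : CorrF f₀ g₀) (h₁ : CorrF f₁ g₁) :
    CorrF (fun v => p (f₀ v) (f₁ v)) (fun v => q (g₀ v) (g₁ v)) :=
  ⟨h.graph.rel₃ (P := fun y a b => y = p a b) (Q := fun y a b => y = q a b) (CorrF.var 0)
    h₀.shift h₁.shift⟩

theorem CorrF.comp₃ {p : ℕ → ℕ → ℕ → ℕ} {q : M → M → M → M}
    (h : CorrF (fun v : Fin 3 → ℕ => p (v 0) (v 1) (v 2))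
      (fun v : Fin 3 → M => q (v 0) (v 1) (v 2)))
    {f₀ f₁ f₂ : (Fin n → ℕ) → ℕ} {g₀ g₁ g₂ : (Fin n → M) → M} (h₀ : CorrF f₀ g₀)
    (h₁ : CorrF f₁ g₁) (h₂ : CorrF f₂ g₂) :
    CorrF (fun v => p (f₀ v) (f₁ v) (f₂ v)) (fun v => q (g₀ v) (g₁ v) (g₂ v)) :=
  ⟨h.graph.rel₄ (P := fun y a b c => y = p a b c) (Q := fun y a b c => y = q a b c) (CorrF.var 0)
    h₀.shift h₁.shift h₂.shift⟩

theorem Corr.eq {f₀ f₁ : (Fin n → ℕ) → ℕ} {g₀ g₁ : (Fin n → M) → M} (h₀ : CorrF f₀ g₀)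
    (h₁ : CorrF f₁ g₁) : Corr (fun v => f₀ v = f₁ v) (fun v => g₀ v = g₁ v) :=
  Corr.rel₂ (P := fun y a => y = a) (Q := fun y a => y = a) (CorrF.var 0).graph h₀ h₁

theorem Corr.le {f₀ f₁ : (Fin n → ℕ) → ℕ} {g₀ g₁ : (Fin n → M) → M} (h₀ : CorrF f₀ g₀)
    (h₁ : CorrF f₁ g₁) : Corr (fun v => f₀ v ≤ f₁ v) (fun v => leM (g₀ v) (g₁ v)) :=
  Corr.rel₂ (P := fun a b => a ≤ b) (Q := fun a b => leM a b)
    ⟨leS.formula₂ (Term.var 0) (Term.var 1), fun _ => by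
      simp only [Formula.realize_rel₂, Term.realize_var]; rfl, fun _ => by
      simp only [Formula.realize_rel₂, Term.realize_var]⟩ h₀ h₁

theorem Corr.lt {f₀ f₁ : (Fin n → ℕ) → ℕ} {g₀ g₁ : (Fin n → M) → M} (h₀ : CorrF f₀ g₀)
    (h₁ : CorrF f₁ g₁) : Corr (fun v => f₀ v < f₁ v) (fun v => ¬ leM (g₁ v) (g₀ v)) :=
  (Corr.le h₁ h₀).not.congr (fun _ => not_le) (fun _ => Iff.rfl)

theorem CorrF.func (f : LA.Functions m) {f' : Fin m → (Fin n → ℕ) → ℕ}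
    {g : Fin m → (Fin n → M) → M} (h : ∀ i, CorrF (f' i) (g i)) :
    CorrF (fun v => Structure.funMap f (fun i => f' i v))
      (fun v => Structure.funMap f (fun i => g i v)) := by
  have h0 : CorrF (fun v : Fin m → ℕ => Structure.funMap f v)
      (fun v : Fin m → M => Structure.funMap f v) :=
    ⟨⟨Term.equal (Term.var 0) (Term.func f fun i => Term.var i.succ),
      fun _ => by simp [Formula.realize_equal], fun _ => by simp [Formula.realize_equal]⟩⟩
  exact ⟨h0.graph.comp (f := Fin.cases (fun w => w 0) (fun i w => f' i (fun i => w i.succ)))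
    (g := Fin.cases (fun w => w 0) (fun i w => g i (fun i => w i.succ)))
    (Fin.cases (CorrF.var 0) (fun i => (h i).shift))⟩

theorem CorrF.func₂ (f : LA.Functions 2) {f₀ f₁ : (Fin n → ℕ) → ℕ} {g₀ g₁ : (Fin n → M) → M}
    (h₀ : CorrF f₀ g₀) (h₁ : CorrF f₁ g₁) : CorrF (fun v => Structure.funMap f ![f₀ v, f₁ v])
      (fun v => Structure.funMap f ![g₀ v, g₁ v]) := by
  convert CorrF.func f (f' := ![f₀, f₁]) (g := ![g₀, g₁])
    (fun i => by fin_cases i; exacts [h₀, h₁]) using 3 <;> (ext i; fin_cases i <;> rfl)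

theorem CorrF.func₁ (f : LA.Functions 1) {f₀ : (Fin n → ℕ) → ℕ} {g₀ : (Fin n → M) → M}
    (h₀ : CorrF f₀ g₀) : CorrF (fun v => Structure.funMap f ![f₀ v])
      (fun v => Structure.funMap f ![g₀ v]) := by
  convert CorrF.func f (f' := ![f₀]) (g := ![g₀])
    (fun i => by fin_cases i; exact h₀) using 3 <;> (ext i; fin_cases i; rfl)

theorem CorrF.func₀ (f : LA.Functions 0) : CorrF (fun _ : Fin n → ℕ => Structure.funMap f ![])
      (fun _ : Fin n → M => Structure.funMap f ![]) := by
  convert CorrF.func (M := M) f (f' := ![]) (g := ![]) (n := n)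
    (fun i => i.elim0) using 3

theorem CorrF.add {f₀ f₁ : (Fin n → ℕ) → ℕ} {g₀ g₁ : (Fin n → M) → M} (h₀ : CorrF f₀ g₀)
    (h₁ : CorrF f₁ g₁) : CorrF (fun v => f₀ v + f₁ v) (fun v => addM (g₀ v) (g₁ v)) :=
  CorrF.func₂ addS h₀ h₁

theorem CorrF.mul {f₀ f₁ : (Fin n → ℕ) → ℕ} {g₀ g₁ : (Fin n → M) → M} (h₀ : CorrF f₀ g₀)
    (h₁ : CorrF f₁ g₁) : CorrF (fun v => f₀ v * f₁ v) (fun v => mulM (g₀ v) (g₁ v)) :=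
  CorrF.func₂ mulS h₀ h₁

theorem CorrF.natPair {f₀ f₁ : (Fin n → ℕ) → ℕ} {g₀ g₁ : (Fin n → M) → M} (h₀ : CorrF f₀ g₀)
    (h₁ : CorrF f₁ g₁) : CorrF (fun v => natPair (f₀ v) (f₁ v)) (fun v => pairM (g₀ v) (g₁ v)) :=
  CorrF.func₂ pairS h₀ h₁

theorem CorrF.size {f₀ : (Fin n → ℕ) → ℕ} {g₀ : (Fin n → M) → M} (h₀ : CorrF f₀ g₀) :
    CorrF (fun v => Nat.size (f₀ v)) (fun v => lenM (g₀ v)) :=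
  CorrF.func₁ lenS h₀

theorem CorrF.natProj1 {f₀ : (Fin n → ℕ) → ℕ} {g₀ : (Fin n → M) → M} (h₀ : CorrF f₀ g₀) :
    CorrF (fun v => natProj1 (f₀ v)) (fun v => proj1M (g₀ v)) :=
  CorrF.func₁ proj1S h₀

theorem CorrF.natProj2 {f₀ : (Fin n → ℕ) → ℕ} {g₀ : (Fin n → M) → M} (h₀ : CorrF f₀ g₀) :
    CorrF (fun v => natProj2 (f₀ v)) (fun v => proj2M (g₀ v)) :=
  CorrF.func₁ proj2S h₀

theorem num_nat (k : ℕ) : num ℕ k = k := by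
  induction k with
  | zero => rfl
  | succ k ih => exact congrArg (· + 1) ih

theorem CorrF.const (k : ℕ) : CorrF (fun _ : Fin n → ℕ => k) (fun _ : Fin n → M => num M k) := by
  suffices CorrF (fun _ : Fin n → ℕ => num ℕ k) (fun _ : Fin n → M => num M k) by
    simpa only [num_nat] using this
  induction k with
  | zero => exact CorrF.func₀ zeroS
  | succ k ih => exact CorrF.func₂ addS ih (CorrF.func₀ oneS)

end Correspondence

/-! ### Primitive recursive relations are arithmetical -/

section Arithmetical

variable {n : ℕ}

/-- `R` is definable in the standard model. -/
def Arith (R : (Fin n → ℕ) → Prop) : Prop := Corr (M := ℕ) R R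

/-- The graph of `f` is definable in the standard model. -/
def ArithF (f : (Fin n → ℕ) → ℕ) : Prop := CorrF (M := ℕ) f f

/-- For an arithmetical R the formula chosen in `definingFormula` does define R, so the default `⊥`
does not intervene, and `interp R` can be transferred. -/
theorem Arith.corr {M : Type*} [LA.Structure M] {R : (Fin n → ℕ) → Prop} (h : Arith R) :
    Corr R (interp (M := M) R) := by
  have h' : ∃ φ : LA.Formula (Fin n), ∀ v, φ.Realize v ↔ R v := ⟨h.choose, h.choose_spec.1⟩
  refine ⟨definingFormula R, fun v => ?_, fun v => Iff.rfl⟩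
  unfold definingFormula
  rw [dif_pos h']
  exact h'.choose_spec v

theorem ArithF.of_graph {f : (Fin n → ℕ) → ℕ} {G : ℕ → (Fin n → ℕ) → Prop}
    (h : Arith fun w : Fin (n + 1) → ℕ => G (w 0) (fun i => w i.succ))
    (hG : ∀ y v, G y v ↔ y = f v) : ArithF f :=
  ⟨Corr.congr h (fun _ => hG _ _) (fun _ => hG _ _)⟩

theorem Arith.lt {f g : (Fin n → ℕ) → ℕ} (hf : ArithF f) (hg : ArithF g) :
    Arith fun v => f v < g v :=
  (Corr.le hg hf).not.congr (fun _ => not_le) (fun _ => not_le)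

theorem ArithF.const (k : ℕ) : ArithF fun _ : Fin n → ℕ => k := by
  have h := CorrF.const (M := ℕ) (n := n) k
  simp only [num_nat] at h
  exact h

theorem arithF_pair : ArithF fun v : Fin 2 → ℕ => Nat.pair (v 0) (v 1) := by
  refine ArithF.of_graph (G := fun y v => (v 0 < v 1 ∧ y = v 1 * v 1 + v 0) ∨
    (v 1 ≤ v 0 ∧ y = v 0 * v 0 + v 0 + v 1)) ?_ ?_
  · refine ((Arith.lt ?_ ?_).and ?_).or ((Corr.le (M := ℕ) ?_ ?_).and ?_)
    all_goals apply_rules [Corr.eq, CorrF.add, CorrF.mul, CorrF.var]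
  · intro y v
    unfold Nat.pair
    split_ifs with h <;> grind

theorem ArithF.comp₁ {p : ℕ → ℕ} (h : ArithF fun v : Fin 1 → ℕ => p (v 0))
    {f : (Fin n → ℕ) → ℕ} (hf : ArithF f) : ArithF fun v => p (f v) :=
  CorrF.comp₁ h hf

theorem ArithF.pair {f g : (Fin n → ℕ) → ℕ} (hf : ArithF f) (hg : ArithF g) :
    ArithF fun v => Nat.pair (f v) (g v) :=
  CorrF.comp₂ arithF_pair hf hg

theorem arithF_fst : ArithF fun v : Fin 1 → ℕ => (v 0).unpair.1 := by
  refine ArithF.of_graph (G := fun y v => ∃ z, v 0 = Nat.pair y z) ?_ fun y v => ?_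
  · refine Corr.ex (M := ℕ) (Corr.eq (CorrF.var _) (ArithF.pair (CorrF.var _) (CorrF.var _)))
  · exact ⟨fun ⟨z, h⟩ => by simp [h], fun h => ⟨(v 0).unpair.2, by simp [h]⟩⟩

theorem arithF_snd : ArithF fun v : Fin 1 → ℕ => (v 0).unpair.2 := by
  refine ArithF.of_graph (G := fun y v => ∃ z, v 0 = Nat.pair z y) ?_ fun y v => ?_
  · refine Corr.ex (M := ℕ) (Corr.eq (CorrF.var _) (ArithF.pair (CorrF.var _) (CorrF.var _)))
  · exact ⟨fun ⟨z, h⟩ => by simp [h], fun h => ⟨(v 0).unpair.1, by simp [h]⟩⟩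

theorem ArithF.fst {f : (Fin n → ℕ) → ℕ} (hf : ArithF f) : ArithF fun v => (f v).unpair.1 :=
  CorrF.comp₁ (M := ℕ) (p := fun x => x.unpair.1) (q := fun x => x.unpair.1) arithF_fst hf

theorem ArithF.snd {f : (Fin n → ℕ) → ℕ} (hf : ArithF f) : ArithF fun v => (f v).unpair.2 :=
  CorrF.comp₁ (M := ℕ) (p := fun x => x.unpair.2) (q := fun x => x.unpair.2) arithF_snd hf

theorem arithF_mod_succ : ArithF fun v : Fin 2 → ℕ => v 0 % (v 1 + 1) := by
  refine ArithF.of_graph (G := fun y v => y ≤ v 1 ∧ ∃ q, v 0 = (v 1 + 1) * q + y) ?_ fun y v => ?_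
  · refine (Corr.le (M := ℕ) ?_ ?_).and (Corr.ex (M := ℕ) (Corr.eq ?_ ?_))
    all_goals apply_rules [CorrF.add, CorrF.mul, CorrF.var, ArithF.const 1]
  · constructor
    · rintro ⟨h, q, hq⟩
      rw [hq, Nat.mul_add_mod, Nat.mod_eq_of_lt (by lia)]
    · rintro rfl
      exact ⟨Nat.le_of_lt_succ (Nat.mod_lt _ (by lia)), _, (Nat.div_add_mod _ _).symm⟩

theorem arithF_beta : ArithF fun v : Fin 2 → ℕ => Nat.beta (v 0) (v 1) := by
  refine CorrF.comp₂ (p := fun a b => a % (b + 1)) (q := fun a b => a % (b + 1)) arithF_mod_succ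
    (ArithF.fst (CorrF.var 0))
    (CorrF.mul (CorrF.add (CorrF.var 1) (ArithF.const 1)) (ArithF.snd (CorrF.var 0)))

theorem ArithF.beta {f g : (Fin n → ℕ) → ℕ} (hf : ArithF f) (hg : ArithF g) :
    ArithF fun v => Nat.beta (f v) (g v) :=
  CorrF.comp₂ arithF_beta hf hg

/-- Gödel's β-function: by the Chinese remainder theorem one number codes a finite sequence. This
replaces recursion by a quantifier over codes. -/
theorem exists_beta (m : ℕ) (f : ℕ → ℕ) : ∃ c, ∀ i < m, Nat.beta c i = f i := by
  refine ⟨Nat.unbeta ((List.range m).map f), fun i hi => ?_⟩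
  simpa using Nat.beta_unbeta_coe ((List.range m).map f) ⟨i, by simpa using hi⟩

/-- Primitive recursive functions are arithmetical. -/
theorem arithF_of_natPrimrec {f : ℕ → ℕ} (h : Nat.Primrec f) :
    ArithF fun v : Fin 1 → ℕ => f (v 0) := by
  induction h with
  | zero => exact ArithF.const 0
  | succ => exact CorrF.add (CorrF.var 0) (ArithF.const 1)
  | left => exact arithF_fst
  | right => exact arithF_snd
  | pair _ _ ihf ihg => exact ArithF.pair ihf ihg
  | comp _ _ ihf ihg => exact ArithF.comp₁ ihf ihg
  | @prec f g _ _ ihf ihg =>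
    -- The number c codes the course of values of the recursion, up to the argument.
    refine ArithF.of_graph (G := fun y v => ∃ c, Nat.beta c 0 = f (v 0).unpair.1 ∧
      y = Nat.beta c (v 0).unpair.2 ∧ ∀ i, i < (v 0).unpair.2 → Nat.beta c (i + 1) =
        g (Nat.pair (v 0).unpair.1 (Nat.pair i (Nat.beta c i)))) ?_ fun y v => ?_
    · refine Corr.ex (M := ℕ) (Corr.and (Corr.eq ?_ ?_) (Corr.and (Corr.eq ?_ ?_)
        (Corr.all (Corr.imp (Arith.lt ?_ ?_) (Corr.eq ?_ ?_)))))
      · exact ArithF.beta (CorrF.var 0) (ArithF.const 0)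
      · exact ArithF.comp₁ ihf (ArithF.fst (CorrF.var _))
      · exact CorrF.var _
      · exact ArithF.beta (CorrF.var 0) (ArithF.snd (CorrF.var _))
      · exact CorrF.var 0
      · exact ArithF.snd (CorrF.var _)
      · exact ArithF.beta (CorrF.var _) (CorrF.add (CorrF.var 0) (ArithF.const 1))
      · exact ArithF.comp₁ ihg (ArithF.pair (ArithF.fst (CorrF.var _))
          (ArithF.pair (CorrF.var 0) (ArithF.beta (CorrF.var _) (CorrF.var 0))))
    · simp only [Nat.unpaired]
      set z := (v 0).unpair.1
      set N := (v 0).unpair.2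
      let F : ℕ → ℕ := fun n => n.rec (f z) fun y IH => g (Nat.pair z (Nat.pair y IH))
      change _ ↔ y = F N
      constructor
      · rintro ⟨c, h0, rfl, hs⟩
        have key : ∀ i ≤ N, Nat.beta c i = F i := by
          intro i
          induction i with
          | zero => exact fun _ => h0
          | succ i ih => exact fun hi => by rw [hs i hi, ih (by lia)]
        exact key N le_rfl
      · rintro rfl
        obtain ⟨c, hc⟩ := exists_beta (N + 1) F
        exact ⟨c, hc 0 (by lia), (hc N (by lia)).symm, fun i hi => by
          rw [hc (i + 1) (by lia), hc i (by lia)]⟩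

theorem ArithF.primrec₁ {g : ℕ → ℕ} (hg : Primrec g) {f : (Fin n → ℕ) → ℕ} (hf : ArithF f) :
    ArithF fun v => g (f v) :=
  ArithF.comp₁ (arithF_of_natPrimrec (Primrec.nat_iff.1 hg)) hf

theorem ArithF.primrec₂ {g : ℕ → ℕ → ℕ} (hg : Primrec₂ g) {f₀ f₁ : (Fin n → ℕ) → ℕ}
    (h₀ : ArithF f₀) (h₁ : ArithF f₁) : ArithF fun v => g (f₀ v) (f₁ v) := by
  have := ArithF.primrec₁ (Primrec.nat_iff.2 (Primrec₂.unpaired'.2 hg)) (ArithF.pair h₀ h₁)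
  simpa [Nat.unpaired] using this

end Arithmetical

/-! ### Arithmetical relations used below -/

section Coding

theorem primrec₂_pow : Primrec₂ (fun a b : ℕ => a ^ b) := Primrec₂.unpaired'.1 Nat.Primrec.pow

theorem arithF_pow : ArithF fun v : Fin 2 → ℕ => v 0 ^ v 1 :=
  ArithF.primrec₂ primrec₂_pow (CorrF.var 0) (CorrF.var 1)

/-- The bit `i` of `x`, as a number. -/
def bitNat (x i : ℕ) : ℕ := x / 2 ^ i % 2

theorem bitNat_eq_one {x i : ℕ} : bitNat x i = 1 ↔ x.testBit i = true := by
  rw [Nat.testBit_eq_decide_div_mod_eq, decide_eq_true_iff, bitNat]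

theorem bitNat_eq (x i : ℕ) : bitNat x i = if x.testBit i then 1 else 0 := by
  split_ifs with h
  · exact bitNat_eq_one.2 h
  · rw [← bitNat_eq_one] at h
    have : bitNat x i < 2 := Nat.mod_lt _ (by norm_num)
    lia

theorem primrec₂_bitNat : Primrec₂ bitNat :=
  Primrec.nat_mod.comp₂ (Primrec.nat_div.comp₂ Primrec₂.left
    (primrec₂_pow.comp₂ (Primrec₂.const 2) Primrec₂.right)) (Primrec₂.const 2)

theorem arith_testBit : Arith fun v : Fin 2 → ℕ => (v 1).testBit (v 0) = true :=
  (Corr.eq (M := ℕ) (ArithF.primrec₂ primrec₂_bitNat (CorrF.var 1) (CorrF.var 0))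
    (ArithF.const 1)).congr (fun _ => bitNat_eq_one) (fun _ => bitNat_eq_one)

/-- The set coded by `x`. -/
def bits (x : ℕ) : Finset ℕ := x.bitIndices.toFinset

theorem mem_bits {x i : ℕ} : i ∈ bits x ↔ x.testBit i = true := by
  simp [bits]

theorem setCode_bits (x : ℕ) : setCode (bits x) = x := by
  exact Finset.sum_toFinset_bitIndices_two_pow x

theorem bits_setCode (s : Finset ℕ) : bits (setCode s) = s := by
  exact Finset.toFinset_bitIndices_sum_two_pow s

theorem testBit_setCode {s : Finset ℕ} {i : ℕ} : (setCode s).testBit i = true ↔ i ∈ s := by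
  rw [← mem_bits, bits_setCode]

/-- Since i < 2^i, all bits of x are at positions below x, so a recursion of length x counts them;
in this form the cardinality is visibly primitive recursive. -/
theorem card_bits (x : ℕ) :
    (bits x).card = Nat.rec 0 (fun i acc => acc + bitNat x i) x := by
  have h : ∀ m : ℕ, (Nat.rec 0 (fun i acc => acc + bitNat x i) m : ℕ) =
      ∑ i ∈ Finset.range m, bitNat x i := by
    intro m
    induction m with
    | zero => rfl
    | succ m ih => rw [Finset.sum_range_succ, ← ih]
  rw [h, Finset.card_eq_sum_ones]
  simp only [bitNat_eq]
  rw [← Finset.sum_filter]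
  refine Finset.sum_congr ?_ fun _ _ => rfl
  ext i
  simp only [mem_bits, Finset.mem_filter, Finset.mem_range]
  exact ⟨fun h => ⟨Nat.lt_of_lt_of_le i.lt_two_pow_self (Nat.ge_two_pow_of_testBit h), h⟩,
    fun h => h.2⟩

theorem primrec_card_bits : Primrec fun x => (bits x).card := by
  refine (Primrec.nat_rec' (f := fun x : ℕ => x) (g := fun _ => 0)
    (h := fun x p => p.2 + bitNat x p.1) Primrec.id (Primrec.const 0) ?_).of_eq
    fun x => (card_bits x).symm
  exact Primrec.nat_add.comp₂ (Primrec.snd.comp₂ Primrec₂.right)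
    (primrec₂_bitNat.comp₂ Primrec₂.left (Primrec.fst.comp₂ Primrec₂.right))

theorem ArithF.card_bits {n : ℕ} {f : (Fin n → ℕ) → ℕ} (hf : ArithF f) :
    ArithF fun v => (bits (f v)).card :=
  ArithF.primrec₁ primrec_card_bits hf

theorem exists_setCode_iff (k a b : ℕ) :
    (∃ s t : Finset ℕ, a = setCode s ∧ b = setCode t ∧ k * s.card ≤ t.card) ↔
      k * (bits a).card ≤ (bits b).card := by
  constructor
  · rintro ⟨s, t, rfl, rfl, h⟩
    rwa [bits_setCode, bits_setCode]
  · exact fun h => ⟨_, _, (setCode_bits a).symm, (setCode_bits b).symm, h⟩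

theorem arith_card (k : ℕ) : Arith fun v : Fin 2 → ℕ =>
    ∃ s t : Finset ℕ, v 0 = setCode s ∧ v 1 = setCode t ∧ k * s.card ≤ t.card := by
  refine (Corr.le (M := ℕ) (CorrF.mul (ArithF.const k)
    (ArithF.card_bits (CorrF.var 0))) (ArithF.card_bits (CorrF.var 1))).congr
    (fun v => ?_) (fun v => ?_) <;>
  exact (exists_setCode_iff k _ _).symm

/-! Circuits are coded by lists. -/

/-- The gate with a given code. -/
def gateOf (p : ℕ × ℕ × ℕ) : Gate :=
  if p.1 = 0 then .const false else if p.1 = 1 then .const true else if p.1 = 2 then .input p.2.1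
  else if p.1 = 3 then .not p.2.1 else if p.1 = 4 then .and p.2.1 p.2.2 else .or p.2.1 p.2.2

theorem gateOf_surjective : Function.Surjective gateOf := by
  rintro ((_ | _) | i | a | ⟨a, b⟩ | ⟨a, b⟩)
  exacts [⟨(0, 0, 0), rfl⟩, ⟨(1, 0, 0), rfl⟩, ⟨(2, i, 0), rfl⟩, ⟨(3, a, 0), rfl⟩,
    ⟨(4, a, b), rfl⟩, ⟨(5, a, b), rfl⟩]

/-- The circuit with a given code. -/
def circuitOf (c : List (ℕ × ℕ × ℕ) × List ℕ) : Circuit := ⟨c.1.map gateOf, c.2⟩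

theorem circuitOf_surjective : Function.Surjective circuitOf := by
  rintro ⟨gs, os⟩
  obtain ⟨l, rfl⟩ := gateOf_surjective.list_map gs
  exact ⟨(l, os), rfl⟩

theorem gateOf_eval (x : ℕ) (vals : List Bool) (p : ℕ × ℕ × ℕ) : (gateOf p).eval x vals =
    bif p.1 == 0 then false else bif p.1 == 1 then true else
    bif p.1 == 2 then (bitNat x p.2.1 == 1) else bif p.1 == 3 then !(vals.getD p.2.1 false) else
    bif p.1 == 4 then (vals.getD p.2.1 false && vals.getD p.2.2 false) else
    (vals.getD p.2.1 false || vals.getD p.2.2 false) := by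
  have hb : (bitNat x p.2.1 == 1) = x.testBit p.2.1 := by
    rw [Bool.eq_iff_iff, beq_iff_eq, bitNat_eq_one]
  rw [hb]
  unfold gateOf
  simp only [Bool.cond_eq_ite, beq_iff_eq]
  split_ifs <;> rfl

theorem primrec_gateOf_eval :
    Primrec fun q : ℕ × List Bool × (ℕ × ℕ × ℕ) => (gateOf q.2.2).eval q.1 q.2.1 := by
  simp only [gateOf_eval]
  have hx : Primrec fun q : ℕ × List Bool × (ℕ × ℕ × ℕ) => q.1 := Primrec.fst
  have hv : Primrec fun q : ℕ × List Bool × (ℕ × ℕ × ℕ) => q.2.1 :=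
    Primrec.fst.comp Primrec.snd
  have hp : Primrec fun q : ℕ × List Bool × (ℕ × ℕ × ℕ) => q.2.2 :=
    Primrec.snd.comp Primrec.snd
  have h1 := Primrec.fst.comp hp
  have h2 := Primrec.fst.comp (Primrec.snd.comp hp)
  have h3 := Primrec.snd.comp (Primrec.snd.comp hp)
  have ha := (Primrec.list_getD false).comp hv h2
  have hb := (Primrec.list_getD false).comp hv h3
  have tag (k : ℕ) := Primrec.beq.comp h1 (Primrec.const k)
  exact Primrec.cond (tag 0) (Primrec.const _) <| Primrec.cond (tag 1) (Primrec.const _) <|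
    Primrec.cond (tag 2) (Primrec.beq.comp (primrec₂_bitNat.comp hx h2) (Primrec.const 1)) <|
    Primrec.cond (tag 3) (Primrec.not.comp ha) <| Primrec.cond (tag 4) (Primrec.and.comp ha hb) <|
    Primrec.or.comp ha hb

theorem primrec_wires : Primrec fun q : (List (ℕ × ℕ × ℕ) × List ℕ) × ℕ =>
    (circuitOf q.1).wires q.2 := by
  simp only [Circuit.wires, circuitOf, List.foldl_map]
  refine Primrec.list_foldl (f := fun q : (List (ℕ × ℕ × ℕ) × List ℕ) × ℕ => q.1.1)
    (g := fun _ => []) (h := fun q s => s.1 ++ [(gateOf s.2).eval q.2 s.1])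
    (Primrec.fst.comp Primrec.fst) (Primrec.const _) ?_
  refine Primrec.list_concat.comp₂ (Primrec.fst.comp₂ Primrec₂.right)
    (primrec_gateOf_eval.comp₂ (g := fun (q : (List (ℕ × ℕ × ℕ) × List ℕ) × ℕ)
      (s : List Bool × (ℕ × ℕ × ℕ)) => (q.2, s.1, s.2)) ?_)
  exact Primrec₂.pair.comp₂ (Primrec.snd.comp₂ Primrec₂.left)
    (Primrec₂.pair.comp₂ (Primrec.fst.comp₂ Primrec₂.right) (Primrec.snd.comp₂ Primrec₂.right))

theorem primrec_circuit_eval : Primrec fun q : (List (ℕ × ℕ × ℕ) × List ℕ) × ℕ =>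
    (circuitOf q.1).eval q.2 := by
  -- Horner's scheme turns the output number into a fold over the list of outputs.
  have h : ∀ q : (List (ℕ × ℕ × ℕ) × List ℕ) × ℕ, (circuitOf q.1).eval q.2 =
      q.1.2.foldr (fun o acc => (bif ((circuitOf q.1).wires q.2).getD o false then 1 else 0) +
        2 * acc) 0 := by
    intro q
    change Nat.ofDigits 2 (q.1.2.map _) = _
    generalize (circuitOf q.1).wires q.2 = W
    induction q.1.2 with
    | nil => rfl
    | cons o l ih =>
      rw [List.map_cons, Nat.ofDigits_cons, ih, List.foldr_cons]
      cases W.getD o false <;> rfl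
  refine (Primrec.list_foldr (f := fun q : (List (ℕ × ℕ × ℕ) × List ℕ) × ℕ => q.1.2)
    (g := fun _ => 0) (h := fun q s => (bif ((circuitOf q.1).wires q.2).getD s.1 false then 1
      else 0) + 2 * s.2) (Primrec.snd.comp Primrec.fst) (Primrec.const 0) ?_).of_eq
    fun q => (h q).symm
  refine Primrec.nat_add.comp₂ (Primrec.cond (c := fun p : ((List (ℕ × ℕ × ℕ) × List ℕ) × ℕ) ×
    (ℕ × ℕ) => ((circuitOf p.1.1).wires p.1.2).getD p.2.1 false) ?_ (Primrec.const 1)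
    (Primrec.const 0)) (Primrec.nat_mul.comp₂ (Primrec₂.const 2) (Primrec.snd.comp₂ Primrec₂.right))
  exact (Primrec.list_getD false).comp (primrec_wires.comp Primrec.fst)
    (Primrec.fst.comp Primrec.snd)

/-- The circuit with code `c`, a number. -/
def circuitNat (c : ℕ) : Circuit := circuitOf (Denumerable.ofNat (List (ℕ × ℕ × ℕ) × List ℕ) c)

theorem circuitNat_surjective : Function.Surjective circuitNat :=
  circuitOf_surjective.comp fun a => ⟨Encodable.encode a, Denumerable.ofNat_encode a⟩

theorem primrec_circuitNat_eval : Primrec₂ fun c x => (circuitNat c).eval x :=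
  primrec_circuit_eval.comp₂ (g := fun c x =>
    (Denumerable.ofNat (List (ℕ × ℕ × ℕ) × List ℕ) c, x))
    (Primrec₂.pair.comp₂ ((Primrec.ofNat _).comp₂ Primrec₂.left) Primrec₂.right)

theorem primrec_circuitNat_size : Primrec fun c => (circuitNat c).size := by
  have h : ∀ c, (circuitNat c).size =
      (Denumerable.ofNat (List (ℕ × ℕ × ℕ) × List ℕ) c).1.length +
      (Denumerable.ofNat (List (ℕ × ℕ × ℕ) × List ℕ) c).2.length := fun c => by
    simp [circuitNat, circuitOf, Circuit.size]
  refine (Primrec.nat_add.comp ?_ ?_).of_eq fun c => (h c).symm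
  · exact Primrec.list_length.comp (Primrec.fst.comp (Primrec.ofNat _))
  · exact Primrec.list_length.comp (Primrec.snd.comp (Primrec.ofNat _))

theorem eq_setCode_iff {b : ℕ} {s : Finset ℕ} :
    b = setCode s ↔ ∀ x, b.testBit x = true ↔ x ∈ s := by
  constructor
  · rintro rfl x
    exact testBit_setCode
  · intro h
    rw [← setCode_bits b]
    congr 1
    ext x
    rw [mem_bits, h]

/-- Circuits become numbers, and equality of finite sets becomes a quantifier over bits; every
ingredient on the right is arithmetical. -/
theorem subexpComputable_iff (k n b : ℕ) : SubexpComputable k n b ↔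
    ∃ c r, r ^ k ≤ n ∧ (circuitNat c).size ≤ 2 ^ r ∧ ∀ x, b.testBit x = true ↔
      ∃ ω, ω < 2 ^ n ∧ x = natPair ω ((circuitNat c).eval ω) := by
  unfold SubexpComputable
  rw [circuitNat_surjective.exists]
  simp only [eq_setCode_iff, Finset.mem_image, Finset.mem_range, eq_comm (b := natPair _ _)]

theorem arith_subexpComputable :
    Arith fun v : Fin 3 → ℕ => SubexpComputable (v 0) (v 1) (v 2) := by
  have hP {m} (i j : Fin m) : ArithF fun v : Fin m → ℕ => v i ^ v j :=
    CorrF.comp₂ arithF_pow (CorrF.var i) (CorrF.var j)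
  have h2 {m} (j : Fin m) : ArithF fun v : Fin m → ℕ => 2 ^ v j :=
    CorrF.comp₂ arithF_pow (ArithF.const 2) (CorrF.var j)
  refine Corr.congr (M := ℕ) (Corr.ex (Corr.ex (Corr.and (Corr.le ?_ ?_) (Corr.and (Corr.le ?_ ?_)
    (Corr.all (Corr.iff (Corr.rel₂ (M := ℕ) (P := fun i x : ℕ => x.testBit i = true)
        (Q := fun i x : ℕ => x.testBit i = true) arith_testBit ?_ ?_)
      (Corr.ex (Corr.and (Arith.lt ?_ ?_) (Corr.eq ?_ ?_)))))))))
    (fun v => (subexpComputable_iff _ _ _).symm) (fun v => (subexpComputable_iff _ _ _).symm)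
  · exact hP _ _
  · exact CorrF.var _
  · exact ArithF.primrec₁ primrec_circuitNat_size (CorrF.var _)
  · exact h2 _
  · exact CorrF.var _
  · exact CorrF.var _
  · exact CorrF.var _
  · exact h2 _
  · exact CorrF.var _
  · exact CorrF.natPair (CorrF.var _) (ArithF.primrec₂ primrec_circuitNat_eval (CorrF.var _)
      (CorrF.var _))

end Coding

/-! ### Existence of saturated non-standard models -/

section Existence

open Filter

instance finite_LA_symbols : Finite LA.Symbols := by
  have hF : Finite (Σ l, LA.Functions l) := by
    refine Finite.of_surjective (α := Fin 8) ![⟨0, zeroS⟩, ⟨0, oneS⟩, ⟨2, addS⟩, ⟨2, mulS⟩,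
      ⟨2, pairS⟩, ⟨1, proj1S⟩, ⟨1, proj2S⟩, ⟨1, lenS⟩] ?_
    rintro ⟨_, _ | _⟩
    exacts [⟨0, rfl⟩, ⟨1, rfl⟩, ⟨2, rfl⟩, ⟨3, rfl⟩, ⟨4, rfl⟩, ⟨5, rfl⟩, ⟨6, rfl⟩, ⟨7, rfl⟩]
  have hR : Finite (Σ l, LA.Relations l) := by
    refine Finite.of_surjective (α := Unit) (fun _ => ⟨2, leS⟩) ?_
    rintro ⟨_, _ | _⟩
    exact ⟨(), rfl⟩
  exact inferInstanceAs (Finite ((Σ l, LA.Functions l) ⊕ Σ l, LA.Relations l))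

/-- The ultrapower of the standard model by a non-principal ultrafilter. -/
def UltraNat : Type := (hyperfilter ℕ : Filter ℕ).Product fun _ : ℕ => ℕ

instance : LA.Structure UltraNat :=
  Ultraproduct.structure (u := hyperfilter ℕ) (M := fun _ : ℕ => ℕ)

/-- The class of a sequence. -/
def UltraNat.mk (f : ℕ → ℕ) : UltraNat :=
  Quotient.mk ((hyperfilter ℕ : Filter ℕ).productSetoid fun _ => ℕ) f

theorem UltraNat.exists_mk (x : UltraNat) : ∃ f, UltraNat.mk f = x := Quot.exists_rep x

theorem ultraNat_equiv : UltraNat ≅[LA] ℕ := by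
  refine elementarilyEquivalent_iff.2 fun φ => ?_
  refine (Ultraproduct.sentence_realize (u := hyperfilter ℕ) (M := fun _ : ℕ => ℕ) φ).trans ?_
  simp

theorem UltraNat.realize {β : Type*} (φ : LA.Formula β) (x : β → ℕ → ℕ) :
    φ.Realize (fun i => UltraNat.mk (x i)) ↔
      ∀ᶠ a in (hyperfilter ℕ : Filter ℕ), φ.Realize fun i => x i a :=
  Ultraproduct.realize_formula_cast (u := hyperfilter ℕ) (M := fun _ : ℕ => ℕ) φ x

theorem UltraNat.funMap {n : ℕ} (f : LA.Functions n) (x : Fin n → ℕ → ℕ) :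
    Structure.funMap f (fun i => UltraNat.mk (x i)) =
      UltraNat.mk fun a => Structure.funMap f fun i => x i a :=
  Ultraproduct.funMap_cast (u := hyperfilter ℕ) (M := fun _ : ℕ => ℕ) f x

theorem ultraNat_num (k : ℕ) : num UltraNat k = UltraNat.mk fun _ => k := by
  have h0 (f : LA.Functions 0) :
      Structure.funMap f ![] = UltraNat.mk fun _ => Structure.funMap f ![] := by
    refine .trans (congrArg _ (Subsingleton.elim _ _)) ((UltraNat.funMap f ![]).trans
      (congrArg _ (funext fun _ => congrArg _ (Subsingleton.elim _ _))))
  induction k with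
  | zero => exact h0 zeroS
  | succ k ih =>
    rw [num, ih, h0 oneS]
    have := UltraNat.funMap addS ![fun _ => k, fun _ => 1]
    refine Eq.trans ?_ this
    congr 1
    ext i
    fin_cases i <;> rfl

theorem exists_nonstandard_ultraNat : ∃ n : UltraNat, Nonstandard n := by
  refine ⟨UltraNat.mk fun i => i, fun k hk => ?_⟩
  rw [ultraNat_num] at hk
  have h : ∀ᶠ i : ℕ in (hyperfilter ℕ : Filter ℕ), i = k := Quotient.exact hk
  have : ({k} : Set ℕ) ∉ (hyperfilter ℕ : Filter ℕ) :=
    notMem_hyperfilter_of_finite (Set.finite_singleton k)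
  exact this (by simpa [Filter.Eventually] using h)

/-- The usual diagonal argument: solutions of longer and longer finite parts of the type are glued
along the index set, by Łoś's theorem. -/
theorem ultraNat_saturated : Aleph1Saturated UltraNat := by
  intro A hA p hp
  have := hA.to_subtype
  obtain rfl | hne := p.eq_empty_or_nonempty
  · exact ⟨UltraNat.mk fun _ => 0, by simp⟩
  -- A finite language with countably many parameters has only countably many formulas.
  obtain ⟨φ, rfl⟩ := (Set.to_countable p).exists_eq_range hne
  have hx : ∀ N : ℕ, ∃ x : UltraNat, ∀ j ≤ N,
      (φ j).Realize (Sum.elim (fun a : A => (a : UltraNat)) (fun _ => x)) := by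
    classical
    intro N
    obtain ⟨x, hx⟩ := hp ((Finset.range (N + 1)).image φ) (by
      intro ψ hψ
      obtain ⟨j, -, rfl⟩ := Finset.mem_image.1 (Finset.mem_coe.1 hψ)
      exact ⟨j, rfl⟩)
    exact ⟨x, fun j hj => hx _ (Finset.mem_image_of_mem _ (Finset.mem_range.2 (by lia)))⟩
  choose x hx using hx
  choose rep hrep using UltraNat.exists_mk
  have los (j : ℕ) (f : ℕ → ℕ) :
      (φ j).Realize (Sum.elim (fun a : A => (a : UltraNat)) (fun _ => UltraNat.mk f)) ↔
        ∀ᶠ i in (hyperfilter ℕ : Filter ℕ),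
          (φ j).Realize (Sum.elim (fun a : A => rep a i) (fun _ => f i)) := by
    have h := UltraNat.realize (φ j) (Sum.elim (fun a : A => rep a) (fun _ => f))
    have h1 : (fun i => UltraNat.mk (Sum.elim (fun a : A => rep a) (fun _ : Unit => f) i)) =
        Sum.elim (fun a : A => (a : UltraNat)) (fun _ => UltraNat.mk f) := by
      ext c
      rcases c with a | _
      exacts [hrep a, rfl]
    have h2 (i : ℕ) : (fun c => Sum.elim (fun a : A => rep a) (fun _ : Unit => f) c i) =
        Sum.elim (fun a : A => rep a i) (fun _ => f i) := by
      ext c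
      rcases c with a | _ <;> rfl
    simpa only [h1, h2] using h
  let good (N i : ℕ) : Prop := ∀ j ≤ N, (φ j).Realize
    (Sum.elim (fun a : A => rep a i) (fun _ => rep (x N) i))
  classical
  -- At index i, use the solution of the longest initial part, of index at most i, that is correct
  -- at i. For fixed j, almost all i satisfy `good j i` and j ≤ i, so the index used there is at
  -- least j.
  let f : ℕ → ℕ := fun i => rep (x (Nat.findGreatest (fun N => good N i) i)) i
  refine ⟨UltraNat.mk f, ?_⟩
  rintro _ ⟨j, rfl⟩
  rw [los]
  have hgood : ∀ᶠ i in (hyperfilter ℕ : Filter ℕ), good j i := by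
    refine (eventually_all_finite (Set.finite_Iic j)).2 fun l hl => ?_
    rw [← los, hrep]
    exact hx j l hl
  have hlarge : ∀ᶠ i in (hyperfilter ℕ : Filter ℕ), j ≤ i :=
    hyperfilter_le_cofinite (by simpa [Filter.Eventually] using
      (Nat.cofinite_eq_atTop ▸ eventually_ge_atTop j : ∀ᶠ i in cofinite, j ≤ i))
  filter_upwards [hgood, hlarge] with i h1 h2
  exact Nat.findGreatest_spec (P := fun N => good N i) h2 h1 j (Nat.le_findGreatest h2 h1)

end Existence

/-! ### Bits of pairs and projections -/

section PairingBits

/-- The lowest base-4 digit of the pair consists of the lowest bits of a and b; the bits of pairs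
are computed by induction on this. -/
theorem natPair_eq (a b : ℕ) :
    natPair a b = (a % 2 + 2 * (b % 2)) + 4 * natPair (a / 2) (b / 2) := by
  have h : ∀ a : ℕ, Nat.ofDigits 4 (Nat.digits 2 a) =
      a % 2 + 4 * Nat.ofDigits 4 (Nat.digits 2 (a / 2)) := by
    intro a
    rcases Nat.eq_zero_or_pos a with rfl | ha
    · simp
    · rw [Nat.digits_def' (by norm_num) ha, Nat.ofDigits_cons]
  unfold natPair
  rw [h a, h b]
  ring

theorem testBit_two_mul_add (i c z : ℕ) (hc : c < 2) :
    (c + 2 * z).testBit (i + 1) = z.testBit i := by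
  rw [Nat.testBit_succ]
  congr 1
  lia

theorem testBit_zero_add_two_mul (c z : ℕ) (hc : c < 2) :
    (c + 2 * z).testBit 0 = decide (c = 1) := by
  rw [Nat.testBit_zero]
  congr 1
  apply propext
  lia

theorem testBit_natPair (i : ℕ) : ∀ a b, (natPair a b).testBit (2 * i) = a.testBit i ∧
    (natPair a b).testBit (2 * i + 1) = b.testBit i := by
  induction i with
  | zero =>
    intro a b
    have h : natPair a b = a % 2 + 2 * (b % 2 + 2 * natPair (a / 2) (b / 2)) := by
      rw [natPair_eq]; ring
    rw [h]
    have ha := Nat.mod_lt a (y := 2) (by norm_num)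
    have hb := Nat.mod_lt b (y := 2) (by norm_num)
    rw [testBit_zero_add_two_mul _ _ ha, testBit_two_mul_add _ _ _ ha,
      testBit_zero_add_two_mul _ _ hb, Nat.testBit_zero, Nat.testBit_zero]
    exact ⟨rfl, rfl⟩
  | succ i ih =>
    intro a b
    have h : natPair a b = a % 2 + 2 * (b % 2 + 2 * natPair (a / 2) (b / 2)) := by
      rw [natPair_eq]; ring
    have ha := Nat.mod_lt a (y := 2) (by norm_num)
    have hb := Nat.mod_lt b (y := 2) (by norm_num)
    rw [h, show 2 * (i + 1) = (2 * i + 1) + 1 by ring, testBit_two_mul_add _ _ _ ha,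
      testBit_two_mul_add _ _ _ hb, testBit_two_mul_add _ _ _ ha,
      testBit_two_mul_add _ _ _ hb, (ih _ _).1, (ih _ _).2, Nat.testBit_succ, Nat.testBit_succ]
    exact ⟨rfl, rfl⟩

theorem natProj1_eq (z : ℕ) : natProj1 z = z % 2 + 2 * natProj1 (z / 4) := by
  unfold natProj1
  rcases Nat.eq_zero_or_pos z with rfl | hz
  · simp
  · conv_lhs => rw [Nat.digits_def' (by norm_num) hz]
    rw [List.map_cons, Nat.ofDigits_cons, Nat.mod_mod_of_dvd z (by norm_num)]

theorem natProj2_eq (z : ℕ) : natProj2 z = z / 2 % 2 + 2 * natProj2 (z / 4) := by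
  unfold natProj2
  rcases Nat.eq_zero_or_pos z with rfl | hz
  · simp
  · conv_lhs => rw [Nat.digits_def' (by norm_num) hz]
    rw [List.map_cons, Nat.ofDigits_cons]
    congr 1
    lia

theorem testBit_natProj1 (i : ℕ) : ∀ z, (natProj1 z).testBit i = z.testBit (2 * i) := by
  induction i with
  | zero =>
    intro z
    rw [natProj1_eq, testBit_zero_add_two_mul _ _ (Nat.mod_lt _ (by norm_num)), Nat.testBit_zero]
  | succ i ih =>
    intro z
    rw [natProj1_eq, testBit_two_mul_add _ _ _ (Nat.mod_lt _ (by norm_num)), ih,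
      show 2 * (i + 1) = (2 * i + 1) + 1 by ring, Nat.testBit_succ, Nat.testBit_succ,
      Nat.div_div_eq_div_mul]

theorem testBit_natProj2 (i : ℕ) : ∀ z, (natProj2 z).testBit i = z.testBit (2 * i + 1) := by
  induction i with
  | zero =>
    intro z
    rw [natProj2_eq, testBit_zero_add_two_mul _ _ (Nat.mod_lt _ (by norm_num)), Nat.testBit_succ,
      Nat.testBit_zero]
  | succ i ih =>
    intro z
    rw [natProj2_eq, testBit_two_mul_add _ _ _ (Nat.mod_lt _ (by norm_num)), ih,
      show 2 * (i + 1) + 1 = (2 * i + 1 + 1) + 1 by ring, Nat.testBit_succ (z) (2 * i + 1 + 1),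
      Nat.testBit_succ (z / 2), Nat.div_div_eq_div_mul]

theorem natProj1_natPair (a b : ℕ) : natProj1 (natPair a b) = a :=
  Nat.eq_of_testBit_eq fun i => by rw [testBit_natProj1, (testBit_natPair i a b).1]

theorem natProj2_natPair (a b : ℕ) : natProj2 (natPair a b) = b :=
  Nat.eq_of_testBit_eq fun i => by rw [testBit_natProj2, (testBit_natPair i a b).2]

theorem natPair_natProj (z : ℕ) : natPair (natProj1 z) (natProj2 z) = z := by
  refine Nat.eq_of_testBit_eq fun i => ?_
  obtain ⟨j, rfl | rfl⟩ := Nat.even_or_odd' i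
  · rw [(testBit_natPair j _ _).1, testBit_natProj1]
  · rw [(testBit_natPair j _ _).2, testBit_natProj2]

theorem natPair_inj {a b a' b' : ℕ} (h : natPair a b = natPair a' b') : a = a' ∧ b = b' :=
  ⟨by rw [← natProj1_natPair a b, h, natProj1_natPair],
    by rw [← natProj2_natPair a b, h, natProj2_natPair]⟩

end PairingBits

/-! ### Circuit complexity -/

section Circuits

/-- The values of gates that are appended to gates with values `vals`. -/
def runGates (G : List Gate) (x : ℕ) (vals : List Bool) : List Bool :=
  G.foldl (fun vals g => vals ++ [g.eval x vals]) vals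

theorem runGates_append (G H : List Gate) (x : ℕ) (vals : List Bool) :
    runGates (G ++ H) x vals = runGates H x (runGates G x vals) := List.foldl_append

theorem runGates_cons (g : Gate) (G : List Gate) (x : ℕ) (vals : List Bool) :
    runGates (g :: G) x vals = runGates G x (vals ++ [g.eval x vals]) := rfl

theorem length_runGates (G : List Gate) (x : ℕ) (vals : List Bool) :
    (runGates G x vals).length = vals.length + G.length := by
  induction G generalizing vals with
  | nil => rfl
  | cons g G ih => rw [runGates_cons, ih]; simp; ring

theorem getD_runGates (G : List Gate) (x : ℕ) (vals : List Bool) {i : ℕ} (hi : i < vals.length) :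
    (runGates G x vals).getD i false = vals.getD i false := by
  induction G generalizing vals with
  | nil => rfl
  | cons g G ih =>
    rw [runGates_cons, ih _ (by simp; lia), List.getD_append _ _ _ _ hi]

/-- `G` has a gate that computes `f`. -/
def Avail (G : List Gate) (f : ℕ → Bool) : Prop :=
  ∃ o < G.length, ∀ x, (runGates G x []).getD o false = f x

/-- Later gates do not change the values of existing wires. This is why `Avail` asks for an existing
gate: a missing wire reads `false` now, but could be a gate of H later. -/
theorem Avail.append {G : List Gate} {f : ℕ → Bool} (h : Avail G f) (H : List Gate) :
    Avail (G ++ H) f := by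
  obtain ⟨o, ho, h⟩ := h
  refine ⟨o, by simp; lia, fun x => ?_⟩
  rw [runGates_append, getD_runGates, h]
  rwa [length_runGates, List.length_nil, zero_add]

theorem avail_gate (G : List Gate) (g : Gate) :
    Avail (G ++ [g]) (fun x => g.eval x (runGates G x [])) := by
  refine ⟨G.length, by simp, fun x => ?_⟩
  rw [runGates_append, runGates_cons, runGates, List.foldl_nil, List.getD_append_right] <;>
  simp [length_runGates]

/-- From gates that compute the functions in `A`, those in `B` can be computed by `s` more gates. -/
def Cost (A : Set (ℕ → Bool)) (s : ℕ) (B : Set (ℕ → Bool)) : Prop :=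
  ∀ G, (∀ f ∈ A, Avail G f) → ∃ H, H.length ≤ s ∧ ∀ f ∈ B, Avail (G ++ H) f

variable {A A' B B' C : Set (ℕ → Bool)} {s s' t : ℕ} {f g h : ℕ → Bool}

theorem Cost.mono (hc : Cost A s B) (hA : A ⊆ A') (hs : s ≤ s') (hB : B' ⊆ B) : Cost A' s' B' := by
  intro G hG
  obtain ⟨H, h1, h2⟩ := hc G fun f hf => hG f (hA hf)
  exact ⟨H, h1.trans hs, fun f hf => h2 f (hB hf)⟩

theorem Cost.of_subset (hB : B ⊆ A) : Cost A s B :=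
  fun G hG => ⟨[], by simp, fun f hf => by simpa using hG f (hB hf)⟩

/-- The second computation may reuse the wires produced by the first, and both results stay
available; thus shared subcircuits are counted once. -/
theorem Cost.seq (h1 : Cost A s B) (h2 : Cost (A ∪ B) t C) : Cost A (s + t) (B ∪ C) := by
  intro G hG
  obtain ⟨H, hs, hH⟩ := h1 G hG
  obtain ⟨H', ht, hH'⟩ := h2 (G ++ H) (by
    rintro f (hf | hf)
    · exact (hG f hf).append _
    · exact hH f hf)
  refine ⟨H ++ H', by simp; lia, ?_⟩
  rw [← List.append_assoc]
  rintro f (hf | hf)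
  · exact (hH f hf).append _
  · exact hH' f hf

theorem Cost.trans (h1 : Cost A s B) (h2 : Cost (A ∪ B) t C) : Cost A (s + t) C :=
  (h1.seq h2).mono subset_rfl le_rfl subset_union_right

theorem Cost.union (h1 : Cost A s B) (h2 : Cost A t C) : Cost A (s + t) (B ∪ C) :=
  h1.seq (h2.mono subset_union_left le_rfl subset_rfl)

theorem Cost.iUnion {S : ℕ → Set (ℕ → Bool)} (m : ℕ) (h : ∀ i < m, Cost A s (S i)) :
    Cost A (m * s) {f | ∃ i < m, f ∈ S i} := by
  induction m with
  | zero => exact Cost.of_subset (by rintro f ⟨i, hi, -⟩; lia)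
  | succ m ih =>
    refine ((ih fun i hi => h i (by lia)).union (h m (by lia))).mono subset_rfl ?_ ?_
    · rw [Nat.succ_mul]
    · rintro f ⟨i, hi, hf⟩
      rcases Nat.lt_succ_iff_lt_or_eq.1 hi with hi | rfl
      · exact Or.inl ⟨i, hi, hf⟩
      · exact Or.inr hf

/-- Computing the members of a sequence one after the other. -/
theorem Cost.iterate {S : ℕ → Set (ℕ → Bool)} (m : ℕ) (h0 : S 0 ⊆ A)
    (h : ∀ i < m, Cost (A ∪ S i) s (S (i + 1))) : Cost A (m * s) {f | ∃ i ≤ m, f ∈ S i} := by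
  induction m with
  | zero =>
    refine Cost.of_subset ?_
    rintro f ⟨i, hi, hf⟩
    obtain rfl : i = 0 := by lia
    exact h0 hf
  | succ m ih =>
    refine ((ih fun i hi => h i (by lia)).seq ((h m (by lia)).mono (union_subset_union_right _ ?_)
      le_rfl subset_rfl)).mono subset_rfl ?_ ?_
    · exact fun f hf => ⟨m, le_rfl, hf⟩
    · rw [Nat.succ_mul]
    · rintro f ⟨i, hi, hf⟩
      rcases Nat.lt_succ_iff_lt_or_eq.1 (Nat.lt_succ_of_le hi) with hi | rfl
      · exact Or.inl ⟨i, by lia, hf⟩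
      · exact Or.inr hf

theorem Cost.of_mem (hf : f ∈ A) : Cost A 0 {f} := Cost.of_subset (by simpa)

theorem Cost.not (hf : Cost A s {f}) : Cost A (s + 1) {fun x => !f x} := by
  refine hf.trans fun G hG => ?_
  obtain ⟨o, -, h⟩ := hG f (by simp)
  refine ⟨[.not o], le_rfl, ?_⟩
  rintro _ rfl
  convert avail_gate G (.not o) using 2 with x
  simp only [Gate.eval, h]

theorem Cost.and (hf : Cost A s {f}) (hg : Cost A t {g}) :
    Cost A (s + t + 1) {fun x => f x && g x} := by
  refine (hf.union hg).trans fun G hG => ?_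
  obtain ⟨o, -, h⟩ := hG f (by simp)
  obtain ⟨o', -, h'⟩ := hG g (by simp)
  refine ⟨[.and o o'], le_rfl, ?_⟩
  rintro _ rfl
  convert avail_gate G (.and o o') using 2 with x
  simp only [Gate.eval, h, h']

theorem Cost.or (hf : Cost A s {f}) (hg : Cost A t {g}) :
    Cost A (s + t + 1) {fun x => f x || g x} := by
  refine (hf.union hg).trans fun G hG => ?_
  obtain ⟨o, -, h⟩ := hG f (by simp)
  obtain ⟨o', -, h'⟩ := hG g (by simp)
  refine ⟨[.or o o'], le_rfl, ?_⟩
  rintro _ rfl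
  convert avail_gate G (.or o o') using 2 with x
  simp only [Gate.eval, h, h']

theorem Cost.xor (hf : f ∈ A) (hg : Cost A t {g}) :
    Cost A (2 * t + 4) {fun x => f x ^^ g x} := by
  have := ((Cost.of_mem hf).or hg).and ((Cost.of_mem hf).and hg).not
  convert this.mono subset_rfl (show _ ≤ 2 * t + 4 by lia) subset_rfl using 2
  ext x
  cases f x <;> cases g x <;> rfl

theorem Cost.ite (hf : f ∈ A) (hg : g ∈ A) (hh : h ∈ A) :
    Cost A 4 {fun x => bif f x then g x else h x} := by
  have := ((Cost.of_mem hf).and (.of_mem hg)).or ((Cost.of_mem hf).not.and (.of_mem hh))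
  convert this.mono subset_rfl (show _ ≤ 4 by lia) subset_rfl using 2
  ext x
  cases f x <;> cases g x <;> cases h x <;> rfl

/-- The constant functions. -/
def constFuns : Set (ℕ → Bool) := range fun c _ => c

/-- The bits of a function with numbers as values. -/
def bitFuns (α : ℕ → ℕ) : Set (ℕ → Bool) := range fun i x => (α x).testBit i

theorem const_mem (hA : constFuns ⊆ A) (c : Bool) : (fun _ => c) ∈ A := hA ⟨c, rfl⟩

theorem bit_mem {α : ℕ → ℕ} (hA : bitFuns α ⊆ A) (i : ℕ) : (fun x => (α x).testBit i) ∈ A :=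
  hA ⟨i, rfl⟩

/-- It suffices to compute the bits below `m` when the others vanish. -/
theorem Cost.bitFuns_of_lt {γ : ℕ → ℕ} (hK : constFuns ⊆ A) (m : ℕ) (hγ : ∀ x, γ x < 2 ^ m)
    (h : ∀ i < m, Cost A s {fun x => (γ x).testBit i}) : Cost A (m * s) (bitFuns γ) := by
  refine (((Cost.iUnion m h).seq (Cost.of_subset (s := 0) (B := A) subset_union_left))).mono
    subset_rfl (by lia) ?_
  rintro _ ⟨i, rfl⟩
  rcases lt_or_ge i m with hi | hi
  · exact Or.inl ⟨i, hi, rfl⟩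
  · right
    convert const_mem hK false using 2 with x
    exact Nat.testBit_eq_false_of_lt ((hγ x).trans_le (Nat.pow_le_pow_right (by norm_num) hi))

end Circuits

/-! ### Circuits for the arithmetical operations -/

section Operations

variable {A : Set (ℕ → Bool)} {α β : ℕ → ℕ}

/-- The carry into position `i` in the addition of `a` and `b`. -/
def carryBit (a b i : ℕ) : Bool := decide (2 ^ i ≤ a % 2 ^ i + b % 2 ^ i)

theorem carry_ofNat (a b : ℕ) {i w : ℕ} (hi : i ≤ w) :
    BitVec.carry i (BitVec.ofNat w a) (BitVec.ofNat w b) false = carryBit a b i := by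
  simp [BitVec.carry, carryBit, Nat.mod_mod_of_dvd _ (pow_dvd_pow 2 hi)]

theorem carryBit_succ (a b i : ℕ) : carryBit a b (i + 1) =
    ((a.testBit i && b.testBit i) || (carryBit a b i && (a.testBit i || b.testBit i))) := by
  have := BitVec.carry_succ i (BitVec.ofNat (i + 1) a) (BitVec.ofNat (i + 1) b) false
  rw [carry_ofNat _ _ le_rfl, carry_ofNat _ _ (Nat.le_succ i)] at this
  rw [this]
  simp only [BitVec.getLsbD_ofNat, Nat.lt_succ_self, decide_true, Bool.true_and]
  cases a.testBit i <;> cases b.testBit i <;> cases carryBit a b i <;> rfl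

theorem testBit_add (a b i : ℕ) :
    (a + b).testBit i = (a.testBit i ^^ (b.testBit i ^^ carryBit a b i)) := by
  have := BitVec.getLsbD_add (Nat.lt_succ_self i) (BitVec.ofNat (i + 1) a) (BitVec.ofNat (i + 1) b)
  rw [carry_ofNat _ _ (Nat.le_succ i), ← BitVec.ofNat_add] at this
  simpa only [BitVec.getLsbD_ofNat, Nat.lt_succ_self, decide_true, Bool.true_and] using this

/-- Ripple-carry addition: four gates for each carry, then twelve gates for each bit of the sum,
which is the exclusive or of two bits and a carry. -/
theorem cost_add (hK : constFuns ⊆ A) (hα : bitFuns α ⊆ A) (hβ : bitFuns β ⊆ A) (m : ℕ)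
    (hm : ∀ x, α x + β x < 2 ^ m) : Cost A (m * 20) (bitFuns fun x => α x + β x) := by
  have h1 : Cost A (m * 4) {f | ∃ i ≤ m, f ∈ ({fun x => carryBit (α x) (β x) i} : Set _)} := by
    refine Cost.iterate m ?_ fun i _ => ?_
    · rintro _ rfl
      convert const_mem hK false using 2 with x
      simp [carryBit, Nat.mod_one]
    · simp only [carryBit_succ]
      have ha : (fun x => (α x).testBit i) ∈ A ∪ {fun x => carryBit (α x) (β x) i} :=
        Or.inl (bit_mem hα i)
      have hb : (fun x => (β x).testBit i) ∈ A ∪ {fun x => carryBit (α x) (β x) i} :=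
        Or.inl (bit_mem hβ i)
      have hc : (fun x => carryBit (α x) (β x) i) ∈ A ∪ {fun x => carryBit (α x) (β x) i} :=
        Or.inr rfl
      exact ((Cost.of_mem ha).and (Cost.of_mem hb)).or
        ((Cost.of_mem hc).and ((Cost.of_mem ha).or (Cost.of_mem hb)))
  refine (h1.trans (t := m * 12) (Cost.bitFuns_of_lt ?_ m hm fun i hi => ?_)).mono
    subset_rfl (by lia) subset_rfl
  · exact hK.trans subset_union_left
  · simp only [testBit_add]
    refine Cost.xor (t := 4) (Or.inl (bit_mem hα i)) ?_
    exact Cost.xor (t := 0) (Or.inl (bit_mem hβ i)) (Cost.of_mem (Or.inr ⟨i, hi.le, rfl⟩))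

/-- School multiplication: the products of α with the truncations of β are computed in turn. Each
step masks a shifted copy of α (2m gates) and adds it (20 gates for each of 2m bits), hence the 42.
-/
theorem cost_mul (hK : constFuns ⊆ A) (hα : bitFuns α ⊆ A) (hβ : bitFuns β ⊆ A) (m : ℕ)
    (ha : ∀ x, α x < 2 ^ m) (hb : ∀ x, β x < 2 ^ m) :
    Cost A (m * (m * 42)) (bitFuns fun x => α x * β x) := by
  have key (i : ℕ) (x : ℕ) : α x * (β x % 2 ^ (i + 1)) =
      α x * (β x % 2 ^ i) + bif (β x).testBit i then α x * 2 ^ i else 0 := by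
    rw [Nat.mod_pow_succ, mul_add]
    have h := bitNat_eq (β x) i
    rw [bitNat] at h
    rw [h]
    cases (β x).testBit i <;> simp
  have hlt (i : ℕ) (x : ℕ) : α x * (β x % 2 ^ i) < 2 ^ (m + m) := by
    rw [pow_add]
    exact Nat.mul_lt_mul'' (ha x) ((Nat.mod_le _ _).trans_lt (hb x))
  have := Cost.iterate (A := A) (s := m * 42) (S := fun i => bitFuns fun x => α x * (β x % 2 ^ i)) m
    (by
      rintro _ ⟨j, rfl⟩
      convert const_mem hK false using 2 with x
      simp [Nat.mod_one])
    (by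
      intro i hi
      set A' := A ∪ bitFuns fun x => α x * (β x % 2 ^ i)
      have hA : A ⊆ A' := subset_union_left
      have h1 : Cost A' ((m + m) * 1)
          (bitFuns fun x => bif (β x).testBit i then α x * 2 ^ i else 0) := by
        refine Cost.bitFuns_of_lt (hK.trans hA) _ (fun x => ?_) fun j _ => ?_
        · have := hlt (i + 1) x
          rw [key] at this
          lia
        · rcases lt_or_ge j i with hj | hj
          · refine (Cost.of_mem (hA (const_mem hK false))).mono subset_rfl (by lia) (Eq.subset ?_)
            congr 1
            ext x
            cases (β x).testBit i <;> simp [Nat.testBit_mul_two_pow, hj]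
          · refine ((Cost.of_mem (hA (bit_mem hβ i))).and
              (Cost.of_mem (hA (bit_mem hα (j - i))))).mono subset_rfl (by lia) (Eq.subset ?_)
            congr 1
            ext x
            cases (β x).testBit i <;> simp [Nat.testBit_mul_two_pow, hj]
      simp only [key]
      refine (h1.trans (t := (m + m) * 20) (cost_add ?_ ?_ ?_ _ fun x => ?_)).mono subset_rfl
        (by lia) subset_rfl
      · exact (hK.trans hA).trans subset_union_left
      · exact subset_union_right.trans subset_union_left
      · exact subset_union_right
      · rw [← key]
        exact hlt _ _)
  refine this.mono subset_rfl le_rfl fun f hf => ⟨m, le_rfl, ?_⟩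
  simpa only [Nat.mod_eq_of_lt (hb _)] using hf

theorem cost_pair (hα : bitFuns α ⊆ A) (hβ : bitFuns β ⊆ A) :
    Cost A 0 (bitFuns fun x => natPair (α x) (β x)) := by
  refine Cost.of_subset ?_
  rintro _ ⟨i, rfl⟩
  obtain ⟨j, rfl | rfl⟩ := Nat.even_or_odd' i
  · simpa only [(testBit_natPair _ _ _).1] using bit_mem hα j
  · simpa only [(testBit_natPair _ _ _).2] using bit_mem hβ j

theorem cost_proj1 (hα : bitFuns α ⊆ A) : Cost A 0 (bitFuns fun x => natProj1 (α x)) := by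
  refine Cost.of_subset ?_
  rintro _ ⟨i, rfl⟩
  simpa only [testBit_natProj1] using bit_mem hα _

theorem cost_proj2 (hα : bitFuns α ⊆ A) : Cost A 0 (bitFuns fun x => natProj2 (α x)) := by
  refine Cost.of_subset ?_
  rintro _ ⟨i, rfl⟩
  simpa only [testBit_natProj2] using bit_mem hα _

theorem size_mod_two_pow_succ (a i : ℕ) :
    Nat.size (a % 2 ^ (i + 1)) = bif a.testBit i then i + 1 else Nat.size (a % 2 ^ i) := by
  have h := bitNat_eq a i
  rw [bitNat] at h
  rw [Nat.mod_pow_succ, h]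
  have hlt : a % 2 ^ i < 2 ^ i := Nat.mod_lt _ (by positivity)
  cases a.testBit i
  · simp
  · apply le_antisymm
    · rw [cond_true, Nat.size_le, pow_succ]
      simp
      lia
    · rw [cond_true, Nat.add_one_le_iff, Nat.lt_size]
      simp

/-- The lengths of the truncations of α are updated from low to high positions: at position i, the
bit of α selects between the constant i + 1 and the previous length. -/
theorem cost_size (hK : constFuns ⊆ A) (hα : bitFuns α ⊆ A) (m : ℕ)
    (ha : ∀ x, α x < 2 ^ m) : Cost A (m * (m * 4)) (bitFuns fun x => Nat.size (α x)) := by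
  have := Cost.iterate (A := A) (s := m * 4)
    (S := fun i => bitFuns fun x => Nat.size (α x % 2 ^ i)) m
    (by
      rintro _ ⟨j, rfl⟩
      convert const_mem hK false using 2 with x
      simp [Nat.mod_one])
    (by
      intro i hi
      have hA : A ⊆ A ∪ bitFuns fun x => Nat.size (α x % 2 ^ i) := subset_union_left
      refine Cost.bitFuns_of_lt (hK.trans hA) _ (fun x => ?_) fun j _ => ?_
      · have h1 : Nat.size (α x % 2 ^ (i + 1)) ≤ i + 1 :=
          Nat.size_le.2 (Nat.mod_lt _ (by positivity))
        have h2 := Nat.lt_two_pow_self (n := m)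
        lia
      · simp only [size_mod_two_pow_succ]
        convert Cost.ite (hA (bit_mem hα i)) (hA (const_mem hK ((i + 1).testBit j)))
          (bit_mem (A := A ∪ bitFuns fun x => Nat.size (α x % 2 ^ i)) subset_union_right j)
          using 2
        ext x
        cases (α x).testBit i <;> rfl)
  refine this.mono subset_rfl le_rfl fun f hf => ⟨m, le_rfl, ?_⟩
  simpa only [Nat.mod_eq_of_lt (ha _)] using hf

/-- The top bits decide the comparison unless they agree; then the lower parts do. -/
theorem mod_two_pow_succ_le (a b i : ℕ) : decide (a % 2 ^ (i + 1) ≤ b % 2 ^ (i + 1)) =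
    ((!a.testBit i && b.testBit i) ||
      ((!a.testBit i || b.testBit i) && decide (a % 2 ^ i ≤ b % 2 ^ i))) := by
  have ha := bitNat_eq a i
  have hb := bitNat_eq b i
  rw [bitNat] at ha hb
  rw [Nat.mod_pow_succ, Nat.mod_pow_succ, ha, hb]
  have h1 : a % 2 ^ i < 2 ^ i := Nat.mod_lt _ (by positivity)
  have h2 : b % 2 ^ i < 2 ^ i := Nat.mod_lt _ (by positivity)
  cases a.testBit i <;> cases b.testBit i <;> simp <;> lia

theorem cost_le (hK : constFuns ⊆ A) (hα : bitFuns α ⊆ A) (hβ : bitFuns β ⊆ A) (m : ℕ)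
    (ha : ∀ x, α x < 2 ^ m) (hb : ∀ x, β x < 2 ^ m) :
    Cost A (m * 7) {fun x => decide (α x ≤ β x)} := by
  have := Cost.iterate (A := A) (s := 7)
    (S := fun i => {fun x => decide (α x % 2 ^ i ≤ β x % 2 ^ i)}) m
    (by
      rintro _ rfl
      convert const_mem hK true using 2 with x
      simp [Nat.mod_one])
    (by
      intro i hi
      simp only [mod_two_pow_succ_le]
      set A' := A ∪ {fun x => decide (α x % 2 ^ i ≤ β x % 2 ^ i)}
      have h1 : (fun x => (α x).testBit i) ∈ A' := Or.inl (bit_mem hα i)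
      have h2 : (fun x => (β x).testBit i) ∈ A' := Or.inl (bit_mem hβ i)
      have h3 : (fun x => decide (α x % 2 ^ i ≤ β x % 2 ^ i)) ∈ A' := Or.inr rfl
      exact (((Cost.of_mem h1).not.and (Cost.of_mem h2)).or
        (((Cost.of_mem h1).not.or (Cost.of_mem h2)).and (Cost.of_mem h3))).mono subset_rfl
        (by lia) subset_rfl)
  refine this.mono subset_rfl le_rfl ?_
  rintro _ rfl
  refine ⟨m, le_rfl, ?_⟩
  simp only [Nat.mod_eq_of_lt (ha _), Nat.mod_eq_of_lt (hb _), mem_singleton_iff]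

/-- The indicator of `a ≤ b`. -/
def leInd (a b : ℕ) : ℕ := if a ≤ b then 1 else 0

theorem cost_leInd (hK : constFuns ⊆ A) (hα : bitFuns α ⊆ A) (hβ : bitFuns β ⊆ A) (m : ℕ)
    (ha : ∀ x, α x < 2 ^ m) (hb : ∀ x, β x < 2 ^ m) :
    Cost A (m * 7) (bitFuns fun x => leInd (α x) (β x)) := by
  have := Cost.bitFuns_of_lt (A := A) (s := m * 7) (γ := fun x => leInd (α x) (β x)) hK 1
    (fun x => by unfold leInd; split_ifs <;> norm_num) fun i hi => by
      obtain rfl : i = 0 := by lia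
      convert cost_le hK hα hβ m ha hb using 4 with x
      unfold leInd
      split_ifs with h <;> simp [h]
  simpa using this

/-- A number of bit-length `v`, if `v ≤ 2 ^ m`. -/
def ones (m v : ℕ) : ℕ := 2 ^ min v (2 ^ m) - 1

theorem size_ones {m v : ℕ} (h : v ≤ 2 ^ m) : Nat.size (ones m v) = v := by
  rw [ones, min_eq_left h]
  apply le_antisymm
  · rw [Nat.size_le]
    exact Nat.sub_lt (by positivity) one_pos
  · rcases v with _ | v
    · simp
    · rw [Nat.add_one_le_iff, Nat.lt_size, pow_succ]
      have : 0 < 2 ^ v := by positivity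
      lia

/-- Unary expansion: for i < 2^m, bit i is 1 exactly if i is less than the value of α, which is one
comparison with a constant. The hypothesis on s makes these constants fit into s bits. -/
theorem cost_ones (hK : constFuns ⊆ A) (hα : bitFuns α ⊆ A) (s m : ℕ) (hs : 2 ^ m ≤ s)
    (ha : ∀ x, α x < 2 ^ s) : Cost A (2 ^ m * (s * 7 + 1)) (bitFuns fun x => ones m (α x)) := by
  refine Cost.bitFuns_of_lt hK _ (fun x => ?_) fun i hi => ?_
  · exact (Nat.sub_lt (by positivity) one_pos).trans_le
      (Nat.pow_le_pow_right (by norm_num) (min_le_right _ _))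
  · have h := cost_le (α := α) (β := fun _ => i) hK hα (by
      rintro _ ⟨j, rfl⟩
      exact const_mem hK _) s ha (fun x => (hi.trans_le hs).trans Nat.lt_two_pow_self)
    refine h.not.mono subset_rfl le_rfl (Eq.subset ?_)
    congr 1
    ext x
    rw [ones, Nat.testBit_two_pow_sub_one]
    rw [← decide_not, decide_eq_decide]
    lia

end Operations

/-! ### Functions with small circuits and operations of polynomial size -/

section CircuitFunctions

variable {α β γ : ℕ → ℕ} {s t u m : ℕ}

/-- The gate `g`, placed after `d` additional gates. -/
def Gate.shift (d : ℕ) : Gate → Gate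
  | const c => const c
  | input i => input i
  | not a => not (d + a)
  | and a b => and (d + a) (d + b)
  | or a b => or (d + a) (d + b)

theorem Gate.eval_shift (x : ℕ) (pre vals : List Bool) (g : Gate) :
    (g.shift pre.length).eval x (pre ++ vals) = g.eval x vals := by
  have h (a : ℕ) : (pre ++ vals).getD (pre.length + a) false = vals.getD a false := by
    rw [List.getD_append_right _ _ _ _ (by lia), Nat.add_sub_cancel_left]
  cases g <;> simp only [Gate.shift, Gate.eval, h]

theorem runGates_shift (x : ℕ) (pre vals : List Bool) (G : List Gate) :
    runGates (G.map (Gate.shift pre.length)) x (pre ++ vals) = pre ++ runGates G x vals := by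
  induction G generalizing vals with
  | nil => rfl
  | cons g G ih =>
    rw [List.map_cons, runGates_cons, runGates_cons, Gate.eval_shift, List.append_assoc, ih]

/-- `α` is computed by a circuit of size at most `s`, on inputs of any length. -/
def CircF (s : ℕ) (α : ℕ → ℕ) : Prop := ∃ C : Circuit, C.size ≤ s ∧ ∀ x, C.eval x = α x

theorem CircF.mono (h : CircF s α) (hs : s ≤ t) : CircF t α :=
  h.imp fun _ h => ⟨h.1.trans hs, h.2⟩

theorem testBit_ofDigits (l : List Bool) (i : ℕ) :
    (Nat.ofDigits 2 (l.map Bool.toNat)).testBit i = l.getD i false := by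
  induction l generalizing i with
  | nil => simp
  | cons b l ih =>
    rw [List.map_cons, Nat.ofDigits_cons]
    cases i with
    | zero => cases b <;> simp [Nat.testBit_zero]
    | succ i =>
      have := testBit_two_mul_add i b.toNat (Nat.ofDigits 2 (l.map Bool.toNat)) (by cases b <;> simp)
      simpa [ih] using this

theorem Circuit.testBit_eval (C : Circuit) (x i : ℕ) : (C.eval x).testBit i =
    (C.outputs.map fun o => (runGates C.gates x []).getD o false).getD i false := by
  rw [← testBit_ofDigits, List.map_map]
  rfl

theorem CircF.lt (h : CircF s α) (x : ℕ) : α x < 2 ^ s := by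
  obtain ⟨C, hC, h⟩ := h
  rw [← h]
  refine Nat.lt_pow_two_of_testBit _ fun i hi => ?_
  rw [C.testBit_eval, List.getD_eq_default]
  rw [List.length_map]
  unfold Circuit.size at hC
  lia

/-- The gates of a circuit for α are appended to the given ones, with their wires renumbered. -/
theorem CircF.cost (h : CircF s α) : Cost constFuns s (bitFuns α) := by
  obtain ⟨C, hC, h⟩ := h
  intro G hG
  refine ⟨C.gates.map (Gate.shift G.length), ?_, ?_⟩
  · unfold Circuit.size at hC
    simp
    lia
  · rintro _ ⟨i, rfl⟩
    have hfalse : Avail (G ++ C.gates.map (Gate.shift G.length)) fun _ => false :=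
      (hG _ ⟨false, rfl⟩).append _
    simp only [← h, C.testBit_eval]
    rcases lt_or_ge i C.outputs.length with hi | hi
    · rcases lt_or_ge C.outputs[i] C.gates.length with ho | ho
      · refine ⟨G.length + C.outputs[i], by simpa using ho, fun x => ?_⟩
        have hl : (runGates G x []).length = G.length := by rw [length_runGates]; simp
        have := runGates_shift x (runGates G x []) [] C.gates
        rw [List.append_nil, hl] at this
        rw [runGates_append, this, List.getD_append_right _ _ _ _ (by lia), hl,
          Nat.add_sub_cancel_left]
        simp [List.getD_eq_getElem?_getD, hi]
      -- An output that refers to a missing gate is `false` by convention, but after the circuit is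
      -- extended its index may exist; it is replaced by a constant gate.
      · convert hfalse using 2 with x
        rw [List.getD_eq_getElem?_getD, List.getElem?_map, List.getElem?_eq_getElem hi,
          Option.map_some, Option.getD_some, List.getD_eq_default]
        rw [length_runGates]
        simpa using ho
    · convert hfalse using 2 with x
      rw [List.getD_eq_default]
      simpa using hi

/-- Two gates for the constants, t for the computation, and m outputs. -/
theorem CircF.of_cost (h : Cost constFuns t (bitFuns α)) (hα : ∀ x, α x < 2 ^ m) :
    CircF (t + m + 2) α := by
  obtain ⟨H, hH, hB⟩ := h [.const false, .const true] (by
    rintro _ ⟨_ | _, rfl⟩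
    · exact ⟨0, by simp, fun x => rfl⟩
    · exact ⟨1, by simp, fun x => rfl⟩)
  choose o ho hval using fun i => hB _ ⟨i, rfl⟩
  refine ⟨⟨[.const false, .const true] ++ H, (List.range m).map o⟩, ?_, fun x => ?_⟩
  · simp [Circuit.size]
    lia
  · refine Nat.eq_of_testBit_eq fun i => ?_
    rw [Circuit.testBit_eval]
    simp only [List.map_map, Function.comp_def, hval]
    rcases lt_or_ge i m with hi | hi
    · simp [List.getD_eq_getElem?_getD, hi]
    · rw [List.getD_eq_default _ _ (by simpa using hi)]
      exact (Nat.testBit_eq_false_of_lt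
        ((hα x).trans_le (Nat.pow_le_pow_right (by norm_num) hi))).symm

/-- An operation, with a parameter `m` that is at most logarithmic in the size, that can be
computed by circuits of polynomial size. -/
def PolyOp (op : ℕ → ℕ → ℕ → ℕ) : Prop := ∃ c, 1 ≤ c ∧ ∀ m s α β, 2 ^ m ≤ s → CircF s α →
  CircF s β → CircF ((s + c) ^ c) fun x => op m (α x) (β x)

/-- Quadratically many additional gates and linearly many output bits suffice for all operations
used. The 8 added to c only serves to absorb the lower-order terms into one power. -/
theorem PolyOp.of_cost {op : ℕ → ℕ → ℕ → ℕ} (c : ℕ) (h : ∀ m s α β (A : Set (ℕ → Bool)), 2 ^ m ≤ s →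
    constFuns ⊆ A → bitFuns α ⊆ A → bitFuns β ⊆ A → (∀ x, α x < 2 ^ s) → (∀ x, β x < 2 ^ s) →
    Cost A (c * (s + 1) ^ 2) (bitFuns fun x => op m (α x) (β x)) ∧
      ∀ x, op m (α x) (β x) < 2 ^ (2 * s + 2)) : PolyOp op := by
  refine ⟨c + 8, by lia, fun m s α β hm hα hβ => ?_⟩
  obtain ⟨h1, h2⟩ := h m s α β (constFuns ∪ (bitFuns α ∪ bitFuns β)) hm subset_union_left
    (subset_union_left.trans subset_union_right) (subset_union_right.trans subset_union_right)
    hα.lt hβ.lt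
  refine (CircF.of_cost ((hα.cost.union hβ.cost).trans h1) h2).mono ?_
  have hc : c * (s + 1) ^ 2 ≤ (s + (c + 8)) ^ 3 := by
    rw [pow_succ' _ 2]
    exact Nat.mul_le_mul (by lia) (Nat.pow_le_pow_left (by lia) 2)
  calc s + s + c * (s + 1) ^ 2 + (2 * s + 2) + 2
      ≤ (s + (c + 8)) ^ 3 + 4 * (s + (c + 8)) := by lia
    _ ≤ (s + (c + 8)) ^ 3 + (s + (c + 8)) ^ 2 * (s + (c + 8)) := by
        gcongr
        nlinarith
    _ = 2 * (s + (c + 8)) ^ 3 := by ring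
    _ ≤ (s + (c + 8)) * (s + (c + 8)) ^ 3 := by gcongr; lia
    _ = (s + (c + 8)) ^ 4 := by ring
    _ ≤ (s + (c + 8)) ^ (c + 8) := Nat.pow_le_pow_right (by lia) (by lia)

theorem polyOp_const (b : ℕ) : PolyOp fun _ _ _ => b := by
  refine ⟨b + 2, by lia, fun m s α β hm _ _ => ?_⟩
  have : Cost constFuns 0 (bitFuns fun _ => b) := Cost.of_subset (by
    rintro _ ⟨j, rfl⟩
    exact const_mem subset_rfl _)
  refine (CircF.of_cost this (m := b) fun _ => Nat.lt_two_pow_self).mono ?_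
  exact (by lia : 0 + b + 2 ≤ s + (b + 2)).trans (Nat.le_self_pow (by lia) _)

theorem polyOp_add : PolyOp fun _ a b => a + b := by
  refine PolyOp.of_cost 20 fun m s α β A _ hK hα hβ ha hb => ?_
  have h (x : ℕ) : α x + β x < 2 ^ (s + 1) := by
    rw [pow_succ]; linarith [ha x, hb x]
  refine ⟨(cost_add hK hα hβ _ h).mono subset_rfl ?_ subset_rfl, fun x => (h x).trans_le
    (Nat.pow_le_pow_right (by norm_num) (by lia))⟩
  nlinarith

theorem polyOp_mul : PolyOp fun _ a b => a * b := by
  refine PolyOp.of_cost 42 fun m s α β A _ hK hα hβ ha hb =>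
    ⟨(cost_mul hK hα hβ _ ha hb).mono subset_rfl (by nlinarith) subset_rfl, fun x => ?_⟩
  refine (Nat.mul_lt_mul'' (ha x) (hb x)).trans_le ?_
  rw [← pow_add]
  exact Nat.pow_le_pow_right (by norm_num) (by lia)

theorem natPair_lt {a b s : ℕ} (ha : a < 2 ^ s) (hb : b < 2 ^ s) : natPair a b < 2 ^ (2 * s) := by
  refine Nat.lt_pow_two_of_testBit _ fun i hi => ?_
  obtain ⟨j, rfl | rfl⟩ := Nat.even_or_odd' i
  · rw [(testBit_natPair _ _ _).1]
    exact Nat.testBit_eq_false_of_lt (ha.trans_le (Nat.pow_le_pow_right (by norm_num) (by lia)))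
  · rw [(testBit_natPair _ _ _).2]
    exact Nat.testBit_eq_false_of_lt (hb.trans_le (Nat.pow_le_pow_right (by norm_num) (by lia)))

theorem polyOp_pair : PolyOp fun _ a b => natPair a b := by
  refine PolyOp.of_cost 0 fun m s α β A _ hK hα hβ ha hb =>
    ⟨(cost_pair hα hβ).mono subset_rfl (by lia) subset_rfl, fun x => ?_⟩
  exact (natPair_lt (ha x) (hb x)).trans_le (Nat.pow_le_pow_right (by norm_num) (by lia))

theorem polyOp_proj1 : PolyOp fun _ a _ => natProj1 a := by
  refine PolyOp.of_cost 0 fun m s α β A _ hK hα hβ ha hb =>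
    ⟨(cost_proj1 hα).mono subset_rfl (by lia) subset_rfl, fun x => ?_⟩
  refine Nat.lt_pow_two_of_testBit _ fun i hi => ?_
  rw [testBit_natProj1]
  exact Nat.testBit_eq_false_of_lt ((ha x).trans_le (Nat.pow_le_pow_right (by norm_num) (by lia)))

theorem polyOp_proj2 : PolyOp fun _ a _ => natProj2 a := by
  refine PolyOp.of_cost 0 fun m s α β A _ hK hα hβ ha hb =>
    ⟨(cost_proj2 hα).mono subset_rfl (by lia) subset_rfl, fun x => ?_⟩
  refine Nat.lt_pow_two_of_testBit _ fun i hi => ?_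
  rw [testBit_natProj2]
  exact Nat.testBit_eq_false_of_lt ((ha x).trans_le (Nat.pow_le_pow_right (by norm_num) (by lia)))

theorem polyOp_size : PolyOp fun _ a _ => Nat.size a := by
  refine PolyOp.of_cost 4 fun m s α β A _ hK hα hβ ha hb =>
    ⟨(cost_size hK hα _ ha).mono subset_rfl (by nlinarith) subset_rfl, fun x => ?_⟩
  calc Nat.size (α x) ≤ s := Nat.size_le.2 (ha x)
    _ < 2 ^ s := Nat.lt_two_pow_self
    _ ≤ _ := Nat.pow_le_pow_right (by norm_num) (by lia)

theorem polyOp_leInd : PolyOp fun _ a b => leInd a b := by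
  refine PolyOp.of_cost 7 fun m s α β A _ hK hα hβ ha hb =>
    ⟨(cost_leInd hK hα hβ _ ha hb).mono subset_rfl (by nlinarith) subset_rfl, fun x => ?_⟩
  calc leInd (α x) (β x) < 2 ^ 1 := by unfold leInd; split_ifs <;> norm_num
    _ ≤ _ := Nat.pow_le_pow_right (by norm_num) (by lia)

/-- The one operation here that uses the parameter: 2^m ≤ s bounds the number of output bits. -/
theorem polyOp_ones : PolyOp fun m a _ => ones m a := by
  refine PolyOp.of_cost 7 fun m s α β A hm hK hα hβ ha hb =>
    ⟨(cost_ones hK hα s m hm ha).mono subset_rfl (by nlinarith) subset_rfl, fun x => ?_⟩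
  refine (Nat.sub_lt (by positivity) one_pos).trans_le
      (Nat.pow_le_pow_right (by norm_num) ((min_le_right _ _).trans (by lia)))

theorem circF_const {b s : ℕ} (hb : b < 2 ^ s) : CircF (s + 2) fun _ => b := by
  have : Cost constFuns 0 (bitFuns fun _ => b) := Cost.of_subset (by
    rintro _ ⟨j, rfl⟩
    exact const_mem subset_rfl _)
  exact (CircF.of_cost this fun _ => hb).mono (by lia)

/-- A circuit that copies `n` input bits. -/
def copyCircuit (n : ℕ) : Circuit := ⟨(List.range n).map .input, List.range n⟩

theorem runGates_map_input (l : List ℕ) (x : ℕ) (vals : List Bool) :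
    runGates (l.map .input) x vals = vals ++ l.map fun i => x.testBit i := by
  induction l generalizing vals with
  | nil => simp [runGates]
  | cons i l ih => simp [runGates_cons, ih, Gate.eval]

theorem copyCircuit_eval {n x : ℕ} (hx : x < 2 ^ n) : (copyCircuit n).eval x = x := by
  refine Nat.eq_of_testBit_eq fun i => ?_
  rw [Circuit.testBit_eval, copyCircuit, runGates_map_input]
  rcases lt_or_ge i n with hi | hi
  · simp [List.getD_eq_getElem?_getD, hi]
  · rw [List.getD_eq_default _ _ (by simpa using hi)]
    exact (Nat.testBit_eq_false_of_lt
      (hx.trans_le (Nat.pow_le_pow_right (by norm_num) hi))).symm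

end CircuitFunctions

/-! ### Graphs of functions on the cube -/

section Graphs

/-- `b` codes the graph of a function on the numbers of bit-length at most `n`. -/
def GraphOn (n b : ℕ) : Prop :=
  (∀ ω, Nat.size ω ≤ n → ∃ v, b.testBit (natPair ω v) = true) ∧
  (∀ ω v v', Nat.size ω ≤ n → b.testBit (natPair ω v) = true → b.testBit (natPair ω v') = true →
    v = v') ∧
  ∀ x, b.testBit x = true → ∃ ω v, Nat.size ω ≤ n ∧ x = natPair ω v

/-- The code of the graph of `f` on the numbers of bit-length at most `n`. -/
def graphCode (n : ℕ) (f : ℕ → ℕ) : ℕ :=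
  setCode ((Finset.range (2 ^ n)).image fun ω => natPair ω (f ω))

theorem testBit_graphCode {n : ℕ} {f : ℕ → ℕ} {x : ℕ} :
    (graphCode n f).testBit x = true ↔ ∃ ω, Nat.size ω ≤ n ∧ x = natPair ω (f ω) := by
  simp only [graphCode, testBit_setCode, Nat.size_le, Finset.mem_image, Finset.mem_range,
    eq_comm (a := x)]

theorem testBit_graphCode_pair {n : ℕ} {f : ℕ → ℕ} {ω v : ℕ} :
    (graphCode n f).testBit (natPair ω v) = true ↔ Nat.size ω ≤ n ∧ v = f ω := by
  rw [testBit_graphCode]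
  constructor
  · rintro ⟨ω', h, h'⟩
    obtain ⟨rfl, rfl⟩ := natPair_inj h'
    exact ⟨h, rfl⟩
  · rintro ⟨h, rfl⟩
    exact ⟨ω, h, rfl⟩

theorem graphOn_graphCode (n : ℕ) (f : ℕ → ℕ) : GraphOn n (graphCode n f) := by
  refine ⟨fun ω h => ⟨f ω, testBit_graphCode_pair.2 ⟨h, rfl⟩⟩, fun ω v v' _ h h' => ?_,
    fun x h => ?_⟩
  · rw [(testBit_graphCode_pair.1 h).2, (testBit_graphCode_pair.1 h').2]
  · obtain ⟨ω, h, h'⟩ := testBit_graphCode.1 h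
    exact ⟨ω, _, h, h'⟩

theorem GraphOn.eq_graphCode {n b : ℕ} {f : ℕ → ℕ} (h : GraphOn n b)
    (hf : ∀ ω v, Nat.size ω ≤ n → b.testBit (natPair ω v) = true → v = f ω) :
    b = graphCode n f := by
  rw [graphCode, eq_setCode_iff]
  intro x
  rw [← testBit_setCode, ← graphCode, testBit_graphCode]
  constructor
  · intro hx
    obtain ⟨ω, v, h1, rfl⟩ := h.2.2 x hx
    exact ⟨ω, h1, by rw [hf ω v h1 hx]⟩
  · rintro ⟨ω, h1, rfl⟩
    obtain ⟨v, hv⟩ := h.1 ω h1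
    rwa [← hf ω v h1 hv]

theorem subexpComputable_iff_circF (k n b : ℕ) : SubexpComputable k n b ↔
    ∃ r f, r ^ k ≤ n ∧ CircF (2 ^ r) f ∧ b = graphCode n f := by
  constructor
  · rintro ⟨C, r, h1, h2, h3⟩
    exact ⟨r, C.eval, h1, ⟨C, h2, fun _ => rfl⟩, h3⟩
  · rintro ⟨r, f, h1, ⟨C, h2, h3⟩, h4⟩
    refine ⟨C, r, h1, h2, ?_⟩
    obtain rfl : C.eval = f := funext h3
    exact h4

theorem SubexpComputable.graphOn {k n b : ℕ} (h : SubexpComputable k n b) : GraphOn n b := by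
  obtain ⟨r, f, -, -, rfl⟩ := (subexpComputable_iff_circF _ _ _).1 h
  exact graphOn_graphCode n f

theorem SubexpComputable.anti {k n b : ℕ} (h : SubexpComputable (k + 2) n b) :
    SubexpComputable (k + 1) n b := by
  obtain ⟨C, r, h1, h2⟩ := h
  refine ⟨C, r, le_trans ?_ h1, h2⟩
  rcases Nat.eq_zero_or_pos r with rfl | hr
  · simp
  · exact Nat.pow_le_pow_right hr (by lia)

/-- The integer part of the `k`-th root. -/
theorem exists_root (k n : ℕ) (hk : 1 ≤ k) :
    ∃ R, R ^ k ≤ n ∧ n < (R + 1) ^ k ∧ ∀ r, r ^ k ≤ n → r ≤ R := by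
  have hb (r : ℕ) (h : r ^ k ≤ n) : r ≤ n := (Nat.le_self_pow (by lia) r).trans h
  refine ⟨Nat.findGreatest (fun r => r ^ k ≤ n) n, ?_, ?_, fun r hr => ?_⟩
  · exact Nat.findGreatest_spec (P := fun r => r ^ k ≤ n) (Nat.zero_le n)
      (by rw [zero_pow (by lia)]; exact Nat.zero_le n)
  · by_contra h
    have := Nat.le_findGreatest (P := fun r => r ^ k ≤ n) (hb _ (not_lt.1 h)) (not_lt.1 h)
    lia
  · exact Nat.le_findGreatest (hb r hr) hr

theorem le_root {k n N R : ℕ} (hn : N ^ k ≤ n) (hR : n < (R + 1) ^ k) : N ≤ R :=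
  Nat.lt_succ_iff.1 (lt_of_pow_lt_pow_left₀ k (by lia) (hn.trans_lt hR))

/-- With R = ⌊n^(1/(2k))⌋, the exponent R^2 is still admissible for k, and (R + c)c ≤ R^2 once R ≥
2c. So a polynomial in 2^R is absorbed by passing from 2k to k. -/
theorem exists_growth (c k : ℕ) (hk : 1 ≤ k) : ∃ N, ∀ n ≥ N, ∃ R, (∀ r, r ^ (2 * k) ≤ n → r ≤ R) ∧
    ∃ r', r' ^ k ≤ n ∧ (2 ^ R + c) ^ c ≤ 2 ^ r' := by
  refine ⟨(2 * c) ^ (2 * k), fun n hn => ?_⟩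
  obtain ⟨R, h1, h2, h3⟩ := exists_root (2 * k) n (by lia)
  have hR : 2 * c ≤ R := le_root hn h2
  refine ⟨R, h3, R ^ 2, by rwa [← pow_mul], ?_⟩
  have h4 : 2 ^ R + c ≤ 2 ^ (R + c) := by
    rw [pow_add]
    have h5 := Nat.one_le_two_pow (n := R)
    have h6 : c + 1 ≤ 2 ^ c := Nat.lt_two_pow_self
    nlinarith
  calc (2 ^ R + c) ^ c ≤ (2 ^ (R + c)) ^ c := Nat.pow_le_pow_left h4 c
    _ = 2 ^ ((R + c) * c) := (pow_mul _ _ _).symm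
    _ ≤ 2 ^ (R ^ 2) := Nat.pow_le_pow_right (by norm_num) (by nlinarith)

theorem PolyOp.subexpComputable {op : ℕ → ℕ → ℕ → ℕ} (hop : PolyOp op) (k : ℕ) (hk : 1 ≤ k) :
    ∃ N, ∀ n ≥ N, ∀ m b₁ b₂ b₃, m ^ (2 * k) ≤ n → SubexpComputable (2 * k) n b₁ →
      SubexpComputable (2 * k) n b₂ → GraphOn n b₃ →
      (∀ ω v₁ v₂ v₃, Nat.size ω ≤ n → b₁.testBit (natPair ω v₁) = true →
        b₂.testBit (natPair ω v₂) = true → b₃.testBit (natPair ω v₃) = true → v₃ = op m v₁ v₂) →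
      SubexpComputable k n b₃ := by
  obtain ⟨c, hc, hop⟩ := hop
  obtain ⟨N, hN⟩ := exists_growth c k hk
  refine ⟨N, fun n hn m b₁ b₂ b₃ hm h₁ h₂ h₃ h => ?_⟩
  obtain ⟨R, hR, r', hr', hle⟩ := hN n hn
  obtain ⟨r₁, f₁, hr₁, hf₁, rfl⟩ := (subexpComputable_iff_circF _ _ _).1 h₁
  obtain ⟨r₂, f₂, hr₂, hf₂, rfl⟩ := (subexpComputable_iff_circF _ _ _).1 h₂
  refine (subexpComputable_iff_circF _ _ _).2 ⟨r', _, hr', (hop m (2 ^ R) f₁ f₂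
    (Nat.pow_le_pow_right (by norm_num) (hR m hm))
    (hf₁.mono (Nat.pow_le_pow_right (by norm_num) (hR r₁ hr₁)))
    (hf₂.mono (Nat.pow_le_pow_right (by norm_num) (hR r₂ hr₂)))).mono hle, ?_⟩
  refine h₃.eq_graphCode fun ω v hω hv => h ω _ _ v hω ?_ ?_ hv
  · exact testBit_graphCode_pair.2 ⟨hω, rfl⟩
  · exact testBit_graphCode_pair.2 ⟨hω, rfl⟩

/-- The size bound eventually exceeds every linear function of n that is needed: n + 2 for constants
and 2n for the identity. -/
theorem exists_le_two_pow_root (k : ℕ) (hk : 1 ≤ k) :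
    ∃ N, ∀ n ≥ N, ∃ r, r ^ k ≤ n ∧ 2 * n + 2 ≤ 2 ^ r := by
  obtain ⟨R₀, hR₀⟩ : ∃ R₀, ∀ R ≥ R₀, 4 * (R + 1) ^ k ≤ 2 ^ R := by
    have h := tendsto_pow_const_div_const_pow_of_one_lt k (show (1 : ℝ) < 2 by norm_num)
    -- The bound 1/8 gives 8(R + 1)^k ≤ 2^(R + 1), that is, 4(R + 1)^k ≤ 2^R.
    have h' := (h.comp (Filter.tendsto_add_atTop_nat 1)).eventually
      (ge_mem_nhds (show (0 : ℝ) < 1 / 8 by norm_num))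
    obtain ⟨R₀, hR₀⟩ := Filter.eventually_atTop.1 h'
    refine ⟨R₀, fun R hR => ?_⟩
    have h2 := hR₀ R hR
    simp only [Function.comp_apply] at h2
    rw [div_le_iff₀ (by positivity), pow_succ] at h2
    have : (4 * (R + 1) ^ k : ℝ) ≤ 2 ^ R := by push_cast at h2; linarith
    exact_mod_cast this
  refine ⟨R₀ ^ k, fun n hn => ?_⟩
  obtain ⟨R, h1, h2, -⟩ := exists_root k n hk
  refine ⟨R, h1, le_trans ?_ (hR₀ R (le_root hn h2))⟩
  have : 1 ≤ (R + 1) ^ k := Nat.one_le_pow _ _ (by lia)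
  lia

theorem subexpComputable_const (k : ℕ) (hk : 1 ≤ k) : ∃ N, ∀ n ≥ N, ∀ w b, Nat.size w ≤ n →
    GraphOn n b → (∀ ω v, Nat.size ω ≤ n → b.testBit (natPair ω v) = true → v = w) →
    SubexpComputable k n b := by
  obtain ⟨N, hN⟩ := exists_le_two_pow_root k hk
  refine ⟨N, fun n hn w b hw hb h => ?_⟩
  obtain ⟨r, hr, hle⟩ := hN n hn
  exact (subexpComputable_iff_circF _ _ _).2 ⟨r, _, hr,
    (circF_const (Nat.size_le.1 hw)).mono (by lia), hb.eq_graphCode h⟩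

theorem subexpComputable_id (k : ℕ) (hk : 1 ≤ k) : ∃ N, ∀ n ≥ N, ∀ b, GraphOn n b →
    (∀ ω v, Nat.size ω ≤ n → b.testBit (natPair ω v) = true → v = ω) →
    SubexpComputable k n b := by
  obtain ⟨N, hN⟩ := exists_le_two_pow_root k hk
  refine ⟨N, fun n hn b hb h => ?_⟩
  obtain ⟨r, hr, hle⟩ := hN n hn
  refine ⟨copyCircuit n, r, hr, ?_, ?_⟩
  · simp [copyCircuit, Circuit.size]
    lia
  · exact hb.eq_graphCode fun ω v hω hv =>
      (h ω v hω hv).trans (copyCircuit_eval (Nat.size_le.1 hω)).symm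

/-- Some short `w` is larger than the bit-lengths of all values of subexponentially computable
functions. -/
theorem exists_large_const (K : ℕ) (hK : 1 ≤ K) : ∃ N, ∀ n ≥ N, ∃ w, Nat.size w ≤ n ∧
    2 * Nat.size w ^ K ≤ n ∧ ∀ b, SubexpComputable (2 * K) n b → ∀ ω v, Nat.size ω ≤ n →
      b.testBit (natPair ω v) = true → Nat.size v ≠ w := by
  -- This makes R at least 4, so that 2(R + 2) ≤ R^2.
  refine ⟨4 ^ (2 * K), fun n hn => ?_⟩
  obtain ⟨R, h1, h2, h3⟩ := exists_root (2 * K) n (by lia)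
  have hR : 4 ≤ R := le_root hn h2
  have hs : Nat.size (2 ^ (R + 1)) = R + 2 := Nat.size_pow
  have h4 : 2 * (R + 2) ^ K ≤ n := by
    calc 2 * (R + 2) ^ K ≤ 2 ^ K * (R + 2) ^ K :=
          Nat.mul_le_mul_right _ (Nat.le_self_pow (by lia) 2)
      _ = (2 * (R + 2)) ^ K := (mul_pow _ _ _).symm
      _ ≤ (R ^ 2) ^ K := Nat.pow_le_pow_left (by nlinarith) K
      _ = R ^ (2 * K) := (pow_mul _ _ _).symm
      _ ≤ n := h1
  -- Values have at most 2^R bits, so this power of 2 is not a length; its own length is only R + 2.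
  refine ⟨2 ^ (R + 1), ?_, by rwa [hs], fun b hb ω v hω hv => ?_⟩
  · rw [hs]
    exact (Nat.le_self_pow (by lia) _).trans ((Nat.le_mul_of_pos_left _ two_pos).trans h4)
  · obtain ⟨r, f, hr, hf, rfl⟩ := (subexpComputable_iff_circF _ _ _).1 hb
    obtain ⟨-, rfl⟩ := testBit_graphCode_pair.1 hv
    have h5 : Nat.size (f ω) ≤ 2 ^ r := Nat.size_le.2 (hf.lt ω)
    have h6 : 2 ^ r < 2 ^ (R + 1) := Nat.pow_lt_pow_right (by norm_num) (by have := h3 r hr; lia)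
    lia

/-- Few numbers below `2 ^ n` have bit-length less than `n / 2`. -/
theorem card_short_le (j : ℕ) : ∃ N, ∀ n ≥ N, ∀ u w : ℕ,
    (∀ ω, u.testBit ω = true → 2 * Nat.size ω < n) →
    (∀ ω, w.testBit ω = true ↔ Nat.size ω ≤ n) → j * (bits u).card ≤ (bits w).card := by
  -- Then n - n / 2 ≥ j, so the ratio of cardinalities, at least 2^(n - n / 2), exceeds j.
  refine ⟨2 * j, fun n hn u w hu hw => ?_⟩
  have h1 : bits w = Finset.range (2 ^ n) := by
    ext ω
    rw [mem_bits, hw, Finset.mem_range, Nat.size_le]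
  have h2 : bits u ⊆ Finset.range (2 ^ (n / 2)) := by
    intro ω hω
    rw [mem_bits] at hω
    rw [Finset.mem_range, ← Nat.size_le]
    have := hu ω hω
    lia
  have h3 := Finset.card_le_card h2
  rw [h1, Finset.card_range]
  rw [Finset.card_range] at h3
  calc j * (bits u).card ≤ 2 ^ (n - n / 2) * 2 ^ (n / 2) :=
        Nat.mul_le_mul (Nat.lt_two_pow_self.le.trans
          (Nat.pow_le_pow_right (by norm_num) (by lia))) h3
    _ = 2 ^ n := by rw [← pow_add]; congr 1; lia

end Graphs

/-! ### Transfer to a model of true arithmetic -/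

section Transfer

variable {M : Type*} [LA.Structure M] {n : ℕ}

theorem Corr.mem {f₀ f₁ : (Fin n → ℕ) → ℕ} {g₀ g₁ : (Fin n → M) → M} (h₀ : CorrF f₀ g₀)
    (h₁ : CorrF f₁ g₁) : Corr (fun v => (f₁ v).testBit (f₀ v) = true)
      (fun v => MMem (g₀ v) (g₁ v)) := by
  refine Corr.rel₂ (P := fun x u => u.testBit x = true) (Q := MMem)
    (arith_testBit.corr.congr (fun _ => Iff.rfl) fun v => ?_) h₀ h₁
  rw [MMem]
  exact iff_of_eq (congrArg _ (by ext i; fin_cases i <;> rfl))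

/-- In `M`: `b` is computed by a circuit of size at most `2 ^ (n ^ (1 / k))`. -/
abbrev SubM (k : ℕ) (a b : M) : Prop :=
  interp (fun v => SubexpComputable (v 0) (v 1) (v 2)) ![num M k, a, b]

theorem Corr.subexp' {f f₀ f₁ : (Fin n → ℕ) → ℕ} {g g₀ g₁ : (Fin n → M) → M} (h : CorrF f g)
    (h₀ : CorrF f₀ g₀) (h₁ : CorrF f₁ g₁) : Corr (fun v => SubexpComputable (f v) (f₀ v) (f₁ v))
      (fun v => interp (fun v => SubexpComputable (v 0) (v 1) (v 2)) ![g v, g₀ v, g₁ v]) := by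
  refine Corr.rel₃ (P := fun k a b => SubexpComputable k a b)
    (Q := fun k a b => interp (fun v => SubexpComputable (v 0) (v 1) (v 2)) ![k, a, b])
    (arith_subexpComputable.corr.congr (fun _ => Iff.rfl) fun v => ?_) h h₀ h₁
  exact iff_of_eq (congrArg _ (by ext i; fin_cases i <;> rfl))

theorem Corr.subexp (k : ℕ) {f₀ f₁ : (Fin n → ℕ) → ℕ} {g₀ g₁ : (Fin n → M) → M}
    (h₀ : CorrF f₀ g₀) (h₁ : CorrF f₁ g₁) : Corr (fun v => SubexpComputable k (f₀ v) (f₁ v))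
      (fun v => SubM k (g₀ v) (g₁ v)) :=
  Corr.subexp' (CorrF.const k) h₀ h₁

/-- In `M`: `j |u| ≤ k |w|`. -/
def FracM (j k : ℕ) (u w : M) : Prop :=
  interp (fun v => j * (bits (v 0)).card ≤ k * (bits (v 1)).card) ![u, w]

theorem Corr.frac (j k : ℕ) {f₀ f₁ : (Fin n → ℕ) → ℕ} {g₀ g₁ : (Fin n → M) → M}
    (h₀ : CorrF f₀ g₀) (h₁ : CorrF f₁ g₁) :
    Corr (fun v => j * (bits (f₀ v)).card ≤ k * (bits (f₁ v)).card)
      (fun v => FracM j k (g₀ v) (g₁ v)) := by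
  have h : Arith fun v : Fin 2 → ℕ => j * (bits (v 0)).card ≤ k * (bits (v 1)).card :=
    Corr.le (M := ℕ) (CorrF.mul (ArithF.const j) (ArithF.card_bits (CorrF.var 0)))
      (CorrF.mul (ArithF.const k) (ArithF.card_bits (CorrF.var 1)))
  refine Corr.rel₂ (P := fun u w => j * (bits u).card ≤ k * (bits w).card) (Q := FracM j k)
    (h.corr.congr (fun _ => Iff.rfl) fun v => ?_) h₀ h₁
  exact iff_of_eq (congrArg _ (by ext i; fin_cases i <;> rfl))

theorem interp_card_iff (hM : M ≅[LA] ℕ) (k : ℕ) (u w : M) :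
    interp (fun v => ∃ s t : Finset ℕ, v 0 = setCode s ∧ v 1 = setCode t ∧ k * s.card ≤ t.card)
      ![u, w] ↔ FracM k 1 u w := by
  refine (((arith_card k).corr (M := M)).iff (Corr.frac k 1 (CorrF.var 0) (CorrF.var 1))).transfer
    hM (fun v => ?_) ![u, w]
  rw [exists_setCode_iff, one_mul]

/-- The power `a ^ (k + 1)` in `M`. -/
def powM (a : M) : ℕ → M
  | 0 => a
  | k + 1 => mulM (powM a k) a

theorem CorrF.pow (k : ℕ) {f : (Fin n → ℕ) → ℕ} {g : (Fin n → M) → M} (h : CorrF f g) :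
    CorrF (fun v => f v ^ (k + 1)) (fun v => powM (g v) k) := by
  induction k with
  | zero => simpa only [zero_add, pow_one, powM] using h
  | succ k ih =>
    simp only [pow_succ _ (k + 1)]
    exact ih.mul h

/-- The function on `M` with the definition of an arithmetical function. -/
def interpF (f : (Fin n → ℕ) → ℕ) (v : Fin n → M) : M :=
  Classical.epsilon (h := ⟨num M 0⟩) fun y =>
    interp (fun w : Fin (n + 1) → ℕ => w 0 = f fun i => w i.succ) (Fin.cons y v)

/-- Existence and uniqueness of the value transfer from ℕ, so the choice in `interpF` picks the only
point on the graph. -/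
theorem ArithF.corrF (hM : M ≅[LA] ℕ) {f : (Fin n → ℕ) → ℕ} (hf : ArithF f) :
    CorrF f (interpF (M := M) f) := by
  have hc := Arith.corr (M := M) (R := fun w : Fin (n + 1) → ℕ => w 0 = f fun i => w i.succ)
    hf.graph
  set S := interp (M := M) (fun w : Fin (n + 1) → ℕ => w 0 = f fun i => w i.succ) with hS
  have hc' : Corr (fun w : Fin (n + 1) → ℕ => w 0 = f fun i => w i.succ)
      (fun w : Fin (n + 1) → M => S (Fin.cons (w 0) fun i => w i.succ)) :=
    hc.congr (fun _ => Iff.rfl) fun w => iff_of_eq (congrArg S (Fin.cons_self_tail w).symm)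
  have hex (v : Fin n → M) : ∃ y, S (Fin.cons y v) :=
    (Corr.ex (R := fun y v => y = f v) (S := fun y v => S (Fin.cons y v)) hc').transfer hM
      (fun v => ⟨_, rfl⟩) v
  have hun (v : Fin n → M) (y z : M) : S (Fin.cons y v) → S (Fin.cons z v) → y = z := by
    have h1 := hc'.comp (n := n + 2)
      (f := fun i v => v ((Fin.cases 0 (fun i => i.succ.succ) : Fin (n + 1) → Fin (n + 2)) i))
      (g := fun i v => v ((Fin.cases 0 (fun i => i.succ.succ) : Fin (n + 1) → Fin (n + 2)) i))
      fun _ => CorrF.var _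
    have h2 := hc'.comp (n := n + 2) (f := fun i v => v i.succ) (g := fun i v => v i.succ)
      fun _ => CorrF.var _
    have h3 : Corr (fun v : Fin (n + 2) → ℕ => v 0 = v 1) (fun v : Fin (n + 2) → M => v 0 = v 1) :=
      Corr.eq (CorrF.var _) (CorrF.var _)
    exact (h1.imp (h2.imp h3)).transfer hM (fun v h h' => h.trans h'.symm)
      (Fin.cons y (Fin.cons z v))
  refine ⟨hc'.congr (fun _ => Iff.rfl) fun w => ?_⟩
  have hspec := Classical.epsilon_spec_aux ⟨num M 0⟩ (fun y => S (Fin.cons y fun i => w i.succ))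
    (hex _)
  constructor
  · intro h
    exact hun _ _ _ h hspec
  · intro h
    rw [h]
    exact hspec

theorem arithF_leInd : ArithF fun v : Fin 3 → ℕ => leInd (v 1) (v 2) :=
  ArithF.primrec₂ (g := leInd) (Primrec.ite (c := fun p : ℕ × ℕ => p.1 ≤ p.2) Primrec.nat_le
    (Primrec.const 1) (Primrec.const 0)) (CorrF.var 1) (CorrF.var 2)

theorem arithF_ones : ArithF fun v : Fin 3 → ℕ => ones (v 0) (v 1) := by
  refine ArithF.primrec₂ (Primrec.nat_sub.comp₂ (primrec₂_pow.comp₂ (Primrec₂.const 2)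
    (Primrec.nat_min.comp₂ Primrec₂.right (primrec₂_pow.comp₂ (Primrec₂.const 2) Primrec₂.left)))
    (Primrec₂.const 1)) (CorrF.var 0) (CorrF.var 1)

/-- In `M`: `b` is the graph of a function on the numbers of bit-length at most `a`. -/
def GraphOnM (a b : M) : Prop :=
  (∀ ω, leM (lenM ω) a → ∃ v, MMem (pairM ω v) b) ∧
  (∀ ω v v', leM (lenM ω) a → MMem (pairM ω v) b → MMem (pairM ω v') b → v = v') ∧
  ∀ x, MMem x b → ∃ ω v, leM (lenM ω) a ∧ x = pairM ω v

theorem Corr.graphOn {f₀ f₁ : (Fin n → ℕ) → ℕ} {g₀ g₁ : (Fin n → M) → M} (h₀ : CorrF f₀ g₀)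
    (h₁ : CorrF f₁ g₁) : Corr (fun v => GraphOn (f₀ v) (f₁ v))
      (fun v => GraphOnM (g₀ v) (g₁ v)) := by
  refine Corr.rel₂ (P := GraphOn) (Q := GraphOnM) ?_ h₀ h₁
  unfold GraphOn GraphOnM
  apply_rules (maxDepth := 500) [Corr.and, Corr.imp, Corr.all, Corr.ex, Corr.le, Corr.eq,
    Corr.mem, CorrF.var, CorrF.natPair, CorrF.size]

/-! The elementary theory of `M`. -/

theorem mem_ext (hM : M ≅[LA] ℕ) {u w : M} (h : ∀ x, MMem x u ↔ MMem x w) : u = w := by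
  refine Corr.transfer (R := fun v : Fin 2 → ℕ => (∀ x, (v 0).testBit x = true ↔
    (v 1).testBit x = true) → v 0 = v 1) (S := fun v => (∀ x, MMem x (v 0) ↔ MMem x (v 1)) →
    v 0 = v 1) ?_ hM (fun v h => ?_) ![u, w] h
  · apply_rules [Corr.imp, Corr.iff, Corr.all, Corr.eq, Corr.mem, CorrF.var]
  · exact Nat.eq_of_testBit_eq fun i => Bool.eq_iff_iff.2 (h i)

end Transfer

/-! ### Definable sets, comprehension and saturation -/

section Definable

variable {M : Type*} [LA.Structure M]

theorem Corr.definable₁ {n : ℕ} {R : (Fin (n + 1) → ℕ) → Prop} {S : (Fin (n + 1) → M) → Prop}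
    (h : Corr R S) (c : Fin n → M) : (univ : Set M).Definable₁ LA {x | S (Fin.cons x c)} := by
  obtain ⟨φ, -, hφ⟩ := h
  unfold Definable₁
  rw [definable_iff_exists_formula_sum]
  refine ⟨φ.relabel (Fin.cons (Sum.inr 0) fun i => Sum.inl ⟨c i, mem_univ _⟩), ?_⟩
  ext q
  simp only [mem_ofPred_eq, Formula.realize_relabel, ← hφ]
  refine iff_of_eq (congrArg _ ?_)
  funext i
  refine Fin.cases ?_ (fun i => ?_) i <;> simp

/-- A set that is definable with parameters is defined by a formula with a finite list of
parameters. -/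
theorem exists_formula_of_definable₁ {D : Set M} (hD : (univ : Set M).Definable₁ LA D) :
    ∃ (m : ℕ) (φ : LA.Formula (Fin (m + 1))) (c : Fin m → M),
      ∀ x, x ∈ D ↔ φ.Realize (Fin.cons x c : Fin (m + 1) → M) := by
  unfold Definable₁ at hD
  obtain ⟨A, -, hA⟩ := definable_iff_finitely_definable.1 hD
  obtain ⟨φ, hφ⟩ := definable_iff_exists_formula_sum.1 hA
  let e := Fintype.equivFin (A : Set M)
  refine ⟨_, φ.relabel (Sum.elim (fun a => (e a).succ) fun _ => 0), fun i => e.symm i,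
    fun x => ?_⟩
  have := Set.ext_iff.1 hφ (fun _ => x)
  simp only [mem_ofPred_eq] at this
  rw [this, Formula.realize_relabel]
  refine iff_of_eq (congrArg _ ?_)
  funext i
  rcases i with i | i <;> simp

/-- Comprehension in a model of true arithmetic. -/
theorem exists_mem_iff (hM : M ≅[LA] ℕ) {D : Set M} (hD : (univ : Set M).Definable₁ LA D)
    (a : M) : ∃ u, ∀ x, MMem x u ↔ leM (lenM x) a ∧ x ∈ D := by
  obtain ⟨m, φ, c, hφ⟩ := exists_formula_of_definable₁ hD
  simp only [hφ]
  let e : Fin (m + 1) → Fin (m + 3) := Fin.cons 0 fun i => i.succ.succ.succ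
  have h1 : Corr (fun w : Fin (m + 3) → ℕ => φ.Realize (Fin.cons (w 0) fun i => w i.succ.succ.succ))
      (fun w : Fin (m + 3) → M => φ.Realize (Fin.cons (w 0) fun i => w i.succ.succ.succ)) := by
    refine (Corr.formula φ e).congr (fun w => ?_) (fun w => ?_) <;>
    · refine iff_of_eq (congrArg _ ?_)
      funext i
      refine Fin.cases ?_ (fun i => ?_) i <;> rfl
  refine Corr.transfer (R := fun v : Fin (m + 1) → ℕ => ∃ u : ℕ, ∀ x : ℕ, u.testBit x = true ↔
      x.size ≤ v 0 ∧ φ.Realize (Fin.cons x fun i => v i.succ))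
    (S := fun v => ∃ u, ∀ x, MMem x u ↔
      leM (lenM x) (v 0) ∧ φ.Realize (Fin.cons x fun i => v i.succ)) ?_ hM (fun v => ?_) (Fin.cons a c)
  · refine Corr.ex (Corr.all (Corr.iff (Corr.mem (CorrF.var _) (CorrF.var _))
      (Corr.and (Corr.le (CorrF.size (CorrF.var _)) (CorrF.var _)) h1)))
  · classical
    refine ⟨setCode ((Finset.range (2 ^ v 0)).filter fun x =>
      φ.Realize (Fin.cons x fun i => v i.succ : Fin (m + 1) → ℕ)), fun x => ?_⟩
    rw [testBit_setCode]
    simp [Nat.size_le]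

/-- Saturation for definable sets with arbitrary parameters: each set needs only finitely many, so
countably many occur altogether. -/
theorem Aleph1Saturated.exists_mem (hs : Aleph1Saturated M) {D : ℕ → Set M}
    (hD : ∀ k, (univ : Set M).Definable₁ LA (D k)) (h : ∀ N, ∃ x, ∀ k ≤ N, x ∈ D k) :
    ∃ x, ∀ k, x ∈ D k := by
  choose m φ c hφ using fun k => exists_formula_of_definable₁ (hD k)
  let A : Set M := ⋃ k, range (c k)
  have hc (k : ℕ) (i : Fin (m k)) : c k i ∈ A := mem_iUnion.2 ⟨k, i, rfl⟩
  let ψ (k : ℕ) : LA.Formula (A ⊕ Unit) :=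
    (φ k).relabel (Fin.cons (Sum.inr ()) fun i => Sum.inl ⟨c k i, hc k i⟩)
  have hψ (k : ℕ) (x : M) :
      (ψ k).Realize (Sum.elim (fun a : A => (a : M)) (fun _ => x)) ↔ x ∈ D k := by
    rw [hφ, Formula.realize_relabel]
    refine iff_of_eq (congrArg _ ?_)
    funext i
    refine Fin.cases ?_ (fun i => ?_) i <;> simp
  obtain ⟨x, hx⟩ := hs A (countable_iUnion fun k => (finite_range _).countable) (range ψ)
    fun Φ hΦ => by
      classical
      rw [← image_univ, Finset.subset_set_image_iff] at hΦ
      obtain ⟨T, -, rfl⟩ := hΦ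
      obtain ⟨x, hx⟩ := h (T.sup id)
      refine ⟨x, fun φ hφ => ?_⟩
      obtain ⟨k, hk, rfl⟩ := Finset.mem_image.1 hφ
      exact (hψ k x).2 (hx k (Finset.le_sup (f := id) hk))
  exact ⟨x, fun k => (hψ k x).1 (hx _ ⟨k, rfl⟩)⟩

end Definable

/-! ### The elementary theory of finite sets -/

section FiniteSets

variable {M : Type*} [LA.Structure M]

theorem FracM.mono (hM : M ≅[LA] ℕ) {j k : ℕ} {u v w : M} (h : ∀ x, MMem x u → MMem x v)
    (hv : FracM j k v w) : FracM j k u w := by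
  refine Corr.transfer (R := fun v : Fin 3 → ℕ =>
      (∀ x, (v 0).testBit x = true → (v 1).testBit x = true) →
        j * (bits (v 1)).card ≤ k * (bits (v 2)).card → j * (bits (v 0)).card ≤ k * (bits (v 2)).card)
    (S := fun v => (∀ x, MMem x (v 0) → MMem x (v 1)) → FracM j k (v 1) (v 2) →
      FracM j k (v 0) (v 2)) ?_ hM (fun v h h' => ?_) ![u, v, w] h hv
  · apply_rules [Corr.imp, Corr.all, Corr.mem, Corr.frac, CorrF.var]
  · refine le_trans (Nat.mul_le_mul_left _ (Finset.card_le_card fun x => ?_)) h'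
    simpa only [mem_bits] using h x

theorem FracM.union (hM : M ≅[LA] ℕ) {k : ℕ} {u a b w : M} (h : ∀ x, MMem x u → MMem x a ∨ MMem x b)
    (ha : FracM (2 * k) 1 a w) (hb : FracM (2 * k) 1 b w) : FracM k 1 u w := by
  refine Corr.transfer (R := fun v : Fin 4 → ℕ =>
      (∀ x, (v 0).testBit x = true → (v 1).testBit x = true ∨ (v 2).testBit x = true) →
        2 * k * (bits (v 1)).card ≤ 1 * (bits (v 3)).card →
        2 * k * (bits (v 2)).card ≤ 1 * (bits (v 3)).card →
        k * (bits (v 0)).card ≤ 1 * (bits (v 3)).card)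
    (S := fun v => (∀ x, MMem x (v 0) → MMem x (v 1) ∨ MMem x (v 2)) → FracM (2 * k) 1 (v 1) (v 3) →
      FracM (2 * k) 1 (v 2) (v 3) → FracM k 1 (v 0) (v 3)) ?_ hM (fun v h h' h'' => ?_)
      ![u, a, b, w] h ha hb
  · apply_rules [Corr.imp, Corr.all, Corr.or, Corr.mem, Corr.frac, CorrF.var]
  · have : (bits (v 0)).card ≤ (bits (v 1)).card + (bits (v 2)).card := by
      refine le_trans (Finset.card_le_card fun x hx => ?_) (Finset.card_union_le _ _)
      simpa only [Finset.mem_union, mem_bits] using h x (mem_bits.1 hx)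
    nlinarith

/-- One increment of the measure: |u| ≥ (j/k)|w| and a disjoint d with |d| > |w|/k give |v| ≥
((j+1)/k)|w|. Together with `not_fracM_succ` it bounds the number of such increments. -/
theorem FracM.succ (hM : M ≅[LA] ℕ) {j k : ℕ} {u d v w : M} (hu : ∀ x, MMem x u → MMem x v)
    (hd : ∀ x, MMem x d → MMem x v) (hud : ∀ x, MMem x u → ¬ MMem x d)
    (h : FracM j k w u) (h' : ¬ FracM k 1 d w) : FracM (j + 1) k w v := by
  refine Corr.transfer (R := fun v : Fin 4 → ℕ =>
      (∀ x, (v 0).testBit x = true → (v 2).testBit x = true) →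
      (∀ x, (v 1).testBit x = true → (v 2).testBit x = true) →
      (∀ x, (v 0).testBit x = true → ¬ (v 1).testBit x = true) →
        j * (bits (v 3)).card ≤ k * (bits (v 0)).card →
        ¬ k * (bits (v 1)).card ≤ 1 * (bits (v 3)).card →
        (j + 1) * (bits (v 3)).card ≤ k * (bits (v 2)).card)
    (S := fun v => (∀ x, MMem x (v 0) → MMem x (v 2)) → (∀ x, MMem x (v 1) → MMem x (v 2)) →
      (∀ x, MMem x (v 0) → ¬ MMem x (v 1)) → FracM j k (v 3) (v 0) → ¬ FracM k 1 (v 1) (v 3) →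
      FracM (j + 1) k (v 3) (v 2)) ?_ hM (fun v h1 h2 h3 h4 h5 => ?_)
      ![u, d, v, w] hu hd hud h h'
  · apply_rules (maxDepth := 500) [Corr.not, Corr.imp, Corr.all, Corr.mem, Corr.frac, CorrF.var]
  · have : (bits (v 0)).card + (bits (v 1)).card ≤ (bits (v 2)).card := by
      rw [← Finset.card_union_of_disjoint]
      · refine Finset.card_le_card fun x hx => ?_
        simp only [Finset.mem_union, mem_bits] at hx ⊢
        exact hx.elim (h1 x) (h2 x)
      · refine Finset.disjoint_left.2 fun x hx => ?_
        simpa only [mem_bits] using h3 x (mem_bits.1 hx)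
    nlinarith

theorem FracM.zero (hM : M ≅[LA] ℕ) (k : ℕ) (u w : M) : FracM 0 k u w :=
  Corr.transfer (R := fun v : Fin 2 → ℕ => 0 * (bits (v 0)).card ≤ k * (bits (v 1)).card)
    (S := fun v => FracM 0 k (v 0) (v 1)) (Corr.frac 0 k (CorrF.var _) (CorrF.var _)) hM
    (fun v => by simp) ![u, w]

theorem not_fracM_succ (hM : M ≅[LA] ℕ) {k : ℕ} {u w x : M} (hu : ∀ x, MMem x u → MMem x w)
    (hx : MMem x w) : ¬ FracM (k + 1) k w u := by
  refine Corr.transfer (R := fun v : Fin 3 → ℕ =>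
      (∀ x, (v 0).testBit x = true → (v 1).testBit x = true) → (v 1).testBit (v 2) = true →
        ¬ (k + 1) * (bits (v 1)).card ≤ k * (bits (v 0)).card)
    (S := fun v => (∀ x, MMem x (v 0) → MMem x (v 1)) → MMem (v 2) (v 1) →
      ¬ FracM (k + 1) k (v 1) (v 0)) ?_ hM (fun v h h' => ?_) ![u, w, x] hu hx
  · apply_rules (maxDepth := 500) [Corr.not, Corr.imp, Corr.all, Corr.mem, Corr.frac, CorrF.var]
  · have h1 : (bits (v 0)).card ≤ (bits (v 1)).card := Finset.card_le_card fun x => by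
      simpa only [mem_bits] using h x
    have h2 : 0 < (bits (v 1)).card := Finset.card_pos.2 ⟨_, mem_bits.2 h'⟩
    nlinarith

/-- Through this, facts about all sufficiently large numbers become applicable to n. -/
theorem Nonstandard.num_le (hM : M ≅[LA] ℕ) {n : M} (hn : Nonstandard n) (N : ℕ) :
    leM (num M N) n := by
  induction N with
  | zero =>
    exact Corr.transfer (R := fun v : Fin 1 → ℕ => 0 ≤ v 0) (S := fun v => leM (num M 0) (v 0))
      (Corr.le (CorrF.const 0) (CorrF.var _)) hM (fun v => Nat.zero_le _) ![n]
  | succ N ih =>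
    refine (Corr.transfer (R := fun v : Fin 1 → ℕ => N ≤ v 0 → v 0 = N ∨ N + 1 ≤ v 0)
      (S := fun v => leM (num M N) (v 0) → v 0 = num M N ∨ leM (num M (N + 1)) (v 0)) ?_ hM
      (fun v h => ?_) ![n] ih).resolve_left (hn N)
    · exact Corr.imp (Corr.le (CorrF.const _) (CorrF.var _)) (Corr.or
        (Corr.eq (CorrF.var _) (CorrF.const _)) (Corr.le (CorrF.const (N + 1)) (CorrF.var _)))
    · lia

end FiniteSets

/-! ### The algebra of truth values -/

theorem meet_spec {B : Type*} [BooleanAlgebra B] {S : Set B} (h : ∃ b, IsGLB S b) :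
    IsGLB S (meet S) := by
  rw [meet, dif_pos h]
  exact h.choose_spec

theorem join_spec {B : Type*} [BooleanAlgebra B] {S : Set B} (h : ∃ b, IsLUB S b) :
    IsLUB S (join S) := by
  rw [join, dif_pos h]
  exact h.choose_spec

theorem exists_isGLB_of_exists_isLUB {B : Type*} [BooleanAlgebra B]
    (h : ∀ S : Set B, ∃ b, IsLUB S b) (S : Set B) : ∃ b, IsGLB S b :=
  let ⟨b, hb⟩ := h (lowerBounds S)
  ⟨b, isLUB_lowerBounds.1 hb⟩

section Truth

variable {M : Type*} [LA.Structure M] {n : M}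

theorem CodesSet.unique (hM : M ≅[LA] ℕ) {u v : M} {U : Set M} (hu : CodesSet u U)
    (hv : CodesSet v U) : u = v :=
  mem_ext hM fun x => (hu x).trans (hv x).symm

theorem exists_codesSet (hM : M ≅[LA] ℕ) (U : events (cube n)) :
    ∃ u : M, CodesSet u (Subtype.val '' (U : Set (cube n))) := by
  obtain ⟨U, D, hD, rfl⟩ := U
  obtain ⟨u, hu⟩ := exists_mem_iff hM hD n
  refine ⟨u, fun x => (hu x).trans ⟨fun h => ⟨⟨x, h.1⟩, h.2, rfl⟩, ?_⟩⟩
  rintro ⟨ω, h, rfl⟩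
  exact ⟨ω.2, h⟩

open Classical in
/-- The code of an event. -/
def code (U : Set (cube n)) : M :=
  if h : ∃ u : M, CodesSet u (Subtype.val '' U) then h.choose else n

theorem code_spec (hM : M ≅[LA] ℕ) (U : events (cube n)) :
    CodesSet (code (U : Set (cube n))) (Subtype.val '' (U : Set (cube n))) := by
  have h := exists_codesSet hM U
  rw [code, dif_pos h]
  exact h.choose_spec

theorem mem_code (hM : M ≅[LA] ℕ) (U : events (cube n)) (ω : cube n) :
    MMem (ω : M) (code (U : Set (cube n))) ↔ ω ∈ (U : Set (cube n)) := by
  rw [code_spec hM U]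
  simp

theorem mem_code_imp (hM : M ≅[LA] ℕ) {U : events (cube n)} {P : M → Prop}
    (h : ∀ ω : cube n, ω ∈ (U : Set (cube n)) → P ω) (x : M)
    (hx : MMem x (code (U : Set (cube n)))) : P x := by
  obtain ⟨ω, hω, rfl⟩ := (code_spec hM U x).1 hx
  exact h ω hω

theorem definable_event {D : Set M} (hD : (univ : Set M).Definable₁ LA D) :
    (Subtype.val ⁻¹' D : Set (cube n)) ∈ events (cube n) :=
  ⟨D, hD, rfl⟩

/-- The code of the sample space. -/
abbrev topCode (n : M) : M := code (((⊤ : events (cube n)) : Set (cube n)))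

theorem exists_mem_topCode (hM : M ≅[LA] ℕ) (n : M) : ∃ x, MMem x (topCode n) := by
  have h : leM (lenM (num M 0)) n :=
    Corr.transfer (R := fun v : Fin 1 → ℕ => Nat.size 0 ≤ v 0)
      (S := fun v => leM (lenM (num M 0)) (v 0)) (Corr.le (CorrF.size (CorrF.const 0)) (CorrF.var _))
      hM (fun v => by simp) ![n]
  exact ⟨_, (mem_code hM ⊤ ⟨_, h⟩).2 trivial⟩

/-- `k |U| ≤ |Ω|` holds in `M`. -/
def IsSmall (k : ℕ) (U : events (cube n)) : Prop := FracM k 1 (code (U : Set (cube n))) (topCode n)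

theorem infinitesimal_iff (hM : M ≅[LA] ℕ) (U : events (cube n)) :
    Infinitesimal (U : Set (cube n)) ↔ ∀ k, IsSmall k U := by
  have hT : CodesSet (topCode n) (cube n) := by
    have := code_spec hM (⊤ : events (cube n))
    have h : ((⊤ : events (cube n)) : Set (cube n)) = univ := rfl
    rwa [h, image_univ, Subtype.range_coe, ← h] at this
  refine forall_congr' fun k => ?_
  simp only [interp_card_iff hM]
  constructor
  · rintro ⟨u, w, hu, hw, h⟩
    rwa [hu.unique hM (code_spec hM U), hw.unique hM hT] at h
  · exact fun h => ⟨_, _, code_spec hM U, hT, h⟩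

theorem IsSmall.mono (hM : M ≅[LA] ℕ) {k : ℕ} {U V : events (cube n)} (h : U ≤ V)
    (hV : IsSmall k V) : IsSmall k U :=
  FracM.mono hM (mem_code_imp hM fun ω hω => (mem_code hM V ω).2 (h hω)) hV

theorem IsSmall.union (hM : M ≅[LA] ℕ) {k : ℕ} {U V W : events (cube n)} (h : W ≤ U ⊔ V)
    (hU : IsSmall (2 * k) U) (hV : IsSmall (2 * k) V) : IsSmall k W :=
  FracM.union hM (mem_code_imp hM fun ω hω =>
    (h hω).imp (mem_code hM U ω).2 (mem_code hM V ω).2) hU hV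

/-- If the empty event were not small, adding it repeatedly to the sample space would produce a
measure above 1. -/
theorem isSmall_bot (hM : M ≅[LA] ℕ) (k : ℕ) : IsSmall k (⊥ : events (cube n)) := by
  by_contra h
  have hlt : ∀ j, FracM j k (topCode n) (topCode n) := fun j => by
    induction j with
    | zero => exact FracM.zero hM _ _ _
    | succ j ih =>
      refine FracM.succ hM (fun x h => h) (mem_code_imp hM (U := ⊥) fun ω hω => False.elim hω)
        (fun x _ hx => ?_) ih h
      exact mem_code_imp hM (U := (⊥ : events (cube n))) (P := fun _ => False) (fun ω hω => hω) x hx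
  obtain ⟨x, hx⟩ := exists_mem_topCode hM n
  exact not_fracM_succ hM (fun x h => h) hx (hlt (k + 1))

theorem infinitesimal_of_le (hM : M ≅[LA] ℕ) {U V : events (cube n)} (h : U ≤ V)
    (hV : Infinitesimal (V : Set (cube n))) : Infinitesimal (U : Set (cube n)) :=
  (infinitesimal_iff hM U).2 fun _ => ((infinitesimal_iff hM V).1 hV _).mono hM h

theorem infinitesimal_of_le_sup (hM : M ≅[LA] ℕ) {U V W : events (cube n)} (h : W ≤ U ⊔ V)
    (hU : Infinitesimal (U : Set (cube n))) (hV : Infinitesimal (V : Set (cube n))) :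
    Infinitesimal (W : Set (cube n)) :=
  (infinitesimal_iff hM W).2 fun _ => IsSmall.union hM h ((infinitesimal_iff hM U).1 hU _)
    ((infinitesimal_iff hM V).1 hV _)

/-- The infinitesimal events already form an ideal, so passing to the span adds nothing. -/
theorem mem_nullIdeal (hM : M ≅[LA] ℕ) (a : AsBoolRing (events (cube n))) :
    a ∈ nullIdeal (cube n) ↔ Infinitesimal ((ofBoolRing a : events (cube n)) : Set (cube n)) := by
  let J : Ideal (AsBoolRing (events (cube n))) :=
    { carrier := {a | Infinitesimal ((ofBoolRing a : events (cube n)) : Set (cube n))}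
      add_mem' := fun {a b} ha hb => infinitesimal_of_le_sup hM
        (by rw [ofBoolRing_add]; exact symmDiff_le_sup) ha hb
      zero_mem' := (infinitesimal_iff hM (⊥ : events (cube n))).2 (isSmall_bot hM)
      smul_mem' := fun c a ha => infinitesimal_of_le hM
        (by rw [smul_eq_mul, ofBoolRing_mul]; exact inf_le_right) ha }
  have : nullIdeal (cube n) = J := Ideal.span_eq J
  rw [this]
  rfl

theorem cls_surjective : Function.Surjective (cls (Ω := cube n)) := fun b => by
  obtain ⟨a, ha⟩ := Ideal.Quotient.mk_surjective (ofBoolAlg b)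
  exact ⟨ofBoolRing a, by rw [cls, toBoolRing_ofBoolRing, ha, toBoolAlg_ofBoolAlg]⟩

theorem cls_top : cls (⊤ : events (cube n)) = ⊤ := by
  rw [cls, toBoolRing_top, map_one, toBoolAlg_one]

theorem cls_bot : cls (⊥ : events (cube n)) = ⊥ := by
  rw [cls, toBoolRing_bot, map_zero, toBoolAlg_zero]

theorem cls_inf (U V : events (cube n)) : cls (U ⊓ V) = cls U ⊓ cls V := by
  rw [cls, toBoolRing_inf, map_mul, toBoolAlg_mul]; rfl

theorem cls_compl (U : events (cube n)) : cls Uᶜ = (cls U)ᶜ := by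
  rw [← hnot_eq_compl, ← hnot_eq_compl, ← symmDiff_top, ← symmDiff_top, ← cls_top, cls,
    toBoolRing_symmDiff, map_add, toBoolAlg_add]
  rfl

theorem cls_sup (U V : events (cube n)) : cls (U ⊔ V) = cls U ⊔ cls V := by
  rw [← compl_compl (U ⊔ V), compl_sup, cls_compl, cls_inf, cls_compl, cls_compl, compl_inf,
    compl_compl, compl_compl]

theorem cls_eq_bot (hM : M ≅[LA] ℕ) {U : events (cube n)} :
    cls U = ⊥ ↔ Infinitesimal (U : Set (cube n)) := by
  rw [← toBoolAlg_zero, cls, toBoolAlg_inj, Ideal.Quotient.eq_zero_iff_mem, mem_nullIdeal hM,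
    ofBoolRing_toBoolRing]

theorem cls_le_cls (hM : M ≅[LA] ℕ) {U V : events (cube n)} :
    cls U ≤ cls V ↔ Infinitesimal ((U ⊓ Vᶜ : events (cube n)) : Set (cube n)) := by
  rw [← cls_eq_bot hM, cls_inf, cls_compl, ← disjoint_iff, disjoint_compl_right_iff]

theorem cls_eq_top (hM : M ≅[LA] ℕ) {U : events (cube n)} :
    cls U = ⊤ ↔ Infinitesimal ((Uᶜ : events (cube n)) : Set (cube n)) := by
  rw [← cls_eq_bot hM, cls_compl, compl_eq_bot]

/-- Up to a set of measure at most `1 / k`, some member of a directed family is its union. -/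
theorem exists_isSmall_of_directed (hM : M ≅[LA] ℕ) {I : Set (events (cube n))} (h0 : ⊥ ∈ I)
    (hI : ∀ U ∈ I, ∀ V ∈ I, U ⊔ V ∈ I) (k : ℕ) : ∃ C ∈ I, ∀ B ∈ I, IsSmall k (B ⊓ Cᶜ) := by
  -- Otherwise each member of the family can be enlarged within it by more than 1/k of the sample
  -- space; k + 1 enlargements are too many.
  by_contra! h
  have key : ∀ j, ∃ C ∈ I, FracM j k (topCode n) (code (C : Set (cube n))) := fun j => by
    induction j with
    | zero => exact ⟨⊥, h0, FracM.zero hM _ _ _⟩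
    | succ j ih =>
      obtain ⟨C, hC, hj⟩ := ih
      obtain ⟨B, hB, hk⟩ := h C hC
      refine ⟨C ⊔ B, hI C hC B hB, FracM.succ hM ?_ ?_ ?_ hj hk⟩
      · exact mem_code_imp hM fun ω hω => (mem_code hM (C ⊔ B) ω).2 (Or.inl hω)
      · exact mem_code_imp hM fun ω hω => (mem_code hM (C ⊔ B) ω).2 (Or.inr hω.1)
      · exact mem_code_imp hM fun ω hω h' => ((mem_code hM (B ⊓ Cᶜ) ω).1 h').2 hω
  obtain ⟨C, -, hC⟩ := key (k + 1)
  obtain ⟨x, hx⟩ := exists_mem_topCode hM n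
  exact not_fracM_succ hM (mem_code_imp hM fun ω _ => (mem_code hM ⊤ ω).2 trivial) hx hC

/-- The algebra of truth values is complete. -/
theorem exists_isLUB (hM : M ≅[LA] ℕ) (hs : Aleph1Saturated M) (S : Set (TruthAlg (cube n))) :
    ∃ b, IsLUB S b := by
  -- Closing S under finite joins does not change its upper bounds and makes the family directed.
  let I : Set (events (cube n)) := {U | ∃ T : Finset (TruthAlg (cube n)), (T : Set _) ⊆ S ∧
    cls U ≤ T.sup id}
  have h0 : ⊥ ∈ I := ⟨∅, by simp, by simp [cls_bot]⟩
  have hI : ∀ U ∈ I, ∀ V ∈ I, U ⊔ V ∈ I := by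
    classical
    rintro U ⟨T, hT, hU⟩ V ⟨T', hT', hV⟩
    refine ⟨T ∪ T', by simp [hT, hT'], ?_⟩
    rw [cls_sup, Finset.sup_union]
    exact sup_le_sup hU hV
  choose c hcI hc using exists_isSmall_of_directed hM h0 hI
  -- Finite unions make the approximations increasing; they stay in the directed family.
  let C : ℕ → events (cube n) := fun k => k.rec (c 0) fun k U => U ⊔ c (k + 1)
  have hCI (k : ℕ) : C k ∈ I := by
    induction k with
    | zero => exact hcI 0
    | succ k ih => exact hI _ ih _ (hcI _)
  have hmono : Monotone C := monotone_nat_of_le_succ fun k => le_sup_left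
  have hcC (k : ℕ) : c k ≤ C k := by
    cases k with
    | zero => exact le_rfl
    | succ k => exact le_sup_right
  have hC (k : ℕ) (B : events (cube n)) (hB : B ∈ I) : IsSmall k (B ⊓ (C k)ᶜ) :=
    (hc k B hB).mono hM (inf_le_inf_left _ (compl_le_compl (hcC k)))
  -- The sets x that contain C_k and exceed it by measure at most 1/k. For the conditions with k ≤
  -- N, the code of C_N is a solution.
  let D (k : ℕ) : Set M := {x | (∀ y, MMem y (code (C k).1) → MMem y x) ∧
    ∃ d, (∀ y, MMem y d ↔ MMem y x ∧ ¬ MMem y (code (C k).1)) ∧ FracM k 1 d (topCode n)}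
  have hD (k : ℕ) : (univ : Set M).Definable₁ LA (D k) := by
    refine Corr.definable₁ (S := fun v => (∀ y, MMem y (v 1) → MMem y (v 0)) ∧
      ∃ d, (∀ y, MMem y d ↔ MMem y (v 0) ∧ ¬ MMem y (v 1)) ∧ FracM k 1 d (v 2))
      (R := fun v : Fin 3 → ℕ => (∀ y, (v 1).testBit y = true → (v 0).testBit y = true) ∧
      ∃ d : ℕ, (∀ y, d.testBit y = true ↔ (v 0).testBit y = true ∧ ¬ (v 1).testBit y = true) ∧
        k * (bits d).card ≤ 1 * (bits (v 2)).card) ?_ ![code (C k).1, topCode n]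
    apply_rules (maxDepth := 500) [Corr.not, Corr.and, Corr.imp, Corr.iff, Corr.all, Corr.ex,
      Corr.mem, Corr.frac, CorrF.var]
  obtain ⟨u, hu⟩ := hs.exists_mem hD fun N => by
    refine ⟨code (C N : Set (cube n)), fun k hk => ⟨mem_code_imp hM fun ω hω =>
      (mem_code hM (C N) ω).2 (hmono hk hω), code ((C N ⊓ (C k)ᶜ : events (cube n)) : Set (cube n)),
      fun y => ⟨?_, ?_⟩, hC k _ (hCI N)⟩⟩
    · refine mem_code_imp hM (P := fun y => MMem y (code (C N).1) ∧ ¬ MMem y (code (C k).1))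
        (fun ω hω => ?_) y
      rw [mem_code hM, mem_code hM]
      exact hω
    · rintro ⟨h1, h2⟩
      revert h2
      refine mem_code_imp hM (P := fun y => ¬ MMem y (code (C k).1) →
        MMem y (code (C N ⊓ (C k)ᶜ).1)) (fun ω hω h2 => ?_) y h1
      rw [mem_code hM] at h2 ⊢
      exact ⟨hω, h2⟩
  let U : events (cube n) := ⟨_, definable_event (n := n) (Corr.definable₁
    (S := fun v : Fin 2 → M => MMem (v 0) (v 1)) (Corr.mem (CorrF.var _) (CorrF.var _)) ![u])⟩
  have hCU (k : ℕ) : C k ≤ U := fun ω hω => (hu k).1 ω ((mem_code hM _ ω).2 hω)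
  have hUC (k : ℕ) : IsSmall k (U ⊓ (C k)ᶜ) := by
    obtain ⟨d, hd, hk⟩ := (hu k).2
    refine FracM.mono hM (mem_code_imp hM fun ω hω => (hd ω).2 ⟨hω.1, ?_⟩) hk
    rw [mem_code hM]
    exact hω.2
  refine ⟨cls U, fun s hs' => ?_, fun b hb => ?_⟩
  · obtain ⟨V, rfl⟩ := cls_surjective s
    rw [cls_le_cls hM, infinitesimal_iff hM]
    exact fun k => (hC k V ⟨{cls V}, by simpa using hs', by simp⟩).mono hM
      (inf_le_inf_left _ (compl_le_compl (hCU k)))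
  · obtain ⟨V, rfl⟩ := cls_surjective b
    rw [cls_le_cls hM, infinitesimal_iff hM]
    intro k
    have h1 : cls (C (2 * k)) ≤ cls V := by
      obtain ⟨T, hT, hle⟩ := hCI (2 * k)
      exact hle.trans (Finset.sup_le fun t ht => hb (hT ht))
    rw [cls_le_cls hM, infinitesimal_iff hM] at h1
    -- U \ V is covered by U \ C_{2k} and C_{2k} \ V; the index 2k pays for the union of two small
    -- events.
    refine IsSmall.union hM ?_ (hUC (2 * k)) (h1 _)
    intro ω hω
    by_cases h : ω ∈ (C (2 * k)).1
    · exact Or.inr ⟨h, hω.2⟩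
    · exact Or.inl ⟨hω.1, h⟩

theorem isGLB_meet (hM : M ≅[LA] ℕ) (hs : Aleph1Saturated M) (S : Set (TruthAlg (cube n))) :
    IsGLB S (meet S) :=
  meet_spec (exists_isGLB_of_exists_isLUB (exists_isLUB hM hs) S)

theorem isLUB_join (hM : M ≅[LA] ℕ) (hs : Aleph1Saturated M) (S : Set (TruthAlg (cube n))) :
    IsLUB S (join S) :=
  join_spec (exists_isLUB hM hs S)

end Truth

/-! ### Closure properties of the circuit family -/

section Family

variable {M : Type*} [LA.Structure M] {n : M}

theorem GraphOnM.exists_codesFun {b : M} (h : GraphOnM n b) :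
    ∃ γ : RV (cube n), CodesFun b γ := by
  choose f hf using fun ω : cube n => h.1 ω ω.2
  have : CodesFun b f := by
    refine ⟨fun ω v => ⟨fun hv => h.2.1 ω _ _ ω.2 hv (hf ω), fun hv => hv ▸ hf ω⟩, fun x hx => ?_⟩
    obtain ⟨ω, v, hω, rfl⟩ := h.2.2 x hx
    exact ⟨⟨ω, hω⟩, v, rfl⟩
  exact ⟨⟨f, b, this⟩, this⟩

theorem CodesFun.graphOnM {b : M} {α : cube n → M} (h : CodesFun b α) : GraphOnM n b := by
  refine ⟨fun ω hω => ⟨_, (h.1 ⟨ω, hω⟩ _).2 rfl⟩, fun ω v v' hω hv hv' => ?_, fun x hx => ?_⟩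
  · rw [(h.1 ⟨ω, hω⟩ v).1 hv, (h.1 ⟨ω, hω⟩ v').1 hv']
  · obtain ⟨ω, v, rfl⟩ := h.2 x hx
    exact ⟨ω, v, ω.2, rfl⟩

/-- A function obtained pointwise from elements of M by an arithmetical operation is again an
element of M; circuit size plays no role yet. -/
theorem exists_graph_op (hM : M ≅[LA] ℕ) {op : ℕ → ℕ → ℕ → ℕ} {opM : M → M → M → M}
    (hop : CorrF (fun v : Fin 3 → ℕ => op (v 0) (v 1) (v 2))
      (fun v : Fin 3 → M => opM (v 0) (v 1) (v 2)))
    (m : M) {b₁ b₂ : M} (h₁ : GraphOnM n b₁) (h₂ : GraphOnM n b₂) :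
    ∃ b₃, GraphOnM n b₃ ∧ ∀ ω v₁ v₂ v₃, leM (lenM ω) n → MMem (pairM ω v₁) b₁ →
      MMem (pairM ω v₂) b₂ → MMem (pairM ω v₃) b₃ → v₃ = opM m v₁ v₂ := by
  refine Corr.transfer (R := fun v : Fin 4 → ℕ => GraphOn (v 0) (v 2) → GraphOn (v 0) (v 3) →
      ∃ b₃ : ℕ, GraphOn (v 0) b₃ ∧ ∀ ω v₁ v₂ v₃ : ℕ, Nat.size ω ≤ v 0 →
        (v 2).testBit (natPair ω v₁) = true → (v 3).testBit (natPair ω v₂) = true →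
        b₃.testBit (natPair ω v₃) = true → v₃ = op (v 1) v₁ v₂)
    (S := fun v => GraphOnM (v 0) (v 2) → GraphOnM (v 0) (v 3) →
      ∃ b₃, GraphOnM (v 0) b₃ ∧ ∀ ω v₁ v₂ v₃, leM (lenM ω) (v 0) → MMem (pairM ω v₁) (v 2) →
        MMem (pairM ω v₂) (v 3) → MMem (pairM ω v₃) b₃ → v₃ = opM (v 1) v₁ v₂) ?_ hM
    (fun v h h' => ?_) ![n, m, b₁, b₂] h₁ h₂
  · have hop' {k : ℕ} {f₀ f₁ f₂ : (Fin k → ℕ) → ℕ} {g₀ g₁ g₂ : (Fin k → M) → M} (h₀ : CorrF f₀ g₀)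
      (h₁ : CorrF f₁ g₁) (h₂ : CorrF f₂ g₂) :
      CorrF (fun v => op (f₀ v) (f₁ v) (f₂ v)) (fun v => opM (g₀ v) (g₁ v) (g₂ v)) :=
      CorrF.comp₃ hop h₀ h₁ h₂
    apply_rules (maxDepth := 500) [Corr.and, Corr.imp, Corr.all, Corr.ex, Corr.le, Corr.eq,
      Corr.graphOn, Corr.mem, CorrF.var, CorrF.natPair, CorrF.size, hop']
  · have hf (b : ℕ) (hb : GraphOn (v 0) b) : ∃ f : ℕ → ℕ, ∀ ω w, Nat.size ω ≤ v 0 →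
        b.testBit (natPair ω w) = true → w = f ω := by
      have (ω : ℕ) : ∃ y, ∀ w, Nat.size ω ≤ v 0 → b.testBit (natPair ω w) = true → w = y := by
        by_cases hω : Nat.size ω ≤ v 0
        · obtain ⟨y, hy⟩ := hb.1 ω hω
          exact ⟨y, fun w _ hw => hb.2.1 ω _ _ hω hw hy⟩
        · exact ⟨0, fun w hw => absurd hw hω⟩
      choose f hf using this
      exact ⟨f, hf⟩
    obtain ⟨f₁, hf₁⟩ := hf _ h
    obtain ⟨f₂, hf₂⟩ := hf _ h'
    refine ⟨graphCode (v 0) fun ω => op (v 1) (f₁ ω) (f₂ ω), graphOn_graphCode _ _,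
      fun ω v₁ v₂ v₃ hω k₁ k₂ k₃ => ?_⟩
    rw [(testBit_graphCode_pair.1 k₃).2, hf₁ ω v₁ hω k₁, hf₂ ω v₂ hω k₂]

theorem PolyOp.subM (hM : M ≅[LA] ℕ) (hn : Nonstandard n) {op : ℕ → ℕ → ℕ → ℕ}
    {opM : M → M → M → M} (hpoly : PolyOp op)
    (hop : CorrF (fun v : Fin 3 → ℕ => op (v 0) (v 1) (v 2))
      (fun v : Fin 3 → M => opM (v 0) (v 1) (v 2)))
    {m b₁ b₂ b₃ : M} (k : ℕ) (hm : leM (powM m (2 * k + 1)) n) (h₁ : SubM (2 * (k + 1)) n b₁)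
    (h₂ : SubM (2 * (k + 1)) n b₂) (h₃ : GraphOnM n b₃)
    (h : ∀ ω v₁ v₂ v₃, leM (lenM ω) n → MMem (pairM ω v₁) b₁ → MMem (pairM ω v₂) b₂ →
      MMem (pairM ω v₃) b₃ → v₃ = opM m v₁ v₂) : SubM (k + 1) n b₃ := by
  obtain ⟨N, hN⟩ := hpoly.subexpComputable (k + 1) (by lia)
  refine Corr.transfer (R := fun v : Fin 5 → ℕ => N ≤ v 0 → v 1 ^ (2 * k + 1 + 1) ≤ v 0 →
      SubexpComputable (2 * (k + 1)) (v 0) (v 2) → SubexpComputable (2 * (k + 1)) (v 0) (v 3) →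
      GraphOn (v 0) (v 4) → (∀ ω v₁ v₂ v₃ : ℕ, Nat.size ω ≤ v 0 →
        (v 2).testBit (natPair ω v₁) = true → (v 3).testBit (natPair ω v₂) = true →
        (v 4).testBit (natPair ω v₃) = true → v₃ = op (v 1) v₁ v₂) →
        SubexpComputable (k + 1) (v 0) (v 4))
    (S := fun v => leM (num M N) (v 0) → leM (powM (v 1) (2 * k + 1)) (v 0) →
      SubM (2 * (k + 1)) (v 0) (v 2) → SubM (2 * (k + 1)) (v 0) (v 3) → GraphOnM (v 0) (v 4) →
      (∀ ω v₁ v₂ v₃, leM (lenM ω) (v 0) → MMem (pairM ω v₁) (v 2) →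
        MMem (pairM ω v₂) (v 3) → MMem (pairM ω v₃) (v 4) → v₃ = opM (v 1) v₁ v₂) →
      SubM (k + 1) (v 0) (v 4)) ?_ hM (fun v hv hv' => hN _ hv _ _ _ _ hv')
      ![n, m, b₁, b₂, b₃] (hn.num_le hM N) hm h₁ h₂ h₃ h
  have hop' {k : ℕ} {f₀ f₁ f₂ : (Fin k → ℕ) → ℕ} {g₀ g₁ g₂ : (Fin k → M) → M} (h₀ : CorrF f₀ g₀)
    (h₁ : CorrF f₁ g₁) (h₂ : CorrF f₂ g₂) :
    CorrF (fun v => op (f₀ v) (f₁ v) (f₂ v)) (fun v => opM (g₀ v) (g₁ v) (g₂ v)) :=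
    CorrF.comp₃ hop h₀ h₁ h₂
  apply_rules (maxDepth := 500) [Corr.imp, Corr.all, Corr.le, Corr.eq, CorrF.pow,
    Corr.subexp, Corr.graphOn, Corr.mem, CorrF.var, CorrF.natPair, CorrF.size, CorrF.const, hop']

/-- The circuit family is closed under operations that are computed by circuits of polynomial
size. -/
theorem PolyOp.exists_mem (hM : M ≅[LA] ℕ) (hn : Nonstandard n) {op : ℕ → ℕ → ℕ → ℕ}
    {opM : M → M → M → M} (hpoly : PolyOp op)
    (hop : CorrF (fun v : Fin 3 → ℕ => op (v 0) (v 1) (v 2))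
      (fun v : Fin 3 → M => opM (v 0) (v 1) (v 2)))
    {m : M} (hm : ∀ k, leM (powM m k) n) (α β : circuitFamily n) :
    ∃ γ : circuitFamily n, ∀ ω, (γ : RV (cube n)) ω =
      opM m ((α : RV (cube n)) ω) ((β : RV (cube n)) ω) := by
  obtain ⟨α, b₁, h₁, k₁⟩ := α
  obtain ⟨β, b₂, h₂, k₂⟩ := β
  obtain ⟨b₃, h₃, h⟩ := exists_graph_op hM hop m h₁.graphOnM h₂.graphOnM
  obtain ⟨γ, hγ⟩ := h₃.exists_codesFun
  refine ⟨⟨γ, b₃, hγ, fun k hk => ?_⟩, fun ω => ?_⟩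
  · obtain ⟨k, rfl⟩ := Nat.exists_eq_add_of_le' hk
    exact hpoly.subM hM hn hop k (hm _) (k₁ _ (by lia)) (k₂ _ (by lia)) h₃ h
  · exact h ω _ _ _ ω.2 ((h₁.1 _ _).2 rfl) ((h₂.1 _ _).2 rfl) ((hγ.1 _ _).2 rfl)

theorem powM_zero_le (hM : M ≅[LA] ℕ) (n : M) (k : ℕ) : leM (powM (num M 0) k) n :=
  Corr.transfer (R := fun v : Fin 1 → ℕ => 0 ^ (k + 1) ≤ v 0)
    (S := fun v => leM (powM (num M 0) k) (v 0)) (Corr.le (CorrF.pow k (CorrF.const 0)) (CorrF.var _))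
    hM (fun v => by simp) ![n]

/-- The constant may be non-standard: a circuit can have its at most n bits built in, at linear
cost. -/
theorem exists_const_mem (hM : M ≅[LA] ℕ) (hn : Nonstandard n) {w : M} (hw : leM (lenM w) n) :
    ∃ γ : circuitFamily n, ∀ ω, (γ : RV (cube n)) ω = w := by
  obtain ⟨b, hb, h⟩ : ∃ b, GraphOnM n b ∧ ∀ ω v, leM (lenM ω) n → MMem (pairM ω v) b → v = w := by
    refine Corr.transfer (R := fun v : Fin 2 → ℕ => ∃ b : ℕ, GraphOn (v 0) b ∧ ∀ ω y : ℕ,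
        Nat.size ω ≤ v 0 → b.testBit (natPair ω y) = true → y = v 1)
      (S := fun v => ∃ b, GraphOnM (v 0) b ∧ ∀ ω y, leM (lenM ω) (v 0) →
        MMem (pairM ω y) b → y = v 1) ?_ hM (fun v => ?_) ![n, w]
    · apply_rules (maxDepth := 500) [Corr.and, Corr.imp, Corr.all, Corr.ex, Corr.le, Corr.eq,
        Corr.graphOn, Corr.mem, CorrF.var, CorrF.natPair, CorrF.size]
    · exact ⟨graphCode (v 0) fun _ => v 1, graphOn_graphCode _ _, fun ω y _ hy =>
        (testBit_graphCode_pair.1 hy).2⟩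
  obtain ⟨γ, hγ⟩ := hb.exists_codesFun
  refine ⟨⟨γ, b, hγ, fun k hk => ?_⟩, fun ω => h ω _ ω.2 ((hγ.1 _ _).2 rfl)⟩
  obtain ⟨N, hN⟩ := subexpComputable_const k hk
  refine Corr.transfer (R := fun v : Fin 3 → ℕ => N ≤ v 0 → Nat.size (v 1) ≤ v 0 → GraphOn (v 0) (v 2) →
      (∀ ω y : ℕ, Nat.size ω ≤ v 0 → (v 2).testBit (natPair ω y) = true → y = v 1) →
        SubexpComputable k (v 0) (v 2))
    (S := fun v => leM (num M N) (v 0) → leM (lenM (v 1)) (v 0) → GraphOnM (v 0) (v 2) →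
      (∀ ω y, leM (lenM ω) (v 0) → MMem (pairM ω y) (v 2) → y = v 1) → SubM k (v 0) (v 2)) ?_ hM
    (fun v hv => hN _ hv _ _) ![n, w, b] (hn.num_le hM N) hw hb h
  apply_rules (maxDepth := 500) [Corr.imp, Corr.all, Corr.le, Corr.eq,
    Corr.subexp, Corr.graphOn, Corr.mem, CorrF.var, CorrF.natPair, CorrF.size, CorrF.const]

theorem exists_id_mem (hM : M ≅[LA] ℕ) (hn : Nonstandard n) :
    ∃ ι : circuitFamily n, ∀ ω : cube n, (ι : RV (cube n)) ω = ω := by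
  obtain ⟨b, hb, h⟩ : ∃ b, GraphOnM n b ∧ ∀ ω v, leM (lenM ω) n → MMem (pairM ω v) b → v = ω := by
    refine Corr.transfer (R := fun v : Fin 1 → ℕ => ∃ b : ℕ, GraphOn (v 0) b ∧ ∀ ω y : ℕ,
        Nat.size ω ≤ v 0 → b.testBit (natPair ω y) = true → y = ω)
      (S := fun v => ∃ b, GraphOnM (v 0) b ∧ ∀ ω y, leM (lenM ω) (v 0) →
        MMem (pairM ω y) b → y = ω) ?_ hM (fun v => ?_) ![n]
    · apply_rules (maxDepth := 500) [Corr.and, Corr.imp, Corr.all, Corr.ex, Corr.le, Corr.eq,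
        Corr.graphOn, Corr.mem, CorrF.var, CorrF.natPair, CorrF.size]
    · exact ⟨graphCode (v 0) fun x => x, graphOn_graphCode _ _, fun ω y _ hy =>
        (testBit_graphCode_pair.1 hy).2⟩
  obtain ⟨γ, hγ⟩ := hb.exists_codesFun
  refine ⟨⟨γ, b, hγ, fun k hk => ?_⟩, fun ω => h ω _ ω.2 ((hγ.1 _ _).2 rfl)⟩
  obtain ⟨N, hN⟩ := subexpComputable_id k hk
  refine Corr.transfer (R := fun v : Fin 2 → ℕ => N ≤ v 0 → GraphOn (v 0) (v 1) →
      (∀ ω y : ℕ, Nat.size ω ≤ v 0 → (v 1).testBit (natPair ω y) = true → y = ω) →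
        SubexpComputable k (v 0) (v 1))
    (S := fun v => leM (num M N) (v 0) → GraphOnM (v 0) (v 1) →
      (∀ ω y, leM (lenM ω) (v 0) → MMem (pairM ω y) (v 1) → y = ω) → SubM k (v 0) (v 1)) ?_ hM
    (fun v hv => hN _ hv _) ![n, b] (hn.num_le hM N) hb h
  apply_rules (maxDepth := 500) [Corr.imp, Corr.all, Corr.le, Corr.eq,
    Corr.subexp, Corr.graphOn, Corr.mem, CorrF.var, CorrF.natPair, CorrF.size, CorrF.const]

end Family

/-! ### L-closure, definition by cases, compactness and pairing -/

section Closure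

variable {M : Type*} [LA.Structure M] {n : M}

theorem lClosed_circuitFamily (hM : M ≅[LA] ℕ) (hn : Nonstandard n) :
    LClosed (circuitFamily n) := by
  have h0 := powM_zero_le hM n
  obtain ⟨ι, -⟩ := exists_id_mem hM hn
  intro m f α
  suffices ∃ γ : circuitFamily n, ∀ ω, (γ : RV (cube n)) ω =
      Structure.funMap f fun i => (α i : RV (cube n)) ω from
    let ⟨γ, hγ⟩ := this
    ⟨γ, γ.2, hγ⟩
  have e₁ (ω : cube n) (α : Fin 1 → circuitFamily n) :
      (fun i => (α i : RV (cube n)) ω) = ![(α 0 : RV (cube n)) ω] := by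
    funext i; fin_cases i; rfl
  have e₂ (ω : cube n) (α : Fin 2 → circuitFamily n) :
      (fun i => (α i : RV (cube n)) ω) = ![(α 0 : RV (cube n)) ω, (α 1 : RV (cube n)) ω] := by
    funext i; fin_cases i <;> rfl
  cases f with
  | zero =>
    obtain ⟨γ, hγ⟩ := (polyOp_const 0).exists_mem hM hn (opM := fun _ _ _ =>
      Structure.funMap zeroS ![]) (CorrF.func₀ zeroS) h0 ι ι
    exact ⟨γ, fun ω => (hγ ω).trans (congrArg _ (Subsingleton.elim _ _))⟩
  | one =>
    obtain ⟨γ, hγ⟩ := (polyOp_const 1).exists_mem hM hn (opM := fun _ _ _ =>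
      Structure.funMap oneS ![]) (CorrF.func₀ oneS) h0 ι ι
    exact ⟨γ, fun ω => (hγ ω).trans (congrArg _ (Subsingleton.elim _ _))⟩
  | add =>
    obtain ⟨γ, hγ⟩ := polyOp_add.exists_mem hM hn (opM := fun _ a b => addM a b)
      (CorrF.add (CorrF.var 1) (CorrF.var 2)) h0 (α 0) (α 1)
    exact ⟨γ, fun ω => by rw [hγ, e₂]; rfl⟩
  | mul =>
    obtain ⟨γ, hγ⟩ := polyOp_mul.exists_mem hM hn (opM := fun _ a b => mulM a b)
      (CorrF.mul (CorrF.var 1) (CorrF.var 2)) h0 (α 0) (α 1)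
    exact ⟨γ, fun ω => by rw [hγ, e₂]; rfl⟩
  | pair =>
    obtain ⟨γ, hγ⟩ := polyOp_pair.exists_mem hM hn (opM := fun _ a b => pairM a b)
      (CorrF.natPair (CorrF.var 1) (CorrF.var 2)) h0 (α 0) (α 1)
    exact ⟨γ, fun ω => by rw [hγ, e₂]; rfl⟩
  | proj1 =>
    obtain ⟨γ, hγ⟩ := polyOp_proj1.exists_mem hM hn (opM := fun _ a _ => proj1M a)
      (CorrF.natProj1 (CorrF.var 1)) h0 (α 0) (α 0)
    exact ⟨γ, fun ω => by rw [hγ, e₁]; rfl⟩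
  | proj2 =>
    obtain ⟨γ, hγ⟩ := polyOp_proj2.exists_mem hM hn (opM := fun _ a _ => proj2M a)
      (CorrF.natProj2 (CorrF.var 1)) h0 (α 0) (α 0)
    exact ⟨γ, fun ω => by rw [hγ, e₁]; rfl⟩
  | len =>
    obtain ⟨γ, hγ⟩ := polyOp_size.exists_mem hM hn (opM := fun _ a _ => lenM a)
      (CorrF.size (CorrF.var 1)) h0 (α 0) (α 0)
    exact ⟨γ, fun ω => by rw [hγ, e₁]; rfl⟩

theorem LClosed.exists_term {Ω : Set M} {F : Set (RV Ω)} (hF : LClosed F) {β : Type*}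
    (t : LA.Term β) (x : β → F) :
    ∃ τ : F, ∀ ω, (τ : RV Ω) ω = t.realize fun i => (x i : RV Ω) ω := by
  induction t with
  | var i => exact ⟨x i, fun _ => rfl⟩
  | func f ts ih =>
    choose τ hτ using ih
    obtain ⟨γ, hγ, h⟩ := hF _ f τ
    refine ⟨⟨γ, hγ⟩, fun ω => (h ω).trans ?_⟩
    simp only [hτ]
    rfl

/-- The indicator of `≤` in `M`. -/
def leIndM (a b : M) : M := interpF (fun v : Fin 3 → ℕ => leInd (v 1) (v 2)) ![a, a, b]

theorem corrF_leInd (hM : M ≅[LA] ℕ) : CorrF (fun v : Fin 3 → ℕ => leInd (v 1) (v 2))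
    (fun v : Fin 3 → M => leIndM (v 1) (v 2)) := by
  refine CorrF.comp₂ (p := leInd) (q := leIndM) ?_ (CorrF.var 1) (CorrF.var 2)
  exact ⟨(arithF_leInd.corrF hM).graph.comp (n := 3)
    (f := fun i v => ![v 0, v 1, v 1, v 2] i) (g := fun i v => ![v 0, v 1, v 1, v 2] i)
    (fun i => by fin_cases i <;> exact CorrF.var _) |>.congr (fun v => Iff.rfl) fun v => by
      refine iff_of_eq (congrArg _ ?_)
      unfold leIndM
      congr 1⟩

open Classical in
theorem leIndM_eq (hM : M ≅[LA] ℕ) (a b : M) :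
    leIndM a b = if leM a b then num M 1 else num M 0 := by
  have h : (leM a b → leIndM a b = num M 1) ∧ (¬ leM a b → leIndM a b = num M 0) := by
    refine Corr.transfer (R := fun v : Fin 3 → ℕ => (v 1 ≤ v 2 → leInd (v 1) (v 2) = 1) ∧
        (¬ v 1 ≤ v 2 → leInd (v 1) (v 2) = 0))
      (S := fun v => (leM (v 1) (v 2) → leIndM (v 1) (v 2) = num M 1) ∧
        (¬ leM (v 1) (v 2) → leIndM (v 1) (v 2) = num M 0)) ?_ hM (fun v => ?_) ![a, a, b]
    · have := corrF_leInd hM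
      apply_rules [Corr.not, Corr.and, Corr.imp, Corr.le, Corr.eq, CorrF.var, CorrF.const]
    · unfold leInd
      exact ⟨fun h => if_pos h, fun h => if_neg h⟩
  split_ifs with h'
  exacts [h.1 h', h.2 h']

theorem num_le_num (hM : M ≅[LA] ℕ) (j k : ℕ) : leM (num M j) (num M k) ↔ j ≤ k := by
  have h : Corr (fun _ : Fin 0 → ℕ => j ≤ k) (fun _ => leM (num M j) (num M k)) :=
    Corr.le (CorrF.const j) (CorrF.const k)
  by_cases hjk : j ≤ k
  · exact iff_of_true (h.transfer hM (fun _ => hjk) ![]) hjk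
  · exact iff_of_false (h.not.transfer hM (fun _ => hjk) ![]) hjk

theorem leM_antisymm_iff (hM : M ≅[LA] ℕ) {a b : M} : a = b ↔ leM a b ∧ leM b a :=
  Corr.transfer (R := fun v : Fin 2 → ℕ => v 0 = v 1 ↔ v 0 ≤ v 1 ∧ v 1 ≤ v 0)
    (S := fun v => v 0 = v 1 ↔ leM (v 0) (v 1) ∧ leM (v 1) (v 0)) (by
      apply_rules [Corr.and, Corr.iff, Corr.le, Corr.eq, CorrF.var]) hM
    (fun v => le_antisymm_iff) ![a, b]

theorem num_mul_num (hM : M ≅[LA] ℕ) (j k : ℕ) : mulM (num M j) (num M k) = num M (j * k) :=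
  Corr.transfer (R := fun _ : Fin 0 → ℕ => j * k = j * k)
    (S := fun _ => mulM (num M j) (num M k) = num M (j * k))
    (Corr.eq (CorrF.mul (CorrF.const _) (CorrF.const _)) (CorrF.const (j * k))) hM (fun _ => rfl) ![]

theorem select_one (hM : M ≅[LA] ℕ) (a b : M) :
    addM (mulM (num M 1) a) (mulM (num M 0) b) = a :=
  Corr.transfer (R := fun v : Fin 2 → ℕ => 1 * v 0 + 0 * v 1 = v 0)
    (S := fun v => addM (mulM (num M 1) (v 0)) (mulM (num M 0) (v 1)) = v 0)
    (Corr.eq (CorrF.add (CorrF.mul (CorrF.const _) (CorrF.var _))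
      (CorrF.mul (CorrF.const _) (CorrF.var _))) (CorrF.var _)) hM (fun _ => by simp) ![a, b]

theorem select_zero (hM : M ≅[LA] ℕ) (a b : M) :
    addM (mulM (num M 0) a) (mulM (num M 1) b) = b :=
  Corr.transfer (R := fun v : Fin 2 → ℕ => 0 * v 0 + 1 * v 1 = v 1)
    (S := fun v => addM (mulM (num M 0) (v 0)) (mulM (num M 1) (v 1)) = v 1)
    (Corr.eq (CorrF.add (CorrF.mul (CorrF.const _) (CorrF.var _))
      (CorrF.mul (CorrF.const _) (CorrF.var _))) (CorrF.var _)) hM (fun _ => by simp) ![a, b]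

theorem exists_leInd_mem (hM : M ≅[LA] ℕ) (hn : Nonstandard n) (α β : circuitFamily n) :
    ∃ γ : circuitFamily n, ∀ ω, (γ : RV (cube n)) ω =
      leIndM ((α : RV (cube n)) ω) ((β : RV (cube n)) ω) :=
  polyOp_leInd.exists_mem hM hn (opM := fun _ a b => leIndM a b) (corrF_leInd hM)
    (powM_zero_le hM n) α β

theorem exists_mul_mem (hM : M ≅[LA] ℕ) (hn : Nonstandard n) (α β : circuitFamily n) :
    ∃ γ : circuitFamily n, ∀ ω, (γ : RV (cube n)) ω =
      mulM ((α : RV (cube n)) ω) ((β : RV (cube n)) ω) :=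
  polyOp_mul.exists_mem hM hn (opM := fun _ a b => mulM a b)
    (CorrF.mul (CorrF.var 1) (CorrF.var 2)) (powM_zero_le hM n) α β

theorem exists_add_mem (hM : M ≅[LA] ℕ) (hn : Nonstandard n) (α β : circuitFamily n) :
    ∃ γ : circuitFamily n, ∀ ω, (γ : RV (cube n)) ω =
      addM ((α : RV (cube n)) ω) ((β : RV (cube n)) ω) :=
  polyOp_add.exists_mem hM hn (opM := fun _ a b => addM a b)
    (CorrF.add (CorrF.var 1) (CorrF.var 2)) (powM_zero_le hM n) α β

theorem exists_num_mem (hM : M ≅[LA] ℕ) (hn : Nonstandard n) (k : ℕ) :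
    ∃ γ : circuitFamily n, ∀ ω, (γ : RV (cube n)) ω = num M k := by
  obtain ⟨ι, -⟩ := exists_id_mem hM hn
  exact (polyOp_const k).exists_mem hM hn (opM := fun _ _ _ => num M k) (CorrF.const k)
    (powM_zero_le hM n) ι ι

open Classical in
/-- The indicator of an open formula is in the circuit family. -/
theorem exists_indicator (hM : M ≅[LA] ℕ) (hn : Nonstandard n) {β : Type*} {k : ℕ}
    {B : LA.BoundedFormula β k} (hB : B.IsQF) (x : β → circuitFamily n) (y : Fin k → circuitFamily n) :
    ∃ χ : circuitFamily n, ∀ ω, (χ : RV (cube n)) ω =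
      if B.Realize (fun i => (x i : RV (cube n)) ω) (fun i => (y i : RV (cube n)) ω)
        then num M 1 else num M 0 := by
  have h01 := num_le_num hM 0 1
  have h10 := num_le_num hM 1 0
  have h00 := num_le_num hM 0 0
  have h11 := num_le_num hM 1 1
  have hterm (t : LA.Term (β ⊕ Fin k)) : ∃ τ : circuitFamily n, ∀ ω, (τ : RV (cube n)) ω =
      t.realize (Sum.elim (fun i => (x i : RV (cube n)) ω) fun i => (y i : RV (cube n)) ω) := by
    obtain ⟨τ, hτ⟩ := (lClosed_circuitFamily hM hn).exists_term t (Sum.elim x y)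
    refine ⟨τ, fun ω => (hτ ω).trans (congrArg (fun z => t.realize z) ?_)⟩
    funext i
    rcases i with i | i <;> rfl
  induction hB with
  | falsum =>
    obtain ⟨γ, hγ⟩ := exists_num_mem hM hn 0
    exact ⟨γ, fun ω => (hγ ω).trans (if_neg id).symm⟩
  | of_isAtomic h =>
    cases h with
    | equal s t =>
      obtain ⟨σ, hσ⟩ := hterm s
      obtain ⟨τ, hτ⟩ := hterm t
      obtain ⟨χ₁, h₁⟩ := exists_leInd_mem hM hn σ τ
      obtain ⟨χ₂, h₂⟩ := exists_leInd_mem hM hn τ σ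
      -- Equality is the conjunction of the two inequalities, so its indicator is a product.
      obtain ⟨χ, h⟩ := exists_mul_mem hM hn χ₁ χ₂
      refine ⟨χ, fun ω => ?_⟩
      rw [h, h₁, h₂, hσ, hτ, leIndM_eq hM, leIndM_eq hM, BoundedFormula.realize_bdEqual]
      refine .trans ?_ (if_congr (leM_antisymm_iff hM) rfl rfl).symm
      split_ifs with h3 h4 h5 h6 h7 <;> first | exact num_mul_num hM _ _ | tauto
    | rel R ts =>
      cases R
      obtain ⟨σ, hσ⟩ := hterm (ts 0)
      obtain ⟨τ, hτ⟩ := hterm (ts 1)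
      obtain ⟨χ, h⟩ := exists_leInd_mem hM hn σ τ
      refine ⟨χ, fun ω => ?_⟩
      rw [h, hσ, hτ, leIndM_eq hM]
      refine if_congr (.trans (iff_of_eq (congrArg (Structure.RelMap leS) ?_))
        BoundedFormula.realize_rel.symm) rfl rfl
      funext i; fin_cases i <;> rfl
  | imp _ _ ih₁ ih₂ =>
    obtain ⟨χ₁, h₁⟩ := ih₁
    obtain ⟨χ₂, h₂⟩ := ih₂
    -- For truth values 0 and 1, implication is the relation ≤.
    obtain ⟨χ, h⟩ := exists_leInd_mem hM hn χ₁ χ₂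
    refine ⟨χ, fun ω => ?_⟩
    rw [h, h₁, h₂, leIndM_eq hM, BoundedFormula.realize_imp]
    split_ifs <;> simp_all

/-- With the indicator χ of B(α), the function sought is χ·α + χ'·β, where χ' is the indicator of χ
≤ 0. -/
theorem casesClosed_circuitFamily (hM : M ≅[LA] ℕ) (hn : Nonstandard n) :
    CasesClosed (circuitFamily n) := by
  intro α hα β hβ B hB
  obtain ⟨χ, hχ⟩ := exists_indicator hM hn hB (Sum.elim id fun _ => ⟨α, hα⟩) Fin.elim0
  obtain ⟨z, hz⟩ := exists_num_mem hM hn 0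
  obtain ⟨χ', hχ'⟩ := exists_leInd_mem hM hn χ z
  obtain ⟨γ₁, h₁⟩ := exists_mul_mem hM hn χ ⟨α, hα⟩
  obtain ⟨γ₂, h₂⟩ := exists_mul_mem hM hn χ' ⟨β, hβ⟩
  obtain ⟨γ, h⟩ := exists_add_mem hM hn γ₁ γ₂
  have e (ω : cube n) : (B.Realize (Sum.elim (fun a : circuitFamily n => (a : RV (cube n)) ω)
      (fun _ => α ω))) ↔ BoundedFormula.Realize B (fun i => ((Sum.elim id (fun _ => ⟨α, hα⟩) i :
      circuitFamily n) : RV (cube n)) ω) (fun i => ((Fin.elim0 i : circuitFamily n) :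
      RV (cube n)) ω) := by
    refine iff_of_eq (congrArg₂ (fun a b => BoundedFormula.Realize B a b) ?_ (Subsingleton.elim _ _))
    funext i
    rcases i with i | i <;> rfl
  refine ⟨γ, γ.2, fun ω => ⟨fun hω => ?_, fun hω => ?_⟩⟩ <;> rw [e] at hω
  · rw [h, h₁, h₂, hχ', hz, hχ, if_pos hω, leIndM_eq hM, if_neg (by simp [num_le_num hM])]
    exact select_one hM _ _
  · rw [h, h₁, h₂, hχ', hz, hχ, if_neg hω, leIndM_eq hM, if_pos (by simp [num_le_num hM])]
    exact select_zero hM _ _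

theorem SubM.graphOnM (hM : M ≅[LA] ℕ) {k : ℕ} {b : M} (h : SubM k n b) : GraphOnM n b :=
  Corr.transfer (R := fun v : Fin 2 → ℕ => SubexpComputable k (v 0) (v 1) → GraphOn (v 0) (v 1))
    (S := fun v => SubM k (v 0) (v 1) → GraphOnM (v 0) (v 1))
    (Corr.imp (Corr.subexp k (CorrF.var _) (CorrF.var _)) (Corr.graphOn (CorrF.var _) (CorrF.var _)))
    hM (fun _ => SubexpComputable.graphOn) ![n, b] h

/-- H(k, b) is the size condition for exponent k + 1, because the conditions defining F start at
exponent 1. A bound on r^(k+2) implies one on r^(k+1), so the chain decreases. -/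
theorem compactFamily_circuitFamily (hM : M ≅[LA] ℕ) : CompactFamily (circuitFamily n) := by
  obtain ⟨φ, -, hφ⟩ := Corr.subexp' (M := M) (n := 3) (CorrF.add (CorrF.var 0) (CorrF.func₀ oneS))
    (CorrF.var 2) (CorrF.var 1)
  have key (k : ℕ) (b : M) : (φ.relabel ![Sum.inr 0, Sum.inr 1, Sum.inl n]).Realize
      (Sum.elim id ![num M k, b]) ↔ SubM (k + 1) n b := by
    rw [Formula.realize_relabel, hφ]
    rfl
  refine ⟨φ.relabel ![Sum.inr 0, Sum.inr 1, Sum.inl n], ?_, fun k b hb => ?_⟩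
  · ext b
    simp only [mem_iInter, mem_ofPred_eq, key]
    constructor
    · intro h
      obtain ⟨γ, hγ⟩ := (h 0).graphOnM hM |>.exists_codesFun
      refine ⟨γ, ⟨b, hγ, fun k hk => ?_⟩, hγ⟩
      obtain ⟨k, rfl⟩ := Nat.exists_eq_add_of_le' hk
      exact h k
    · rintro ⟨α, ⟨b', h', h⟩, hb⟩ k
      have : b = b' := mem_ext hM fun x => by
        have aux {b b' : M} (hb : CodesFun b α) (h' : CodesFun b' α) (hx : MMem x b) :
            MMem x b' := by
          obtain ⟨ω, v, rfl⟩ := hb.2 x hx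
          exact (h'.1 ω v).2 ((hb.1 ω v).1 hx)
        exact ⟨aux hb h', aux h' hb⟩
      rw [this]
      exact h _ (by lia)
  · simp only [mem_ofPred_eq, key] at hb ⊢
    exact Corr.transfer (R := fun v : Fin 2 → ℕ => SubexpComputable (k + 2) (v 0) (v 1) →
        SubexpComputable (k + 1) (v 0) (v 1))
      (S := fun v => SubM (k + 2) (v 0) (v 1) → SubM (k + 1) (v 0) (v 1))
      (Corr.imp (Corr.subexp _ (CorrF.var _) (CorrF.var _))
        (Corr.subexp _ (CorrF.var _) (CorrF.var _))) hM (fun _ => SubexpComputable.anti) ![n, b] hb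

theorem cls_eq_top_of_forall {U : Set (cube n)} (hU : U ∈ events (cube n)) (h : ∀ ω, ω ∈ U) :
    cls ⟨U, hU⟩ = ⊤ := by
  rw [← cls_top]
  congr 1
  exact Subtype.ext (eq_univ_of_forall h)

theorem meet_eq_top (hM : M ≅[LA] ℕ) (hs : Aleph1Saturated M) {S : Set (TruthAlg (cube n))} :
    meet S = ⊤ ↔ ∀ b ∈ S, b = ⊤ := by
  refine ⟨fun h b hb => top_le_iff.1 (h ▸ (isGLB_meet hM hs S).1 hb), fun h => top_le_iff.1 ?_⟩
  exact (isGLB_meet hM hs S).2 fun b hb => (h b hb).ge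

theorem truth_all_eq_top (hM : M ≅[LA] ℕ) (hs : Aleph1Saturated M) {F : Set (RV (cube n))}
    {β : Type*} {k : ℕ} {φ : LA.BoundedFormula β (k + 1)} {v : β → F} {xs : Fin k → F} :
    truth F φ.all v xs = ⊤ ↔ ∀ y, truth F φ v (Fin.snoc xs y) = ⊤ := by
  rw [truth, meet_eq_top hM hs]
  exact ⟨fun h y => h _ ⟨y, rfl⟩, fun h b ⟨y, hb⟩ => hb ▸ h y⟩

/-- The identities hold at every sample, being true in M by transfer, so no property of F enters. -/
theorem hasPairing (hM : M ≅[LA] ℕ) (hs : Aleph1Saturated M) (F : Set (RV (cube n))) :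
    HasPairing F := by
  refine ⟨(truth_all_eq_top hM hs).2 fun y => cls_eq_top_of_forall _ fun ω => ?_,
    (truth_all_eq_top hM hs).2 fun y => (truth_all_eq_top hM hs).2 fun z =>
      cls_eq_top_of_forall _ fun ω => ?_,
    (truth_all_eq_top hM hs).2 fun y => (truth_all_eq_top hM hs).2 fun z =>
      cls_eq_top_of_forall _ fun ω => ?_⟩
  · have h (z : M) : pairM (proj1M z) (proj2M z) = z :=
      Corr.transfer (R := fun v : Fin 1 → ℕ => natPair (natProj1 (v 0)) (natProj2 (v 0)) = v 0)
        (S := fun v => pairM (proj1M (v 0)) (proj2M (v 0)) = v 0) (Corr.eq (CorrF.natPair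
          (CorrF.natProj1 (CorrF.var _)) (CorrF.natProj2 (CorrF.var _))) (CorrF.var _)) hM
        (fun v => natPair_natProj _) ![z]
    simpa [Fin.snoc] using h _
  · have h (x y : M) : proj1M (pairM x y) = x :=
      Corr.transfer (R := fun v : Fin 2 → ℕ => natProj1 (natPair (v 0) (v 1)) = v 0)
        (S := fun v => proj1M (pairM (v 0) (v 1)) = v 0) (Corr.eq (CorrF.natProj1
          (CorrF.natPair (CorrF.var _) (CorrF.var _))) (CorrF.var _)) hM
        (fun v => natProj1_natPair _ _) ![x, y]
    simpa [Fin.snoc] using h _ _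
  · have h (x y : M) : proj2M (pairM x y) = y :=
      Corr.transfer (R := fun v : Fin 2 → ℕ => natProj2 (natPair (v 0) (v 1)) = v 1)
        (S := fun v => proj2M (pairM (v 0) (v 1)) = v 1) (Corr.eq (CorrF.natProj2
          (CorrF.natPair (CorrF.var _) (CorrF.var _))) (CorrF.var _)) hM
        (fun v => natProj2_natPair _ _) ![x, y]
    simpa [Fin.snoc] using h _ _

end Closure

/-! ### Failure of saturation -/

section Failure

variable {M : Type*} [LA.Structure M] {n : M}

/-- The event that a definable relation holds of the values of two random variables and of a
parameter. -/
theorem relation_mem_events {P : ℕ → ℕ → ℕ → Prop} {Q : M → M → M → Prop}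
    (h : Corr (fun v : Fin 3 → ℕ => P (v 0) (v 1) (v 2))
      (fun v : Fin 3 → M => Q (v 0) (v 1) (v 2))) (α β : RV (cube n)) (c : M) :
    {ω : cube n | Q (α ω) (β ω) c} ∈ events (cube n) := by
  obtain ⟨α, a, ha⟩ := α
  obtain ⟨β, b, hb⟩ := β
  refine ⟨_, Corr.definable₁ (S := fun v : Fin 4 → M => ∃ x y, MMem (pairM (v 0) x) (v 1) ∧
      MMem (pairM (v 0) y) (v 2) ∧ Q x y (v 3))
    (R := fun v : Fin 4 → ℕ => ∃ x y, (v 1).testBit (natPair (v 0) x) = true ∧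
      (v 2).testBit (natPair (v 0) y) = true ∧ P x y (v 3)) ?_ ![a, b, c], ?_⟩
  · have h' {k : ℕ} {f₀ f₁ f₂ : (Fin k → ℕ) → ℕ} {g₀ g₁ g₂ : (Fin k → M) → M} (h₀ : CorrF f₀ g₀)
      (h₁ : CorrF f₁ g₁) (h₂ : CorrF f₂ g₂) :
      Corr (fun v => P (f₀ v) (f₁ v) (f₂ v)) (fun v => Q (g₀ v) (g₁ v) (g₂ v)) :=
      Corr.rel₃ h h₀ h₁ h₂
    refine Corr.ex (Corr.ex (Corr.and (Corr.mem ?_ ?_) (Corr.and (Corr.mem ?_ ?_) (h' ?_ ?_ ?_))))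
    all_goals apply_rules [CorrF.natPair, CorrF.var]
  · ext ω
    constructor
    · intro h
      exact ⟨_, _, (ha.1 ω _).2 rfl, (hb.1 ω _).2 rfl, h⟩
    · rintro ⟨x, y, hx, hy, h⟩
      have hx' := (ha.1 ω x).1 hx
      have hy' := (hb.1 ω y).1 hy
      subst hx' hy'
      exact h

theorem realize_powTerm {β : Type*} (t : LA.Term β) (k : ℕ) (v : β → M) :
    (powTerm t k).realize v = powM (t.realize v) k := by
  induction k with
  | zero => rfl
  | succ k ih => simp [powTerm, powM, ih]

theorem truth_not {Ω : Set M} (F : Set (RV Ω)) {β : Type*} {k : ℕ} (φ : LA.BoundedFormula β k)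
    (v : β → F) (xs : Fin k → F) : truth F (∼φ) v xs = (truth F φ v xs)ᶜ :=
  sup_bot_eq _

theorem truth_inf {Ω : Set M} (F : Set (RV Ω)) {β : Type*} {k : ℕ} (φ ψ : LA.BoundedFormula β k)
    (v : β → F) (xs : Fin k → F) : truth F (φ ⊓ ψ) v xs = truth F φ v xs ⊓ truth F ψ v xs := by
  have : truth F (φ ⊓ ψ) v xs = ((truth F φ v xs)ᶜ ⊔ (truth F (∼ψ) v xs))ᶜ :=
    truth_not F (φ.imp (∼ψ)) v xs
  rw [this, truth_not, compl_sup, compl_compl, compl_compl]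

/-- A meet is 1 only if all its members are, so value 1 can be tested on the exceptional events
separately for each y. The first condition does not depend on y; it stands under the quantifier
because the formula is prenex. -/
theorem truthAt_formulaA_eq_top (hM : M ≅[LA] ℕ) (hs : Aleph1Saturated M) {F : Set (RV (cube n))}
    (ι u : F) (k : ℕ) : truthAt F (formulaA ι k) u = ⊤ ↔
      ∀ y : F, Infinitesimal {ω : cube n | ¬ leM (powM (lenM ((u : RV (cube n)) ω)) k)
        (lenM ((ι : RV (cube n)) ω))} ∧
      Infinitesimal {ω : cube n | lenM ((y : RV (cube n)) ω) = (u : RV (cube n)) ω} := by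
  rw [truthAt, formulaA, truth_all_eq_top hM hs]
  refine forall_congr' fun y => ?_
  rw [truth_inf, inf_eq_top_iff, truth_not, compl_eq_top]
  refine and_congr ?_ ?_
  · refine (cls_eq_top hM).trans (iff_of_eq (congrArg Infinitesimal ?_))
    ext ω
    refine not_congr (iff_of_eq (congrArg (Structure.RelMap leS) ?_))
    funext i
    fin_cases i
    · exact (realize_powTerm _ _ _).trans (by simp)
    · simp
  · refine (cls_eq_bot hM).trans (iff_of_eq (congrArg Infinitesimal ?_))
    ext ω
    simp [Fin.snoc]

theorem isUniversal_formulaA {Ω : Set M} {F : Set (RV Ω)} (ι : F) (k : ℕ) :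
    (formulaA ι k).IsUniversal :=
  .all (.of_isQF (BoundedFormula.IsQF.inf (BoundedFormula.IsAtomic.rel _ _).isQF
    (BoundedFormula.IsAtomic.equal _ _).isQF.not))

theorem infinitesimal_empty (hM : M ≅[LA] ℕ) {U : Set (cube n)} (h : ∀ ω, ω ∉ U) :
    Infinitesimal U := by
  rw [eq_empty_of_forall_notMem h]
  exact (infinitesimal_iff hM ⊥).2 (isSmall_bot hM)

/-- Most strings are longer than half of the maximal length. -/
theorem infinitesimal_short (hM : M ≅[LA] ℕ) (hn : Nonstandard n) (U : events (cube n))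
    (h : ∀ ω ∈ (U : Set (cube n)), ¬ leM n (mulM (num M 2) (lenM (ω : M)))) :
    Infinitesimal (U : Set (cube n)) := by
  rw [infinitesimal_iff hM]
  intro j
  obtain ⟨N, hN⟩ := card_short_le j
  refine Corr.transfer (R := fun v : Fin 3 → ℕ => N ≤ v 0 →
      (∀ ω : ℕ, (v 1).testBit ω = true → 2 * Nat.size ω < v 0) →
      (∀ ω : ℕ, (v 2).testBit ω = true ↔ Nat.size ω ≤ v 0) →
      j * (bits (v 1)).card ≤ 1 * (bits (v 2)).card)
    (S := fun v => leM (num M N) (v 0) →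
      (∀ ω, MMem ω (v 1) → ¬ leM (v 0) (mulM (num M 2) (lenM ω))) →
      (∀ ω, MMem ω (v 2) ↔ leM (lenM ω) (v 0)) → FracM j 1 (v 1) (v 2)) ?_ hM
    (fun v h1 h2 h3 => by rw [one_mul]; exact hN _ h1 _ _ h2 h3)
    ![n, code (U : Set (cube n)), topCode n] (hn.num_le hM N)
    (mem_code_imp hM h) (fun ω => ⟨mem_code_imp hM (fun ω _ => ω.2) ω,
      fun hω => (mem_code hM ⊤ ⟨ω, hω⟩).2 trivial⟩)
  refine Corr.imp (Corr.le (CorrF.const N) (CorrF.var _)) (Corr.imp (Corr.all (Corr.imp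
    (Corr.mem (CorrF.var _) (CorrF.var _)) (Corr.lt (CorrF.mul (CorrF.const 2)
      (CorrF.size (CorrF.var _))) (CorrF.var _)))) (Corr.imp (Corr.all (Corr.iff
    (Corr.mem (CorrF.var _) (CorrF.var _)) (Corr.le (CorrF.size (CorrF.var _)) (CorrF.var _))))
    (Corr.frac j 1 (CorrF.var _) (CorrF.var _))))

/-- Finitely many of the formulas are realized by a constant. -/
theorem exists_truthAt_formulaA_eq_top (hM : M ≅[LA] ℕ) (hs : Aleph1Saturated M)
    (hn : Nonstandard n) {ι : circuitFamily n} (hι : ∀ ω : cube n, (ι : RV (cube n)) ω = ω) (K : ℕ) :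
    ∃ u : circuitFamily n, ∀ k ≤ K, truthAt (circuitFamily n) (formulaA ι k) u = ⊤ := by
  -- The formula with index K has exponent K + 1.
  obtain ⟨N, hN⟩ := exists_large_const (K + 1) (by lia)
  obtain ⟨w, hw, hwn, hwb⟩ : ∃ w, leM (lenM w) n ∧ leM (mulM (num M 2) (powM (lenM w) K)) n ∧
      ∀ b, SubM (2 * (K + 1)) n b → ∀ ω v, leM (lenM ω) n → MMem (pairM ω v) b → ¬ lenM v = w := by
    refine Corr.transfer (R := fun v : Fin 1 → ℕ => N ≤ v 0 → ∃ w : ℕ, Nat.size w ≤ v 0 ∧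
        2 * Nat.size w ^ (K + 1) ≤ v 0 ∧ ∀ b : ℕ, SubexpComputable (2 * (K + 1)) (v 0) b →
        ∀ ω y : ℕ, Nat.size ω ≤ v 0 → b.testBit (natPair ω y) = true → ¬ Nat.size y = w)
      (S := fun v => leM (num M N) (v 0) → ∃ w, leM (lenM w) (v 0) ∧
        leM (mulM (num M 2) (powM (lenM w) K)) (v 0) ∧ ∀ b, SubM (2 * (K + 1)) (v 0) b →
        ∀ ω y, leM (lenM ω) (v 0) → MMem (pairM ω y) b → ¬ lenM y = w) ?_ hM
      (fun v hv => hN _ hv) ![n] (hn.num_le hM N)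
    apply_rules (maxDepth := 500) [Corr.not, Corr.and, Corr.imp, Corr.all, Corr.ex, Corr.le,
      Corr.eq, Corr.subexp, CorrF.pow, CorrF.mul, Corr.mem, CorrF.var, CorrF.natPair, CorrF.size,
      CorrF.const]
  obtain ⟨u, hu⟩ := exists_const_mem hM hn hw
  refine ⟨u, fun k hk => (truthAt_formulaA_eq_top hM hs ι u k).2 fun y => ⟨?_, ?_⟩⟩
  -- Where n ≤ 2|ω|, the bound 2|w|^(K+1) ≤ n gives |w|^(k+1) ≤ |ω|; so the inequality can fail only
  -- at short strings.
  · refine infinitesimal_short hM hn ⟨_, relation_mem_events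
      (P := fun a b _ => ¬ Nat.size a ^ (k + 1) ≤ Nat.size b)
      (Q := fun a b _ => ¬ leM (powM (lenM a) k) (lenM b)) (Corr.not (Corr.le (CorrF.pow k
        (CorrF.size (CorrF.var 0))) (CorrF.size (CorrF.var 1)))) u ι n⟩ fun ω hω hlt => hω ?_
    rw [hu, hι]
    refine Corr.transfer (R := fun v : Fin 3 → ℕ => 2 * Nat.size (v 1) ^ (K + 1) ≤ v 0 →
        v 0 ≤ 2 * Nat.size (v 2) → Nat.size (v 1) ^ (k + 1) ≤ Nat.size (v 2))
      (S := fun v => leM (mulM (num M 2) (powM (lenM (v 1)) K)) (v 0) →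
        leM (v 0) (mulM (num M 2) (lenM (v 2))) → leM (powM (lenM (v 1)) k) (lenM (v 2))) ?_ hM
      (fun v h1 h2 => ?_) ![n, w, ω] hwn hlt
    · apply_rules [Corr.imp, Corr.le, CorrF.pow, CorrF.mul, CorrF.size, CorrF.const, CorrF.var]
    · rcases Nat.eq_zero_or_pos (Nat.size (v 1)) with h0 | h0
      · rw [h0]; simp
      · have := Nat.pow_le_pow_right h0 (Nat.succ_le_succ hk)
        simp only [Nat.succ_eq_add_one] at this
        lia
  -- Membership of y in the family is used only at exponent 2(K + 1), where w is too large to be a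
  -- length at any sample.
  · refine infinitesimal_empty hM fun ω hω => ?_
    obtain ⟨y, b, hb, hy⟩ := y
    exact hwb b (hy _ (by lia)) ω _ ω.2 ((hb.1 ω _).2 rfl) (hω.trans (hu ω))

theorem leM_trans (hM : M ≅[LA] ℕ) {a b c : M} (h : leM a b) (h' : leM b c) : leM a c :=
  Corr.transfer (R := fun v : Fin 3 → ℕ => v 0 ≤ v 1 → v 1 ≤ v 2 → v 0 ≤ v 2)
    (S := fun v => leM (v 0) (v 1) → leM (v 1) (v 2) → leM (v 0) (v 2)) (by
      apply_rules [Corr.imp, Corr.le, CorrF.var]) hM (fun v => le_trans) ![a, b, c] h h'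

/-- The integer part of the root of order N + 1 in M; it serves as the approximate solution when
saturation is applied. -/
theorem exists_rootM (hM : M ≅[LA] ℕ) (n : M) (N : ℕ) :
    ∃ m, (∀ k ≤ N, leM (powM m k) n) ∧ ∀ x, leM (powM x N) n → leM x m := by
  obtain ⟨m, h, h'⟩ : ∃ m, leM (powM m N) n ∧ ∀ x, leM (powM x N) n → leM x m := by
    refine Corr.transfer (R := fun v : Fin 1 → ℕ => ∃ m : ℕ, m ^ (N + 1) ≤ v 0 ∧
        ∀ x : ℕ, x ^ (N + 1) ≤ v 0 → x ≤ m)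
      (S := fun v => ∃ m, leM (powM m N) (v 0) ∧ ∀ x, leM (powM x N) (v 0) → leM x m) ?_ hM
      (fun v => ?_) ![n]
    · apply_rules [Corr.ex, Corr.all, Corr.and, Corr.imp, Corr.le, CorrF.pow, CorrF.var]
    · obtain ⟨R, h1, -, h2⟩ := exists_root (N + 1) (v 0) (by lia)
      exact ⟨R, h1, h2⟩
  refine ⟨m, fun k hk => leM_trans hM ?_ h, h'⟩
  refine Corr.transfer (R := fun v : Fin 1 → ℕ => v 0 ^ (k + 1) ≤ v 0 ^ (N + 1))
    (S := fun v => leM (powM (v 0) k) (powM (v 0) N)) ?_ hM (fun v => ?_) ![m]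
  · apply_rules [Corr.le, CorrF.pow, CorrF.var]
  · rcases Nat.eq_zero_or_pos (v 0) with h0 | h0
    · rw [h0]; simp
    · exact Nat.pow_le_pow_right h0 (by lia)

/-- The function `ones` in `M`. -/
def onesM (m v : M) : M := interpF (fun v : Fin 3 → ℕ => ones (v 0) (v 1)) ![m, v, v]

theorem corrF_ones (hM : M ≅[LA] ℕ) : CorrF (fun v : Fin 3 → ℕ => ones (v 0) (v 1))
    (fun v : Fin 3 → M => onesM (v 0) (v 1)) := by
  refine CorrF.comp₂ (p := ones) (q := onesM) ?_ (CorrF.var 0) (CorrF.var 1)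
  exact ⟨(arithF_ones.corrF hM).graph.comp (n := 3)
    (f := fun i v => ![v 0, v 1, v 2, v 2] i) (g := fun i v => ![v 0, v 1, v 2, v 2] i)
    (fun i => by fin_cases i <;> exact CorrF.var _) |>.congr (fun v => Iff.rfl) fun v => by
      refine iff_of_eq (congrArg _ ?_)
      unfold onesM
      congr 1⟩

theorem lenM_onesM (hM : M ≅[LA] ℕ) {m v : M} (h : leM (lenM v) m) : lenM (onesM m v) = v := by
  refine Corr.transfer (R := fun v : Fin 3 → ℕ => Nat.size (v 1) ≤ v 0 →
      Nat.size (ones (v 0) (v 1)) = v 1)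
    (S := fun v => leM (lenM (v 1)) (v 0) → lenM (onesM (v 0) (v 1)) = v 1) ?_ hM
    (fun v h => size_ones (Nat.size_le.1 h).le) ![m, v, v] h
  have := corrF_ones hM
  apply_rules [Corr.imp, Corr.le, Corr.eq, CorrF.size, CorrF.var]

/-- No element of `K(F)` satisfies all the formulas. -/
theorem exists_truthAt_formulaA_ne_top (hM : M ≅[LA] ℕ) (hs : Aleph1Saturated M)
    (hn : Nonstandard n) {ι : circuitFamily n} (hι : ∀ ω : cube n, (ι : RV (cube n)) ω = ω)
    (u : circuitFamily n) : ∃ k, truthAt (circuitFamily n) (formulaA ι k) u ≠ ⊤ := by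
  by_contra! h
  simp only [truthAt_formulaA_eq_top hM hs] at h
  let E (m : M) : events (cube n) := ⟨_, relation_mem_events
    (P := fun a _ c => ¬ Nat.size a ≤ c) (Q := fun a _ c => ¬ leM (lenM a) c)
    (Corr.not (Corr.le (CorrF.size (CorrF.var 0)) (CorrF.var 2))) u u m⟩
  obtain ⟨b, hb, -⟩ := u.2
  -- The event |u| > m is covered by an M-finite set d of measure at most 1/4. Stated through the
  -- graph b of u, this is first order in m.
  let D (k : ℕ) : Set M := {m | leM (powM m k) n ∧ ∃ d, (∀ x, leM (lenM x) n →
    (∃ v, MMem (pairM x v) b ∧ ¬ leM (lenM v) m) → MMem x d) ∧ FracM 4 1 d (topCode n)}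
  have hD (k : ℕ) : (univ : Set M).Definable₁ LA (D k) := by
    refine Corr.definable₁ (S := fun v => leM (powM (v 0) k) (v 1) ∧ ∃ d, (∀ x, leM (lenM x) (v 1) →
        (∃ y, MMem (pairM x y) (v 2) ∧ ¬ leM (lenM y) (v 0)) → MMem x d) ∧ FracM 4 1 d (v 3))
      (R := fun v : Fin 4 → ℕ => v 0 ^ (k + 1) ≤ v 1 ∧ ∃ d : ℕ, (∀ x : ℕ, Nat.size x ≤ v 1 →
        (∃ y : ℕ, (v 2).testBit (natPair x y) = true ∧ ¬ Nat.size y ≤ v 0) →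
          d.testBit x = true) ∧ 4 * (bits d).card ≤ 1 * (bits (v 3)).card) ?_ ![n, b, topCode n]
    apply_rules (maxDepth := 500) [Corr.not, Corr.and, Corr.imp, Corr.all, Corr.ex, Corr.le,
      CorrF.pow, Corr.mem, Corr.frac, CorrF.var, CorrF.natPair, CorrF.size]
  obtain ⟨m, hm⟩ := hs.exists_mem hD fun N => by
    obtain ⟨m, h1, h2⟩ := exists_rootM hM n N
    refine ⟨m, fun k hk => ⟨h1 k hk, code (E m : Set (cube n)), ?_, ?_⟩⟩
    · rintro x hx ⟨v, hv, hv'⟩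
      rw [(hb.1 ⟨x, hx⟩ v).1 hv] at hv'
      exact (mem_code hM (E m) ⟨x, hx⟩).2 hv'
    · let A : events (cube n) := ⟨_, relation_mem_events
        (P := fun a b _ => ¬ Nat.size a ^ (N + 1) ≤ Nat.size b)
        (Q := fun a b _ => ¬ leM (powM (lenM a) N) (lenM b)) (Corr.not (Corr.le (CorrF.pow N
          (CorrF.size (CorrF.var 0))) (CorrF.size (CorrF.var 1)))) u ι n⟩
      -- If |u(ω)|^(N+1) ≤ |ω| ≤ n, then |u(ω)| is at most the integer root m; so |u| > m is
      -- contained in an infinitesimal event.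
      have hA : E m ≤ A := fun ω hω hle => hω (h2 _ (by
        rw [hι] at hle
        exact leM_trans hM hle ω.2))
      exact ((infinitesimal_iff hM A).1 (h N ι).1 4).mono hM hA
  -- Here all the bounds m^(k+1) ≤ n are needed at once: they keep 2^m output bits within every size
  -- bound of the family.
  obtain ⟨y, hy⟩ := polyOp_ones.exists_mem hM hn (opM := fun m a _ => onesM m a) (corrF_ones hM)
    (fun k => (hm k).1) u u
  obtain ⟨d, hd, hd'⟩ := (hm 0).2
  have hE : IsSmall 4 (E m) := FracM.mono hM (mem_code_imp hM fun ω hω =>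
    hd ω ω.2 ⟨_, (hb.1 ω _).2 rfl, hω⟩) hd'
  let G : events (cube n) := ⟨_, relation_mem_events (P := fun a b _ => Nat.size a = b)
    (Q := fun a b _ => lenM a = b) (Corr.eq (CorrF.size (CorrF.var 0)) (CorrF.var 1)) y u n⟩
  have hG : IsSmall 4 G := (infinitesimal_iff hM G).1 (h 0 y).2 4
  -- The sample space is covered by the events |u| > m and |y| = u, each of measure at most 1/4,
  -- although its measure is 1.
  have htop : IsSmall 2 (⊤ : events (cube n)) := by
    refine IsSmall.union hM (fun ω _ => ?_) hE hG
    by_cases hω : leM (lenM ((u : RV (cube n)) ω)) m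
    · exact Or.inr (show lenM ((y : RV (cube n)) ω) = _ by rw [hy, lenM_onesM hM hω])
    · exact Or.inl hω
  obtain ⟨x, hx⟩ := exists_mem_topCode hM n
  exact not_fracM_succ hM (fun x h => h) hx htop

/-- Every finite part is satisfied with value 1 by some constant, so the left side of (Satur) is 1,
and a realizing element would give value 1 to all formulas. -/
theorem not_realizesSatur (hM : M ≅[LA] ℕ) (hs : Aleph1Saturated M)
    (hn : Nonstandard n) {ι : circuitFamily n} (hι : ∀ ω : cube n, (ι : RV (cube n)) ω = ω)
    (u : circuitFamily n) : ¬ RealizesSatur (circuitFamily n) (range (formulaA ι)) u := by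
  intro h
  have htop : meet {b | ∃ Φ : Finset (FormulaF (circuitFamily n)),
      (Φ : Set (FormulaF (circuitFamily n))) ⊆ range (formulaA ι) ∧ b = join {c | ∃ w, c =
        Φ.inf (fun A => truthAt (circuitFamily n) A w)}} = ⊤ := by
    classical
    rw [meet_eq_top hM hs]
    rintro _ ⟨Φ, hΦ, rfl⟩
    rw [← image_univ, Finset.subset_set_image_iff] at hΦ
    obtain ⟨T, -, rfl⟩ := hΦ
    obtain ⟨w, hw⟩ := exists_truthAt_formulaA_eq_top hM hs hn hι (T.sup id)
    refine top_le_iff.1 (.trans ?_ ((isLUB_join hM hs _).1 ⟨w, rfl⟩))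
    refine Finset.le_inf fun A hA => ?_
    obtain ⟨k, hk, rfl⟩ := Finset.mem_image.1 hA
    exact (hw k (Finset.le_sup (f := id) hk)).ge
  rw [RealizesSatur, htop, top_le_iff, meet_eq_top hM hs] at h
  obtain ⟨k, hk⟩ := exists_truthAt_formulaA_ne_top hM hs hn hι u
  exact hk (h _ ⟨_, ⟨k, rfl⟩, rfl⟩)

end Failure

end

theorem mainTheorem3 :
    Finite LA.Symbols ∧
    (∃ (M : Type) (_ : LA.Structure M), (M ≅[LA] ℕ) ∧ Aleph1Saturated M ∧
      ∃ n : M, Nonstandard n) ∧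
    ∀ (M : Type*) [LA.Structure M], (M ≅[LA] ℕ) → Aleph1Saturated M →
      ∀ n : M, Nonstandard n →
        (∀ S : Set (TruthAlg (cube n)), ∃ b, IsLUB S b) ∧
        LClosed (circuitFamily n) ∧
        CasesClosed (circuitFamily n) ∧
        CompactFamily (circuitFamily n) ∧
        HasPairing (circuitFamily n) ∧
        ∃ ι : circuitFamily n, (∀ ω : cube n, (ι : RV (cube n)) ω = ω) ∧
          (range (formulaA ι)).Countable ∧
          (∀ A ∈ range (formulaA ι), A.IsUniversal) ∧
          ¬ ∃ u : circuitFamily n,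
            RealizesSatur (circuitFamily n) (range (formulaA ι)) u := by
  refine ⟨finite_LA_symbols, ⟨UltraNat, inferInstance, ultraNat_equiv, ultraNat_saturated,
    exists_nonstandard_ultraNat⟩, fun M _ hM hs n hn => ⟨exists_isLUB hM hs,
    lClosed_circuitFamily hM hn, casesClosed_circuitFamily hM hn, compactFamily_circuitFamily hM,
    hasPairing hM hs _, ?_⟩⟩
  obtain ⟨ι, hι⟩ := exists_id_mem hM hn
  refine ⟨ι, hι, countable_range _, ?_, fun ⟨u, hu⟩ => not_realizesSatur hM hs hn hι u hu⟩
  rintro _ ⟨k, rfl⟩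
  exact isUniversal_formulaA ι k
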